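/- Let $k \ge 1$ be an integer and let $\Sigma = \{a_1, \dots, a_k\}$ be an alphabet with $k$ letters. A *pattern* is a finite word over $\mathbb{N} = \{1, 2, 3, \dots\}$; its symbols are called *variables*, $\operatorname{var}(\alpha)$ denotes the set of variables occurring in $\alpha$, and $|\alpha|_x$ denotes the number of occurrences of $x$ in $\alpha$. A pattern is *in canonical form* if it is lexicographically minimal (with respect to $1 < 2 < 3 < \cdots$) among all patterns obtained from it by an injective renaming $\mathbb{N} \to \mathbb{N}$ of its variables. Let $B'(k,2)$ be the set of all words $w \in \Sigma^*$ in which each of the $k^2$ words of length $2$ over $\Sigma$ occurs exactly once as a factor (non-cyclic de Bruijn sequences of order $2$). Let $\Pi_{DB}(k)$ be the set of all patterns $\alpha$ in canonical form for which there are a word $w \in B'(k,2)$ and pairwise disjoint finite sets $N_1, \dots, N_k \subseteq \mathbb{N}$ such that, writing $n_j$ for the number of occurrences of $a_j$ in $w$, one has $|N_j| = \lfloor n_j/2 \rfloor$ for every $j$, the pattern $\alpha$ is obtained from $w$ by replacing every occurrence of every letter $a_j$ by some variable from $N_j$ (different occurrences may receive different variables), and $|\alpha|_x > 1$ for every $j$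 and every $x \in N_j$. Then $$|\Pi_{DB}(k)| \ \ge\ (k!)^{k-1},$$ and, for every $\alpha \in \Pi_{DB}(k)$, $$|\operatorname{var}(\alpha)| \ =\ (k-1)\lfloor k/2 \rfloor + \lfloor (k+1)/2 \rfloor .$$ -/

import Mathlib

/-- A pattern: a finite word over the variables `1, 2, 3, …`. -/
abbrev Pattern : Type := List ℕ+

/-- The set of variables that occur in a pattern. -/
def Pattern.vars (α : Pattern) : Finset ℕ+ := α.toFinset

/-- A pattern is in canonical form if it is lexicographically minimal among all its renamings,
a renaming being the image under a morphism induced by an injective map of the variables. -/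
def Pattern.IsCanonical (α : Pattern) : Prop :=
  ∀ h : ℕ+ → ℕ+, Function.Injective h → α ≤ α.map h

/-- `v` occurs exactly once as a factor of `w`: there is exactly one factorisation
`w = u₁ v u₂`. -/
def OccursExactlyOnce {A : Type*} (v w : List A) : Prop :=
  ∃! u : List A × List A, w = u.1 ++ v ++ u.2

/-- The set `B'(k, n)` of non-cyclic de Bruijn sequences of order `n` over an alphabet with `k`
letters: each word of length `n` appears exactly once as a factor. -/
def nonCyclicDeBruijn (k n : ℕ) : Set (List (Fin k)) :=
  {w | ∀ v : List (Fin k), v.length = n → OccursExactlyOnce v w}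

/-- The set `Π_DB(k)`: patterns in canonical form that arise from some `w ∈ B'(k, 2)` by replacing
each occurrence of each letter `j` by some variable of `N j`, where the sets `N j` are pairwise
disjoint, `N j` has `⌊n_j / 2⌋` elements for `n_j` the number of occurrences of `j` in `w`, and each
variable of each `N j` occurs more than once in the pattern. -/
def PiDB (k : ℕ) : Set Pattern :=
  {α | ∃ w ∈ nonCyclicDeBruijn k 2, ∃ N : Fin k → Finset ℕ+,
    (∀ j, (N j).card = w.count j / 2) ∧
    List.Forall₂ (fun j x => x ∈ N j) w α ∧
    (∀ j, ∀ x ∈ N j, 1 < α.count x) ∧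
    (∀ i i', i ≠ i' → Disjoint (N i) (N i')) ∧
    α.IsCanonical}

/-! A word of `B'(k,2)` is a walk through all arcs of the complete digraph with loops on `k`
letters. Each letter starts `k` arcs, and the last letter occurs once more, so it occurs `k + 1`
times. All variables of all `N j` occur and the `N j` are disjoint, so adding their sizes gives the
exact number of variables.

For the lower bound, labelled Eulerian circuits are counted against the patterns they produce. A
circuit is given by a transition system `T` (the arc `(c, e)` is followed by `(e, T e c)`) and a
first arc `x`. For an involution `σ` with at most one fixed letter, each position is labelled by the
pair `{f, σ f}` of the next letter `f`; a variable is a letter together with a label. The pattern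
shows that occurrences of `e` followed by `f` and by `σ f` are the same letter, so each `e` carries
a matching `pulledBack σ T e` of its predecessors. Moreover the occurrences of `c` before `e` and
before `σ e` share a variable, so what is learned at `σ e` carries over to `e`. If the two matchings
at `e` and `σ e` together are transitive (`LinkedAt`), all occurrences of `e` are identified. If
this holds for all pairs, the walk is known up to one of `k!` renamings
(`IsScheme.exists_renaming`).

Three counts enter. Rotor walks whose last exits form a tree give `k!^k ≤ #T * k^2`, one half of the
BEST theorem (`factorial_pow_le_card_eulerian`). Changing `T` at one letter multiplies a return
permutation, so Eulerian changes correspond to full cycles; the share of full cycles that link two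
matchings is bounded below by deleting points (`linkCount`), and the pairs of `σ` are treated one
after another (`pow_mul_card_le_card_linkedAt`). Finally there are `k! / (2^h h!)` choices of `σ`,
where `h = k / 2`. An inequality between double factorials finishes the even case.

For odd `k = 2h + 1` the exits to the fixed letter of `σ` are added to pairs chosen by a function
`g`. This gains `h^(2h)` choices, but costs a factor `3^(2h)` for guessing those exits in the
pattern and a factor `2` for the choice of the second letter. The balance is sufficient for `k ≥ 7`;
the cases `k = 1, 3, 5` use other labellings. -/

/-! ### Canonical form: numbering letters by first occurrence. -/

/-- A word over `ℕ+` has restricted growth above `m` if each letter exceeds the maximum of `m` and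
the preceding letters by at most one. -/
def IsRestrictedGrowth : ℕ → List ℕ+ → Prop
  | _, [] => True
  | m, x :: l => (x : ℕ) ≤ m + 1 ∧ IsRestrictedGrowth (max m x) l

/-- As long as `h` fixes the values up to `m`, injectivity forbids it to send a new letter to one of
them. The new letter is at most `m + 1`, so its image is not smaller, and the first moved letter
grows. -/
theorem IsRestrictedGrowth.le_map {h : ℕ+ → ℕ+} (hh : Function.Injective h) :
    ∀ {l : List ℕ+} {m : ℕ}, IsRestrictedGrowth m l → (∀ x : ℕ+, (x : ℕ) ≤ m → h x = x) →
      l ≤ l.map h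
  | [], _, _, _ => le_rfl
  | x :: l, m, hl, hm => by
    obtain ⟨h1, h2⟩ := hl
    rw [List.map_cons]
    have key : x = h x ∨ x < h x := by
      rcases Nat.lt_or_ge m (x : ℕ) with hx | hx
      · by_contra hcon
        push Not at hcon
        have hlt : h x < x := lt_of_le_of_ne hcon.2 (Ne.symm hcon.1)
        have : (h x : ℕ) < x := hlt
        have h3 : h (h x) = h x := hm _ (by omega)
        exact hcon.1 (hh h3).symm
      · exact Or.inl (hm x hx).symm
    rcases key with hx | hx
    · rw [← hx]
      have := h2.le_map hh (fun y hy => by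
        rcases Nat.lt_or_ge m (y : ℕ) with hy' | hy'
        · have : (y : ℕ) = x := by
            rcases Nat.le_total m (x : ℕ) with h4 | h4
            · rw [max_eq_right h4] at hy; omega
            · rw [max_eq_left h4] at hy; omega
          have : y = x := PNat.eq this
          rw [this, ← hx]
        · exact hm y hy')
      rcases this.lt_or_eq with h5 | h5
      · exact le_of_lt (List.Lex.cons h5)
      · rw [← h5]
    · exact le_of_lt (List.Lex.rel hx)

theorem exists_first_occurrence {A : Type*} {β : List A} {x : A} (hx : x ∈ β) :
    ∃ p q, β = p ++ x :: q ∧ x ∉ p := by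
  obtain ⟨p, q, h1, h2⟩ := List.eq_append_cons_of_mem hx
  exact ⟨p, q, h1, h2⟩

section code

variable {A : Type*} [DecidableEq A]

/-- The number of distinct letters that occur in `β` before the first occurrence of `x`. -/
def firstRank (β : List A) (x : A) : ℕ := (β.takeWhile (fun y => y ≠ x)).toFinset.card

theorem takeWhile_ne_append {p q : List A} {x : A} (hx : x ∉ p) :
    (p ++ x :: q).takeWhile (fun y => y ≠ x) = p := by
  rw [List.takeWhile_append_of_pos]
  · simp
  · intro a ha
    simp only [ne_eq, decide_not, Bool.not_eq_eq_eq_not, Bool.not_true, decide_eq_false_iff_not]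
    rintro rfl
    exact hx ha

theorem firstRank_lt_of_mem {p q : List A} {x : A} (hx : x ∈ p) :
    firstRank (p ++ q) x < p.toFinset.card := by
  obtain ⟨a, b, rfl, ha⟩ := exists_first_occurrence hx
  unfold firstRank
  rw [List.append_assoc, List.cons_append, takeWhile_ne_append ha]
  apply Finset.card_lt_card
  refine ⟨fun y hy => by simp at hy ⊢; tauto, fun h => ha ?_⟩
  have := @h x (by simp)
  simpa using this

/-- Of two different letters, the one that occurs first is counted in the rank of the other but not
in its own. -/
theorem firstRank_injOn (β : List A) {x y : A} (hx : x ∈ β) (hy : y ∈ β)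
    (h : firstRank β x = firstRank β y) : x = y := by
  obtain ⟨p, q, hp, hxp⟩ := exists_first_occurrence hx
  obtain ⟨p', q', hp', hyp⟩ := exists_first_occurrence hy
  by_contra hne
  have h1 : firstRank β x = p.toFinset.card := by
    rw [hp, firstRank, takeWhile_ne_append hxp]
  have h2 : firstRank β y = p'.toFinset.card := by
    rw [hp', firstRank, takeWhile_ne_append hyp]
  by_cases hxp' : x ∈ p'
  · have := firstRank_lt_of_mem (q := y :: q') hxp'
    rw [← hp'] at this
    omega
  · by_cases hyp' : y ∈ p
    · have := firstRank_lt_of_mem (q := x :: q) hyp'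
      rw [← hp] at this
      omega
    · have e1 : β = p ++ x :: q := hp
      rw [hp', List.append_eq_append_iff] at e1
      rcases e1 with ⟨a, ha, hb⟩ | ⟨a, ha, hb⟩
      · cases a with
        | nil => simp at hb; exact hne hb.1.symm
        | cons z a => simp at hb; apply hyp'; rw [ha, hb.1]; simp
      · cases a with
        | nil => simp at hb; exact hne hb.1
        | cons z a => simp at hb; apply hxp'; rw [ha, hb.1]; simp

/-- The pattern in canonical form with the same repetition structure as the word `β`: the letters
of `β` are numbered in the order of their first occurrences. -/
def canonicalCode (β : List A) : Pattern := β.map fun x => (firstRank β x).succPNat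

/-- The prefix `p` is general for the sake of induction: its number of distinct letters is the
maximum code used so far. -/
theorem isRestrictedGrowth_canonicalCode_aux (q : List A) : ∀ p : List A,
    IsRestrictedGrowth p.toFinset.card (q.map fun x => (firstRank (p ++ q) x).succPNat) := by
  induction q with
  | nil => intro p; trivial
  | cons x q ih =>
    intro p
    have h := ih (p ++ [x])
    rw [List.append_assoc, List.singleton_append] at h
    rw [List.map_cons]
    by_cases hx : x ∈ p
    · have h1 := firstRank_lt_of_mem (q := x :: q) hx
      have h2 : (p ++ [x]).toFinset = p.toFinset := by ext; simp; rintro rfl; exact hx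
      refine ⟨by rw [Nat.succPNat_coe]; omega, ?_⟩
      rw [max_eq_left (by rw [Nat.succPNat_coe]; omega), ← h2]
      exact h
    · have h1 : firstRank (p ++ x :: q) x = p.toFinset.card := by
        rw [firstRank, takeWhile_ne_append hx]
      have h2 : (p ++ [x]).toFinset.card = p.toFinset.card + 1 := by
        have : (p ++ [x]).toFinset = insert x p.toFinset := by ext; simp
        rw [this, Finset.card_insert_of_notMem (by simpa using hx)]
      refine ⟨by rw [Nat.succPNat_coe]; omega, ?_⟩
      rw [max_eq_right (by rw [Nat.succPNat_coe]; omega), Nat.succPNat_coe, h1,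
        Nat.succ_eq_add_one, ← h2]
      exact h

theorem isCanonical_canonicalCode (β : List A) : (canonicalCode β).IsCanonical := by
  intro h hh
  have := isRestrictedGrowth_canonicalCode_aux β []
  exact IsRestrictedGrowth.le_map hh this (fun x hx => by
    have := x.pos
    simp at hx)

theorem getElem_canonicalCode_eq_iff (β : List A) {i j : ℕ} (hi : i < β.length)
    (hj : j < β.length) :
    (canonicalCode β)[i]'(by simpa [canonicalCode] using hi) =
      (canonicalCode β)[j]'(by simpa [canonicalCode] using hj) ↔ β[i] = β[j] := by
  simp only [canonicalCode, List.getElem_map]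
  constructor
  · intro h
    exact firstRank_injOn β (List.getElem_mem hi) (List.getElem_mem hj)
      (Nat.succPNat_injective h)
  · intro h; rw [h]

end code

/-- If a variable exceeds the length, some smaller one does not occur, and exchanging the two gives
a lexicographically smaller pattern. -/
theorem Pattern.IsCanonical.le_length {α : Pattern} (hα : α.IsCanonical) {x : ℕ+} (hx : x ∈ α) :
    (x : ℕ) ≤ α.length := by
  by_contra hlt
  push Not at hlt
  have hy : ∃ y : ℕ+, (y : ℕ) ≤ α.length ∧ y ∉ α := by
    by_contra hcon
    push Not at hcon
    -- Otherwise `1, …, |α|` and `x` would be `|α| + 1` different variables of `α`.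
    have h1 : insert x (Finset.Icc (1 : ℕ+) (α.length.toPNat (List.length_pos_of_mem hx))) ⊆ α.toFinset := by
      intro z hz
      rw [Finset.mem_insert] at hz
      rw [List.mem_toFinset]
      rcases hz with rfl | hz
      · exact hx
      · exact hcon z (Finset.mem_Icc.1 hz).2
    have h2 := Finset.card_le_card h1
    rw [Finset.card_insert_of_notMem (by
      intro hz
      have : (x : ℕ) ≤ α.length := (Finset.mem_Icc.1 hz).2
      omega), PNat.card_Icc] at h2
    have := List.toFinset_card_le α
    simp only [PNat.val_ofNat, Nat.toPNat] at h2
    change α.length + 1 - 1 + 1 ≤ _ at h2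
    omega
  obtain ⟨y, hy1, hy2⟩ := hy
  have hyx : y < x := by
    have : (y : ℕ) < x := by omega
    exact this
  obtain ⟨p, q, hp, hxp⟩ := exists_first_occurrence hx
  have hle := hα (Equiv.swap x y) (Equiv.injective _)
  apply not_lt_of_ge hle
  have hmap : p.map (Equiv.swap x y) = p := by
    conv_rhs => rw [← List.map_id p]
    apply List.map_congr_left
    intro a ha
    rw [id, Equiv.swap_apply_of_ne_of_ne]
    · rintro rfl; exact hxp ha
    · rintro rfl; apply hy2; rw [hp]; simp [ha]
  rw [hp, List.map_append, hmap, List.map_cons, Equiv.swap_apply_left]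
  exact List.Lex.append_left _ (List.Lex.rel hyx) p

theorem finite_isCanonical_length_eq (n : ℕ) :
    {α : Pattern | α.IsCanonical ∧ α.length = n}.Finite := by
  have hf : (Set.univ : Set (Fin n → Fin (n + 1))).Finite := Set.toFinite _
  refine (hf.image fun f => List.ofFn fun i => (f i : ℕ).succPNat).subset ?_
  rintro α ⟨hα, rfl⟩
  refine ⟨fun i => ⟨(α[i] : ℕ) - 1, ?_⟩, trivial, ?_⟩
  · have := hα.le_length (List.getElem_mem i.2)
    rw [Fin.getElem_fin]
    omega
  · refine List.ext_getElem (by simp) fun i h1 h2 => ?_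
    simp only [List.getElem_ofFn, Fin.getElem_fin]
    apply PNat.eq
    rw [Nat.succPNat_coe]
    have := (α[i]).pos
    omega

/-! ### Factors of length two as positions. -/

section factors

variable {A : Type*}

theorem getElem?_of_eq_append_pair {w u₁ u₂ : List A} {a b : A} (h : w = u₁ ++ [a, b] ++ u₂) :
    w[u₁.length]? = some a ∧ w[u₁.length + 1]? = some b := by
  subst h
  simp

theorem eq_append_pair_of_getElem? {w : List A} {i : ℕ} {a b : A} (ha : w[i]? = some a)
    (hb : w[i + 1]? = some b) : w = w.take i ++ [a, b] ++ w.drop (i + 2) := by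
  obtain ⟨h1, h2⟩ := List.getElem?_eq_some_iff.1 ha
  obtain ⟨h3, h4⟩ := List.getElem?_eq_some_iff.1 hb
  conv_lhs => rw [← List.take_append_drop i w, List.drop_eq_getElem_cons h1,
    List.drop_eq_getElem_cons h3, h2, h4]
  simp

theorem occursExactlyOnce_pair_iff {w : List A} {a b : A} :
    OccursExactlyOnce [a, b] w ↔ ∃! i, w[i]? = some a ∧ w[i + 1]? = some b := by
  constructor
  · rintro ⟨⟨u₁, u₂⟩, h1, h2⟩
    refine ⟨u₁.length, getElem?_of_eq_append_pair h1, fun i hi => ?_⟩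
    have h3 := eq_append_pair_of_getElem? hi.1 hi.2
    have h4 := h2 (w.take i, w.drop (i + 2)) h3
    have h5 : w.take i = u₁ := congrArg Prod.fst h4
    obtain ⟨h6, -⟩ := List.getElem?_eq_some_iff.1 hi.1
    rw [← h5, List.length_take]
    omega
  · rintro ⟨i, hi, h2⟩
    refine ⟨(w.take i, w.drop (i + 2)), eq_append_pair_of_getElem? hi.1 hi.2, ?_⟩
    rintro ⟨u₁, u₂⟩ hu
    have h3 := h2 _ (getElem?_of_eq_append_pair hu)
    simp only at hu
    subst h3
    rw [hu]
    simp [List.drop_append]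

theorem count_eq_card_filter [DecidableEq A] (w : List A) (a : A) :
    w.count a = ((Finset.range w.length).filter fun i => w[i]? = some a).card := by
  induction w using List.reverseRecOn with
  | nil => simp
  | append_singleton w b ih =>
    have h1 : (Finset.range w.length).filter (fun i => (w ++ [b])[i]? = some a) =
        (Finset.range w.length).filter (fun i => w[i]? = some a) := by
      apply Finset.filter_congr
      intro i hi
      rw [List.getElem?_append_left (Finset.mem_range.1 hi)]
    rw [List.count_append, List.length_append, List.length_singleton, Finset.range_add_one,
      Finset.filter_insert, h1, ih]
    by_cases hb : b = a
    · subst hb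
      rw [if_pos (by simp), Finset.card_insert_of_notMem (by simp)]
      simp
    · rw [if_neg (by simpa using hb)]
      simp [hb]

end factors

/-! ### Letter counts of de Bruijn words and the number of variables. -/

section deBruijn

variable {k : ℕ} {w : List (Fin k)}

theorem existsUnique_of_mem_nonCyclicDeBruijn (hw : w ∈ nonCyclicDeBruijn k 2) (a b : Fin k) :
    ∃! i, w[i]? = some a ∧ w[i + 1]? = some b :=
  occursExactlyOnce_pair_iff.1 (hw [a, b] rfl)

/-- An occurrence of `a` other than at the end is determined by the letter after it, and each letter
comes after `a` exactly once. -/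
theorem card_filter_range_pred (hw : w ∈ nonCyclicDeBruijn k 2) (a : Fin k) :
    ((Finset.range (w.length - 1)).filter fun i => w[i]? = some a).card = k := by
  choose f hf hf' using existsUnique_of_mem_nonCyclicDeBruijn hw a
  have hinj : Function.Injective f := fun b c h => by
    have h1 := (hf b).2
    have h2 := (hf c).2
    rw [h, h2] at h1
    simpa using h1.symm
  have : (Finset.range (w.length - 1)).filter (fun i => w[i]? = some a) =
      Finset.univ.image f := by
    ext i
    simp only [Finset.mem_filter, Finset.mem_range, Finset.mem_image, Finset.mem_univ, true_and]
    constructor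
    · rintro ⟨h1, h2⟩
      have h3 : i + 1 < w.length := by omega
      exact ⟨w[i + 1], (hf' _ i ⟨h2, List.getElem?_eq_getElem h3⟩).symm⟩
    · rintro ⟨b, rfl⟩
      obtain ⟨h3, -⟩ := List.getElem?_eq_some_iff.1 (hf b).2
      exact ⟨by omega, (hf b).1⟩
  rw [this, Finset.card_image_of_injective _ hinj]
  simp

theorem ne_nil_of_mem_nonCyclicDeBruijn (hk : 1 ≤ k) (hw : w ∈ nonCyclicDeBruijn k 2) :
    w ≠ [] := by
  rintro rfl
  obtain ⟨i, hi, -⟩ := existsUnique_of_mem_nonCyclicDeBruijn hw ⟨0, hk⟩ ⟨0, hk⟩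
  simp at hi

theorem count_of_mem_nonCyclicDeBruijn (hw : w ∈ nonCyclicDeBruijn k 2) (hne : w ≠ [])
    (a : Fin k) : w.count a = k + if a = w.getLast hne then 1 else 0 := by
  have hlen : w.length = w.length - 1 + 1 := by
    have := List.length_pos_of_ne_nil hne; omega
  have hlast : w[w.length - 1]? = some (w.getLast hne) := by
    rw [← List.getLast?_eq_getElem?, List.getLast?_eq_getLast_of_ne_nil hne]
  rw [count_eq_card_filter, hlen, Finset.range_add_one, Finset.filter_insert, hlast]
  have h := card_filter_range_pred hw a
  by_cases ha : a = w.getLast hne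
  · rw [if_pos (by rw [ha]), if_pos ha, Finset.card_insert_of_notMem (by simp), h]
  · rw [if_neg (by simpa using Ne.symm ha), if_neg ha, h]
    simp

theorem length_of_mem_nonCyclicDeBruijn (hk : 1 ≤ k) (hw : w ∈ nonCyclicDeBruijn k 2) :
    w.length = k * k + 1 := by
  have hne := ne_nil_of_mem_nonCyclicDeBruijn hk hw
  have h1 : ∑ a : Fin k, w.count a = w.length := by
    have := Multiset.sum_count_eq_card (s := Finset.univ) (m := (w : Multiset (Fin k))) (by simp)
    simpa using this
  rw [← h1, Finset.sum_congr rfl fun a _ => count_of_mem_nonCyclicDeBruijn hw hne a,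
    Finset.sum_add_distrib]
  simp

theorem vars_card_of_mem_PiDB (hk : 1 ≤ k) {α : Pattern} (hα : α ∈ PiDB k) :
    α.vars.card = (k - 1) * (k / 2) + (k + 1) / 2 := by
  obtain ⟨w, hw, N, hcard, hf, hcount, hdisj, -⟩ := hα
  have hne := ne_nil_of_mem_nonCyclicDeBruijn hk hw
  have h1 : α.vars = Finset.univ.biUnion N := by
    ext x
    simp only [Pattern.vars, List.mem_toFinset, Finset.mem_biUnion, Finset.mem_univ, true_and]
    constructor
    · intro hx
      obtain ⟨i, hi, rfl⟩ := List.getElem_of_mem hx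
      have hlen := hf.length_eq
      exact ⟨w[i], (List.forall₂_iff_get.1 hf).2 i (by omega) hi⟩
    · rintro ⟨j, hj⟩
      have := hcount j x hj
      exact List.count_pos_iff.1 (by omega)
  rw [h1, Finset.card_biUnion (fun i _ j _ hij => hdisj i j hij)]
  have h2 : ∀ j, (N j).card = if j = w.getLast hne then (k + 1) / 2 else k / 2 := by
    intro j
    rw [hcard, count_of_mem_nonCyclicDeBruijn hw hne]
    split_ifs <;> rfl
  rw [Finset.sum_congr rfl fun j _ => h2 j, Finset.sum_ite, Finset.sum_const, Finset.sum_const,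
    Finset.filter_eq' , if_pos (Finset.mem_univ _), Finset.filter_ne',
    Finset.card_erase_of_mem (Finset.mem_univ _)]
  simp [add_comm]

/-- `Set.ncard` is `0` on infinite sets, so the lower bound depends on this. -/
theorem finite_PiDB (hk : 1 ≤ k) : (PiDB k).Finite := by
  refine (finite_isCanonical_length_eq (k * k + 1)).subset ?_
  rintro α ⟨w, hw, N, -, hf, -, -, hc⟩
  exact ⟨hc, by rw [← hf.length_eq, length_of_mem_nonCyclicDeBruijn hk hw]⟩

end deBruijn

/-! ### Transition systems and their walks. -/

section walks

variable {V : Type*}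

/-- A permutation is full if it has a single orbit. -/
def IsFullCycle {A : Type*} (f : Equiv.Perm A) : Prop := ∀ x y, f.SameCycle x y

theorem IsFullCycle.isCycleOn {A : Type*} [Fintype A] {f : Equiv.Perm A} (hf : IsFullCycle f) :
    f.IsCycleOn ((Finset.univ : Finset A) : Set A) := by
  refine ⟨?_, fun x _ y _ => hf x y⟩
  rw [Finset.coe_univ, Set.bijOn_univ]
  exact f.bijective

/-- The permutation of the arcs `(c, e)` of the complete digraph with loops given by a transition
system: after an arc `(c, e)` comes the arc `(e, T e c)`. -/
def stepPerm (T : V → Equiv.Perm V) : Equiv.Perm (V × V) where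
  toFun x := (x.2, T x.2 x.1)
  invFun x := ((T x.1).symm x.2, x.1)
  left_inv x := by simp
  right_inv x := by simp

/-- The letters visited when the transition system `T` is followed from the arc `x`. -/
def walk (T : V → Equiv.Perm V) (x : V × V) (t : ℕ) : V := ((stepPerm T ^ t) x).1

theorem stepPerm_pow_apply (T : V → Equiv.Perm V) (x : V × V) (t : ℕ) :
    (stepPerm T ^ t) x = (walk T x t, walk T x (t + 1)) := by
  refine Prod.ext rfl ?_
  change _ = ((stepPerm T ^ (t + 1)) x).1
  rw [pow_succ', Equiv.Perm.mul_apply]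
  rfl

theorem walk_add_two (T : V → Equiv.Perm V) (x : V × V) (t : ℕ) :
    walk T x (t + 2) = T (walk T x (t + 1)) (walk T x t) := by
  have h := stepPerm_pow_apply T x (t + 1)
  rw [pow_succ', Equiv.Perm.mul_apply, stepPerm_pow_apply] at h
  exact (congrArg Prod.snd h).symm

theorem walk_zero (T : V → Equiv.Perm V) (x : V × V) : walk T x 0 = x.1 := rfl

theorem walk_one (T : V → Equiv.Perm V) (x : V × V) : walk T x 1 = x.2 := rfl

variable [Fintype V] {T : V → Equiv.Perm V}

theorem exists_walk_eq (hT : IsFullCycle (stepPerm T)) (x : V × V) (a b : V) :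
    ∃ t < Fintype.card V * Fintype.card V, walk T x t = a ∧ walk T x (t + 1) = b := by
  obtain ⟨n, hn, h⟩ := hT.isCycleOn.exists_pow_eq (Finset.mem_univ x) (Finset.mem_univ (a, b))
  rw [stepPerm_pow_apply, Prod.mk.injEq] at h
  exact ⟨n, by simpa using hn, h⟩

theorem walk_injOn (hT : IsFullCycle (stepPerm T)) (x : V × V) {t t' : ℕ}
    (ht : t < Fintype.card V * Fintype.card V)
    (ht' : t' < Fintype.card V * Fintype.card V) (h1 : walk T x t = walk T x t')
    (h2 : walk T x (t + 1) = walk T x (t' + 1)) : t = t' := by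
  have h : (stepPerm T ^ t) x = (stepPerm T ^ t') x := by
    rw [stepPerm_pow_apply, stepPerm_pow_apply, h1, h2]
  rw [hT.isCycleOn.pow_apply_eq_pow_apply (Finset.mem_univ x)] at h
  have hc : (Finset.univ : Finset (V × V)).card = Fintype.card V * Fintype.card V := by simp
  rw [hc] at h
  exact Nat.ModEq.eq_of_lt_of_lt h ht ht'

theorem walk_add_card (hT : IsFullCycle (stepPerm T)) (x : V × V) (t : ℕ) :
    walk T x (Fintype.card V * Fintype.card V + t) = walk T x t := by
  have hc : (Finset.univ : Finset (V × V)).card = Fintype.card V * Fintype.card V := by simp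
  have h := (hT.isCycleOn.pow_apply_eq_pow_apply (Finset.mem_univ x)
    (m := Fintype.card V * Fintype.card V + t) (n := t)).2 (by rw [hc]; simp [Nat.ModEq])
  exact congrArg Prod.fst h

end walks

/-! ### From labelled walks to patterns. -/

section scheme

variable {k : ℕ}

/-- The word formed by the values of `w` at `0, …, k ^ 2`. -/
def wordOf {B : Type*} (k : ℕ) (w : ℕ → B) : List B := (List.range (k * k + 1)).map w

theorem length_wordOf {B : Type*} (w : ℕ → B) : (wordOf k w).length = k * k + 1 := by
  simp [wordOf]

theorem getElem?_wordOf {B : Type*} (w : ℕ → B) {t : ℕ} (ht : t ≤ k * k) :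
    (wordOf k w)[t]? = some (w t) := by
  simp [wordOf, Nat.lt_succ_of_le ht]

theorem mem_wordOf {B : Type*} {w : ℕ → B} {b : B} :
    b ∈ wordOf k w ↔ ∃ t ≤ k * k, w t = b := by
  simp [wordOf]

theorem wordOf_walk_mem {T : Fin k → Equiv.Perm (Fin k)} (hT : IsFullCycle (stepPerm T))
    (x : Fin k × Fin k) : wordOf k (walk T x) ∈ nonCyclicDeBruijn k 2 := by
  intro v hv
  obtain ⟨a, b, rfl⟩ := List.length_eq_two.1 hv
  rw [occursExactlyOnce_pair_iff]
  obtain ⟨t, ht, h1, h2⟩ := exists_walk_eq hT x a b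
  rw [Fintype.card_fin] at ht
  refine ⟨t, ⟨?_, ?_⟩, fun i hi => ?_⟩
  · rw [getElem?_wordOf _ ht.le, h1]
  · rw [getElem?_wordOf _ (by omega), h2]
  · obtain ⟨h3, -⟩ := List.getElem?_eq_some_iff.1 hi.2
    rw [length_wordOf] at h3
    have h4 := hi.1
    have h5 := hi.2
    rw [getElem?_wordOf _ (by omega), Option.some.injEq] at h4 h5
    exact walk_injOn hT x (by rw [Fintype.card_fin]; omega) (by rw [Fintype.card_fin]; omega)
      (h4.trans h1.symm) (h5.trans h2.symm)

/-- The walk is closed: after `k * k` steps it is back at its first letter, which therefore is the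
one with an additional occurrence. -/
theorem count_wordOf_walk {T : Fin k → Equiv.Perm (Fin k)} (hT : IsFullCycle (stepPerm T))
    (x : Fin k × Fin k) (a : Fin k) :
    (wordOf k (walk T x)).count a = k + if a = x.1 then 1 else 0 := by
  have hne : wordOf k (walk T x) ≠ [] := by
    intro h
    have := length_wordOf (k := k) (walk T x)
    rw [h] at this
    simp at this
  rw [count_of_mem_nonCyclicDeBruijn (wordOf_walk_mem hT x) hne]
  have : (wordOf k (walk T x)).getLast hne = x.1 := by
    rw [← Option.some_inj, ← List.getLast?_eq_getLast_of_ne_nil hne, List.getLast?_eq_getElem?,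
      length_wordOf, Nat.add_sub_cancel, getElem?_wordOf _ le_rfl]
    have := walk_add_card hT x 0
    rw [Fintype.card_fin] at this
    exact congrArg some this
  rw [this]

/-- The canonical pattern of the word whose letter at position `t` is refined by the label
`lab t`. -/
def labelCode {L : Type*} [DecidableEq L] (w : ℕ → Fin k) (lab : ℕ → L) : Pattern :=
  canonicalCode (wordOf k fun t => (w t, lab t))

/-- The set `N j` consists of the codes of the pairs `(j, l)` with `l ∈ S j`. The letter is part of
the coded pair, so different letters have disjoint sets. -/
theorem labelCode_mem_PiDB {L : Type*} [DecidableEq L] {w : ℕ → Fin k} {lab : ℕ → L}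
    (hw : wordOf k w ∈ nonCyclicDeBruijn k 2) (S : Fin k → Finset L)
    (hcard : ∀ j, (S j).card = (wordOf k w).count j / 2) (hlab : ∀ t ≤ k * k, lab t ∈ S (w t))
    (htwo : ∀ j, ∀ l ∈ S j, ∃ t t', t < t' ∧ t' ≤ k * k ∧ w t = j ∧ w t' = j ∧
      lab t = l ∧ lab t' = l) : labelCode w lab ∈ PiDB k := by
  set β := wordOf k fun t => (w t, lab t) with hβ
  have hmem : ∀ j, ∀ l ∈ S j, (j, l) ∈ β := by
    intro j l hl
    obtain ⟨t, t', h1, h2, h3, h4, h5, h6⟩ := htwo j l hl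
    exact mem_wordOf.2 ⟨t, by omega, by rw [h3, h5]⟩
  have hinj : ∀ i j, ∀ l ∈ S i, ∀ m ∈ S j,
      (firstRank β (i, l)).succPNat = (firstRank β (j, m)).succPNat → (i, l) = (j, m) :=
    fun i j l hl m hm h => firstRank_injOn β (hmem i l hl) (hmem j m hm) (Nat.succPNat_injective h)
  refine ⟨wordOf k w, hw, fun j => (S j).image fun l => (firstRank β (j, l)).succPNat, ?_, ?_, ?_,
    ?_, isCanonical_canonicalCode _⟩
  · intro j
    rw [Finset.card_image_of_injOn, hcard]
    intro l hl m hm h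
    exact (Prod.mk.injEq _ _ _ _ ▸ hinj j j l hl m hm h).2
  · rw [labelCode, canonicalCode, List.forall₂_map_right_iff, ← hβ, wordOf, hβ, wordOf,
      List.forall₂_map_left_iff, List.forall₂_map_right_iff, List.forall₂_same]
    intro t ht
    exact Finset.mem_image_of_mem _ (hlab t (by simpa [Nat.lt_succ_iff] using ht))
  · intro j x hx
    obtain ⟨l, hl, rfl⟩ := Finset.mem_image.1 hx
    obtain ⟨t, t', h1, h2, h3, h4, h5, h6⟩ := htwo j l hl
    apply List.duplicate_iff_two_le_count.1
    rw [List.duplicate_iff_exists_distinct_get]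
    have hlen : (labelCode w lab).length = k * k + 1 := by
      rw [labelCode, canonicalCode, List.length_map, length_wordOf]
    refine ⟨⟨t, by omega⟩, ⟨t', by omega⟩, h1, ?_, ?_⟩
    · simp only [labelCode, canonicalCode, List.get_eq_getElem, List.getElem_map, ← hβ]
      simp only [hβ, wordOf, List.getElem_map, List.getElem_range, h3, h5]
    · simp only [labelCode, canonicalCode, List.get_eq_getElem, List.getElem_map, ← hβ]
      simp only [hβ, wordOf, List.getElem_map, List.getElem_range, h4, h6]
  · intro i j hij
    rw [Finset.disjoint_left]
    intro y hy hy'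
    obtain ⟨l, hl, rfl⟩ := Finset.mem_image.1 hy
    obtain ⟨m, hm, h⟩ := Finset.mem_image.1 hy'
    exact hij (congrArg Prod.fst (hinj j i m hm l hl h)).symm

theorem getElem?_labelCode_eq_iff {L : Type*} [DecidableEq L] (w : ℕ → Fin k) (lab : ℕ → L)
    {t t' : ℕ} (ht : t ≤ k * k) (ht' : t' ≤ k * k) :
    (labelCode w lab)[t]? = (labelCode w lab)[t']? ↔ (w t = w t' ∧ lab t = lab t') := by
  have hl : (wordOf k fun t => (w t, lab t)).length = k * k + 1 := length_wordOf _
  have hl' : (labelCode w lab).length = k * k + 1 := by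
    rw [labelCode, canonicalCode, List.length_map, hl]
  have := getElem_canonicalCode_eq_iff (wordOf k fun t => (w t, lab t)) (i := t) (j := t')
    (by omega) (by omega)
  rw [List.getElem?_eq_getElem (by omega), List.getElem?_eq_getElem (by omega), Option.some_inj]
  unfold labelCode
  rw [this]
  simp [wordOf]

/-- The pattern determines which positions agree in letter and label. All decoding below uses only
this. -/
theorem labelCode_eq_labelCode {L L' : Type*} [DecidableEq L] [DecidableEq L'] {w w' : ℕ → Fin k}
    {lab : ℕ → L} {lab' : ℕ → L'} (h : labelCode w lab = labelCode w' lab') {t t' : ℕ}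
    (ht : t ≤ k * k) (ht' : t' ≤ k * k) :
    (w t = w t' ∧ lab t = lab t') ↔ (w' t = w' t' ∧ lab' t = lab' t') := by
  rw [← getElem?_labelCode_eq_iff w lab ht ht', h, getElem?_labelCode_eq_iff w' lab' ht ht']

end scheme

open Equiv

/-! ### Permutations with a single orbit. -/

section fullCycles

theorem sameCycle_rec {A : Type*} {f : Perm A} {r : A → A → Prop} (hr : Equivalence r)
    (h : ∀ x, r x (f x)) {x y : A} (hxy : f.SameCycle x y) : r x y := by
  obtain ⟨i, rfl⟩ := hxy
  induction i using Int.induction_on with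
  | zero => exact hr.refl x
  | succ i ih =>
    rw [add_comm, zpow_one_add, Perm.mul_apply]
    exact hr.trans ih (h _)
  | pred i ih =>
    have : (f ^ (-(i : ℤ))) x = f ((f ^ (-(i : ℤ) - 1)) x) := by
      rw [← Perm.mul_apply, ← zpow_one_add]; congr 2; ring
    rw [this] at ih
    exact hr.trans ih (hr.symm (h _))

theorem IsFullCycle.permCongr {A B : Type*} (e : A ≃ B) {f : Perm A} (hf : IsFullCycle f) :
    IsFullCycle (e.permCongr f) := by
  have key : ∀ x y, f.SameCycle x y → (e.permCongr f).SameCycle (e x) (e y) := by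
    intro x y hxy
    refine sameCycle_rec (r := fun x y => (e.permCongr f).SameCycle (e x) (e y))
      ⟨fun _ => .refl _ _, fun h => h.symm, fun h h' => h.trans h'⟩ (fun z => ?_) hxy
    have : e (f z) = e.permCongr f (e z) := by simp
    rw [this, Perm.sameCycle_apply_right]
  intro x y
  simpa using key (e.symm x) (e.symm y) (hf _ _)

theorem isFullCycle_permCongr {A B : Type*} (e : A ≃ B) {f : Perm A} :
    IsFullCycle (e.permCongr f) ↔ IsFullCycle f := by
  refine ⟨fun h => ?_, fun h => h.permCongr e⟩
  have := h.permCongr e.symm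
  have h2 : e.symm.permCongr (e.permCongr f) = f := by ext; simp
  rwa [h2] at this

theorem isFullCycle_inv {A : Type*} {f : Perm A} : IsFullCycle f⁻¹ ↔ IsFullCycle f := by
  simp [IsFullCycle, Perm.sameCycle_inv]

/-- `removeNone` bypasses `none` in its cycle, which neither splits nor merges the other points; the
hypothesis says that `none` is not an orbit of its own. -/
theorem isFullCycle_removeNone_iff {A : Type*} {G : Perm (Option A)} (h : G none ≠ none) :
    IsFullCycle (removeNone G) ↔ IsFullCycle G := by
  obtain ⟨a, ha⟩ := Option.ne_none_iff_exists'.1 h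
  constructor
  · intro hg
    have h1 : ∀ x y, G.SameCycle (some x) (some y) := by
      intro x y
      refine sameCycle_rec (r := fun x y => G.SameCycle (some x) (some y))
        ⟨fun _ => .refl _ _, fun h => h.symm, fun h h' => h.trans h'⟩ (fun z => ?_) (hg x y)
      rcases hz : G (some z) with _ | y
      · rw [removeNone_none _ hz, Perm.sameCycle_apply_right, ← hz, Perm.sameCycle_apply_right]
      · rw [removeNone_some _ ⟨y, hz⟩, Perm.sameCycle_apply_right]
    have h2 : ∀ x, G.SameCycle none (some x) := fun x =>
      Perm.SameCycle.trans (by rw [← ha, Perm.sameCycle_apply_right]) (h1 a x)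
    rintro (_ | x) (_ | y)
    · rfl
    · exact h2 y
    · exact (h2 x).symm
    · exact h1 x y
  · intro hG x y
    have := sameCycle_rec (f := G)
      (r := fun u v => Perm.SameCycle (removeNone G) (u.getD a) (v.getD a))
      ⟨fun _ => .refl _ _, fun h => h.symm, fun h h' => h.trans h'⟩ ?_ (hG (some x) (some y))
    · simpa using this
    · rintro (_ | z)
      · rw [ha, Option.getD_none, Option.getD_some]
      · rcases hz : G (some z) with _ | y
        · have h1 : some (removeNone G z) = some a := by rw [removeNone_none _ hz, ha]
          rw [Option.some_inj] at h1
          rw [Option.getD_none, Option.getD_some, ← h1, Perm.sameCycle_apply_right]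
        · have h1 : some (removeNone G z) = some y := by rw [removeNone_some _ ⟨y, hz⟩, hz]
          rw [Option.some_inj] at h1
          rw [Option.getD_some, Option.getD_some, ← h1, Perm.sameCycle_apply_right]

theorem IsFullCycle.apply_ne {A : Type*} {f : Perm A} (hf : IsFullCycle f) {x y : A}
    (hxy : x ≠ y) : f x ≠ x := fun h => by
  obtain ⟨i, hi⟩ := hf x y
  exact hxy ((Perm.zpow_apply_eq_self_of_apply_eq_self h i).symm.trans hi)

theorem removeNone_mul_optionCongr {A : Type*} (G : Perm (Option A)) (f : Perm A) :
    removeNone (G * optionCongr f) = removeNone G * f := by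
  ext x
  apply Option.some_injective
  rw [Perm.mul_apply]
  rcases h : G (some (f x)) with _ | y
  · rw [removeNone_none _ h, removeNone_none _ (by simpa using h)]
    simp
  · rw [removeNone_some _ ⟨y, h⟩, removeNone_some _ ⟨y, by simpa using h⟩]
    simp

theorem removeNone_inv {A : Type*} (G : Perm (Option A)) : (removeNone G)⁻¹ = removeNone G⁻¹ :=
  removeNone_symm G

theorem removeNone_optionCongr_mul {A : Type*} (G : Perm (Option A)) (f : Perm A) :
    removeNone (optionCongr f * G) = f * removeNone G := by
  have h := removeNone_mul_optionCongr G⁻¹ f⁻¹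
  have h2 : (removeNone (optionCongr f * G))⁻¹ = (f * removeNone G)⁻¹ := by
    rw [removeNone_inv, mul_inv_rev, mul_inv_rev, removeNone_inv, ← h]
    rfl
  exact inv_injective h2

theorem removeNone_conj {A : Type*} (G : Perm (Option A)) (f : Perm A) :
    removeNone ((optionCongr f)⁻¹ * G * optionCongr f) = f⁻¹ * removeNone G * f := by
  rw [removeNone_mul_optionCongr]
  congr 1
  exact removeNone_optionCongr_mul G f⁻¹

/-- The permutations supported on the left summand that turn a full cycle into a full cycle
correspond to full cycles of that summand. -/
theorem exists_return_perm_sum (K : Type*) [Nonempty K] (n : ℕ) (F : Perm (K ⊕ Fin n))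
    (hF : IsFullCycle F) :
    ∃ r : Perm K, ∀ ρ : Perm K, IsFullCycle (F * Perm.sumCongr ρ 1) ↔ IsFullCycle (r * ρ) := by
  induction n with
  | zero =>
    let e : K ⊕ Fin 0 ≃ K := Equiv.sumEmpty K (Fin 0)
    refine ⟨e.permCongr F, fun ρ => ?_⟩
    rw [← isFullCycle_permCongr e]
    have : e.permCongr (F * Perm.sumCongr ρ 1) = e.permCongr F * ρ := by
      ext x
      simp [e]
    rw [this]
  | succ n ih =>
    let e : K ⊕ Fin (n + 1) ≃ Option (K ⊕ Fin n) :=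
      (Equiv.sumCongr (Equiv.refl K) (finSuccEquivLast)).trans
        ⟨fun x => x.elim (fun a => some (.inl a)) (fun o => o.map .inr),
          fun o => o.elim (.inr none) (fun s => s.elim .inl (fun b => .inr (some b))),
          by rintro (a | _ | b) <;> rfl, by rintro (_ | a | b) <;> rfl⟩
    set G := e.permCongr F with hG
    have hGf : IsFullCycle G := hF.permCongr e
    obtain ⟨a⟩ := ‹Nonempty K›
    have hGn : G none ≠ none := hGf.apply_ne (y := some (.inl a)) (by simp)
    -- The points outside `K` are bypassed one at a time, so `r` becomes the first return map of `F`
    -- to `K`. Bypassing commutes with right factors that fix the bypassed point.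
    obtain ⟨r, hr⟩ := ih (removeNone G) ((isFullCycle_removeNone_iff hGn).2 hGf)
    refine ⟨r, fun ρ => ?_⟩
    have h1 : e.permCongr (F * Perm.sumCongr ρ 1) = G * optionCongr (Perm.sumCongr ρ 1) := by
      ext1 x
      rw [Equiv.permCongr_apply, Perm.mul_apply, Perm.mul_apply, hG, Equiv.permCongr_apply]
      congr 2
      rw [Equiv.eq_symm_apply]
      rcases x with _ | a | b
      · simp [e]
      · simp [e]
      · simp [e]
    rw [← isFullCycle_permCongr e, h1, ← hr, ← removeNone_mul_optionCongr,
      isFullCycle_removeNone_iff]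
    simpa using hGn

end fullCycles

/-! ### Counting the full cycles that link two involutions. -/

section joint

/-- Two permutations act jointly transitively if any two points are connected by applying them and
their inverses. -/
def JointlyTransitive {A : Type*} (P Q : Perm A) : Prop :=
  ∀ x y, Relation.EqvGen (fun a b => P a = b ∨ Q a = b) x y

theorem eqvGen_rec {A : Type*} {r s : A → A → Prop} (hs : Equivalence s)
    (h : ∀ a b, r a b → s a b) {x y : A} (hxy : Relation.EqvGen r x y) : s x y := by
  induction hxy with
  | rel a b hab => exact h a b hab
  | refl a => exact hs.refl a
  | symm a b _ ih => exact hs.symm ih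
  | trans a b c _ _ h1 h2 => exact hs.trans h1 h2

theorem JointlyTransitive.permCongr {A B : Type*} (e : A ≃ B) {P Q : Perm A}
    (h : JointlyTransitive P Q) : JointlyTransitive (e.permCongr P) (e.permCongr Q) := by
  intro x y
  have := eqvGen_rec (s := fun x y =>
      Relation.EqvGen (fun a b => e.permCongr P a = b ∨ e.permCongr Q a = b) (e x) (e y))
    ⟨fun _ => .refl _, fun h => .symm _ _ h, fun h h' => .trans _ _ _ h h'⟩ ?_
    (h (e.symm x) (e.symm y))
  · simpa using this
  · rintro a b (rfl | rfl)
    · exact .rel _ _ (Or.inl (by simp))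
    · exact .rel _ _ (Or.inr (by simp))

theorem jointlyTransitive_permCongr {A B : Type*} (e : A ≃ B) {P Q : Perm A} :
    JointlyTransitive (e.permCongr P) (e.permCongr Q) ↔ JointlyTransitive P Q := by
  refine ⟨fun h => ?_, fun h => h.permCongr e⟩
  have := h.permCongr e.symm
  have h2 : ∀ f : Perm A, e.symm.permCongr (e.permCongr f) = f := fun f => by ext; simp
  rwa [h2, h2] at this

/-- A step that bypasses `none` is a path through `none` before the deletion, and `hn` attaches
`none` to the rest. -/
theorem jointlyTransitive_of_removeNone {A : Type*} {P Q : Perm (Option A)}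
    (h : JointlyTransitive (removeNone P) (removeNone Q)) (hn : P none ≠ none ∨ Q none ≠ none) :
    JointlyTransitive P Q := by
  set r : Option A → Option A → Prop := fun a b => P a = b ∨ Q a = b with hr
  have hstep : ∀ (G : Perm (Option A)), (∀ a, Relation.EqvGen r a (G a)) → ∀ z : A,
      Relation.EqvGen r (some z) (some (removeNone G z)) := by
    intro G hG z
    rcases hz : G (some z) with _ | y
    · rw [removeNone_none _ hz]
      refine .trans _ none _ ?_ (hG _)
      rw [← hz]
      exact hG _
    · rw [removeNone_some _ ⟨y, hz⟩]
      exact hG _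
  have hP : ∀ a, Relation.EqvGen r a (P a) := fun a => .rel _ _ (Or.inl rfl)
  have hQ : ∀ a, Relation.EqvGen r a (Q a) := fun a => .rel _ _ (Or.inr rfl)
  have h1 : ∀ x y : A, Relation.EqvGen r (some x) (some y) := by
    intro x y
    refine eqvGen_rec (s := fun x y : A => Relation.EqvGen r (some x) (some y))
      ⟨fun _ => .refl _, fun h => .symm _ _ h, fun h h' => .trans _ _ _ h h'⟩ ?_ (h x y)
    rintro a b (rfl | rfl)
    · exact hstep P hP a
    · exact hstep Q hQ a
  have h2 : ∀ x : A, Relation.EqvGen r none (some x) := by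
    rcases hn with hn | hn
    · obtain ⟨a, ha⟩ := Option.ne_none_iff_exists'.1 hn
      exact fun x => .trans _ (some a) _ (ha ▸ hP none) (h1 a x)
    · obtain ⟨a, ha⟩ := Option.ne_none_iff_exists'.1 hn
      exact fun x => .trans _ (some a) _ (ha ▸ hQ none) (h1 a x)
  rintro (_ | x) (_ | y)
  · exact .refl _
  · exact h2 y
  · exact .symm _ _ (h2 x)
  · exact h1 x y

/-- The number of full cycles `z` such that `P` and the conjugate of `S` by `z` act jointly
transitively. -/
noncomputable def linkCount {A : Type*} (P S : Perm A) : ℕ :=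
  Nat.card {z : Perm A // IsFullCycle z ∧ JointlyTransitive P (z⁻¹ * S * z)}

theorem linkCount_permCongr {A B : Type*} (e : A ≃ B) (P S : Perm A) :
    linkCount (e.permCongr P) (e.permCongr S) = linkCount P S := by
  symm
  apply Nat.card_congr
  refine e.permCongr.subtypeEquiv fun z => ?_
  rw [isFullCycle_permCongr]
  have : (e.permCongr z)⁻¹ * e.permCongr S * e.permCongr z = e.permCongr (z⁻¹ * S * z) := by
    ext x
    have h3 : (e.permCongr z)⁻¹ = e.permCongr z⁻¹ := rfl
    rw [h3]
    simp
  rw [this, jointlyTransitive_permCongr]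

theorem card_mul_le_card_sigma {I : Type*} {B : I → Type*} [Finite I] [∀ i, Finite (B i)] {c : ℕ}
    (h : ∀ i, c ≤ Nat.card (B i)) : Nat.card I * c ≤ Nat.card (Σ i, B i) := by
  have := Fintype.ofFinite I
  rw [Nat.card_sigma, Nat.card_eq_fintype_card, ← smul_eq_mul, ← Finset.card_univ]
  exact Finset.card_nsmul_le_sum _ _ _ fun i _ => h i

theorem removeNone_decomposeOption_symm {A : Type*} [DecidableEq A] (x : Option A) (f : Perm A) :
    removeNone (swap none x * optionCongr f) = f := by
  have := (Perm.decomposeOption (α := A)).apply_symm_apply (x, f)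
  exact congrArg Prod.snd this

/-- Inserting `none` into a full cycle `f` of `A` gives `swap none (some a) * optionCongr f`, a full
cycle, and different pairs `(a, f)` give different ones. Deleting `none` from the conjugate of `S`
leaves a conjugate by `f`. As `S` has no fixed point, its conjugate moves `none`. -/
theorem card_mul_le_linkCount {A : Type*} [Finite A] [DecidableEq A] {P S : Perm (Option A)}
    (hS : ∀ x, S x ≠ x) {c : ℕ}
    (hc : ∀ a : A, c ≤ linkCount (removeNone P)
      (removeNone (swap none (some a) * S * swap none (some a)))) :
    Nat.card A * c ≤ linkCount P S := by
  refine (card_mul_le_card_sigma hc).trans ?_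
  refine Nat.card_le_card_of_injective (fun i => ⟨swap none (some i.1) * optionCongr i.2.1, ?_, ?_⟩) ?_
  · rw [← isFullCycle_removeNone_iff, removeNone_decomposeOption_symm]
    · exact i.2.2.1
    · simp
  · obtain ⟨a, f, h1, h2⟩ := i
    dsimp only
    apply jointlyTransitive_of_removeNone
    · refine (congrArg (JointlyTransitive _) ?_).mpr h2
      rw [← removeNone_conj]
      simp only [mul_assoc, mul_inv_rev, swap_inv]
    · right
      intro h
      simp only [mul_assoc, Perm.mul_apply, Perm.inv_eq_iff_eq] at h
      exact hS _ h
  · rintro ⟨a, f, h1⟩ ⟨b, g, h2⟩ h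
    have h3 := congrArg Subtype.val h
    simp only at h3
    have h4 := (Perm.decomposeOption (α := A)).symm.injective
      (a₁ := (some a, f)) (a₂ := (some b, g)) h3
    simp only [Prod.mk.injEq, Option.some.injEq] at h4
    obtain ⟨rfl, rfl⟩ := h4
    rfl

/-- The insertion of `card_mul_le_linkCount` is applied to `z⁻¹`, which exchanges the roles: `none`
is deleted from `S` and `some v` from `P`. Excluding `v₀` ensures that `P` moves the deleted point.
-/
theorem card_pred_mul_le_linkCount {A : Type*} [Finite A] [DecidableEq A] {P S : Perm (Option A)}
    {v₀ : Option A} (hP : ∀ x, P x = x ↔ x = v₀) {c : ℕ}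
    (hc : ∀ v : A, some v ≠ v₀ → c ≤ linkCount
      (removeNone (swap none (some v) * P * swap none (some v))) (removeNone S)) :
    (Nat.card A - 1) * c ≤ linkCount P S := by
  have hcard : Nat.card A - 1 ≤ Nat.card {v : A // some v ≠ v₀} := by
    have := Fintype.ofFinite A
    rcases v₀ with _ | v₁
    · simp
    · simp only [ne_eq, Option.some.injEq, Nat.card_eq_fintype_card]
      rw [Fintype.card_subtype_compl, Fintype.card_subtype_eq]
  refine (Nat.mul_le_mul_right c hcard).trans ?_
  refine (card_mul_le_card_sigma (fun i : {v : A // some v ≠ v₀} => hc i.1 i.2)).trans ?_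
  refine Nat.card_le_card_of_injective
    (fun i => ⟨(swap none (some i.1.1) * optionCongr i.2.1⁻¹)⁻¹, ?_, ?_⟩) ?_
  · rw [isFullCycle_inv, ← isFullCycle_removeNone_iff, removeNone_decomposeOption_symm,
      isFullCycle_inv]
    · exact i.2.2.1
    · simp
  · obtain ⟨⟨v, hv⟩, f, h1, h2⟩ := i
    dsimp only at h2 ⊢
    rw [← jointlyTransitive_permCongr (swap none (some v))]
    have hc : ∀ G : Perm (Option A), (swap none (some v)).permCongr G =
        swap none (some v) * G * swap none (some v) := fun G => by
      ext1 x; simp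
    rw [hc, hc]
    apply jointlyTransitive_of_removeNone
    · refine (congrArg (JointlyTransitive _) ?_).mpr h2
      rw [← removeNone_conj]
      congr 1
      have h5 : (optionCongr f⁻¹ : Perm (Option A)) = (optionCongr f)⁻¹ := rfl
      rw [h5]
      simp only [inv_inv, mul_inv_rev, swap_inv]
      have h6 : swap none (some v) * swap none (some v) = (1 : Perm (Option A)) := swap_mul_self _ _
      calc _ = (swap none (some v) * swap none (some v)) * (optionCongr f)⁻¹ * S * optionCongr f *
            (swap none (some v) * swap none (some v)) := by simp only [mul_assoc]
        _ = _ := by rw [h6]; simp only [mul_assoc, one_mul, mul_one]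
    · left
      intro h
      simp only [mul_assoc, Perm.mul_apply, swap_apply_left] at h
      have h7 : P (some v) = some v := by
        rw [← swap_apply_left (none : Option A) (some v), ← swap_apply_left (none : Option A) (some v)]
        rw [Equiv.swap_apply_eq_iff] at h
        simpa using h
      exact hv ((hP _).1 h7)
  · rintro ⟨⟨a, ha⟩, f, h1⟩ ⟨⟨b, hb⟩, g, h2⟩ h
    have h3 := inv_injective (congrArg Subtype.val h)
    have h4 := (Perm.decomposeOption (α := A)).symm.injective
      (a₁ := (some a, f⁻¹)) (a₂ := (some b, g⁻¹)) h3
    simp only [Prod.mk.injEq, Option.some.injEq, inv_inj] at h4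
    obtain ⟨rfl, rfl⟩ := h4
    rfl

/-- When a point of an involution is deleted, its former partner becomes a fixed point. -/
theorem removeNone_eq_self_iff {A : Type*} {G : Perm (Option A)} (hG : G⁻¹ = G) (x : A) :
    removeNone G x = x ↔ G (some x) = some x ∨ G (some x) = none := by
  rcases h : G (some x) with _ | y
  · have h1 : G none = some x := by
      have h2 := Perm.inv_eq_iff_eq.2 h.symm
      rwa [hG] at h2
    have h3 := removeNone_none _ h
    rw [h1, Option.some_inj] at h3
    simp [h3]
  · have h3 := removeNone_some _ ⟨y, h⟩
    rw [h, Option.some_inj] at h3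
    simp [h3]

theorem permCongr_inv_eq {A B : Type*} (e : A ≃ B) {P : Perm A} (hP : P⁻¹ = P) :
    (e.permCongr P)⁻¹ = e.permCongr P := by
  conv_rhs => rw [← hP]
  rfl

theorem swap_conj_inv_eq {A : Type*} [DecidableEq A] {P : Perm A} (hP : P⁻¹ = P) (x y : A) :
    (swap x y * P * swap x y)⁻¹ = swap x y * P * swap x y := by
  simp [mul_inv_rev, hP, mul_assoc]

/-- The point `u` is deleted from `P`, and `hu` says that this leaves `v` as the only fixed point.
Any of the `2 * j + 1` points allowed by `card_mul_le_linkCount` is deleted from `S`, where only its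
partner becomes fixed. -/
theorem linkCount_even_step {j c : ℕ}
    (hodd : ∀ {A : Type} [Finite A] [DecidableEq A] (P S : Perm A), Nat.card A = 2 * j + 1 →
      P⁻¹ = P → S⁻¹ = S → (∃ v, ∀ x, P x = x ↔ x = v) → (∃ v, ∀ x, S x = x ↔ x = v) →
      c ≤ linkCount P S)
    {A : Type} [Finite A] [DecidableEq A] {P S : Perm A} (hA : Nat.card A = 2 * j + 2)
    (hP : P⁻¹ = P) (hS : S⁻¹ = S) (hS' : ∀ x, S x ≠ x) {u v : A} (huv : v ≠ u)
    (hu : ∀ x, x ≠ u → ((P x = x ∨ P x = u) ↔ x = v)) :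
    (2 * j + 1) * c ≤ linkCount P S := by
  set e := (optionSubtypeNe u).symm with he
  have hcard : Nat.card {b // b ≠ u} = 2 * j + 1 := by
    have := Nat.card_congr e
    rw [Finite.card_option] at this
    omega
  rw [← linkCount_permCongr e, ← hcard]
  have heu : e u = none := by simp [he]
  have hex : ∀ x : {b // b ≠ u}, e.symm (some x) = x := fun x => by simp [he]
  apply card_mul_le_linkCount
  · intro x h
    rw [Equiv.permCongr_apply, ← Equiv.eq_symm_apply] at h
    exact hS' _ h
  · intro a
    set S₂ := swap none (some a) * e.permCongr S * swap none (some a) with hS₂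
    have hS₂i : S₂⁻¹ = S₂ := swap_conj_inv_eq (permCongr_inv_eq e hS) _ _
    have hS₂f : ∀ x, S₂ x ≠ x := by
      intro x h
      rw [hS₂, Perm.mul_apply, Perm.mul_apply, Equiv.swap_apply_eq_iff, Equiv.permCongr_apply,
        ← Equiv.eq_symm_apply] at h
      exact hS' _ h
    refine hodd _ _ hcard ?_ ?_ ⟨⟨v, huv⟩, fun x => ?_⟩ ?_
    · rw [removeNone_inv, permCongr_inv_eq e hP]
    · rw [removeNone_inv, hS₂i]
    · rw [removeNone_eq_self_iff (permCongr_inv_eq e hP), Equiv.permCongr_apply, hex,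
        ← Equiv.eq_symm_apply, hex, ← heu, e.apply_eq_iff_eq, hu _ x.2, Subtype.ext_iff]
    · obtain ⟨y, hy⟩ := Option.ne_none_iff_exists'.1 (hS₂f none)
      refine ⟨y, fun x => ?_⟩
      rw [removeNone_eq_self_iff hS₂i, ← Option.some_inj (a := x), ← hy]
      constructor
      · rintro (h | h)
        · exact absurd h (hS₂f _)
        · have h2 := Perm.inv_eq_iff_eq.2 h.symm
          rw [hS₂i] at h2
          exact h2.symm
      · intro h
        right
        have h2 := Perm.inv_eq_iff_eq.2 h
        rwa [hS₂i] at h2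

/-- Two deletions lower the size by two, each with a factor `2 * j + 1`. The first removes the fixed
point of `S` and a moved point of `P`, so that `S` has no fixed point and `P` has two. The second
removes from `P` the fixed point `w` just created. For `j = 0` the truncated `2 * j - 1` is `0`, and
`0‼ = 1`. -/
theorem sq_doubleFactorial_le_linkCount (j : ℕ) : ∀ {A : Type} [Finite A] [DecidableEq A]
    (P S : Perm A), Nat.card A = 2 * j + 1 → P⁻¹ = P → S⁻¹ = S →
      (∃ v, ∀ x, P x = x ↔ x = v) → (∃ v, ∀ x, S x = x ↔ x = v) →
      (Nat.doubleFactorial (2 * j - 1)) ^ 2 ≤ linkCount P S := by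
  induction j with
  | zero =>
    intro A _ _ P S hA _ _ _ _
    have hsub : Subsingleton A := (Nat.card_eq_one_iff_unique.1 hA).1
    simp only [mul_zero, Nat.zero_sub, Nat.doubleFactorial, one_pow]
    rw [Nat.one_le_iff_ne_zero, ← Nat.pos_iff_ne_zero]
    exact Nat.card_pos_iff.2 ⟨⟨1, fun x y => Subsingleton.elim x y ▸ .refl _ _,
      fun x y => Subsingleton.elim x y ▸ .refl _⟩, inferInstance⟩
  | succ j ih =>
    rintro A _ _ P S hA hP hS ⟨v₀, hv₀⟩ ⟨b₀, hb₀⟩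
    set e := (optionSubtypeNe b₀).symm with he
    have hcard : Nat.card {b // b ≠ b₀} = 2 * j + 2 := by
      have := Nat.card_congr e
      rw [Finite.card_option] at this
      omega
    have heb : e b₀ = none := by simp [he]
    have hex : ∀ x : {b // b ≠ b₀}, e.symm (some x) = x := fun x => by simp [he]
    rw [← linkCount_permCongr e]
    have hP' : ∀ x, e.permCongr P x = x ↔ x = e v₀ := by
      intro x
      rw [Equiv.permCongr_apply, ← Equiv.eq_symm_apply, hv₀, Equiv.symm_apply_eq]
    have hS' : ∀ x, e.permCongr S x = x ↔ x = none := by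
      intro x
      rw [Equiv.permCongr_apply, ← Equiv.eq_symm_apply, hb₀, Equiv.symm_apply_eq, heb]
    have hSn := (hS' none).2 rfl
    have key : ∀ v : {b // b ≠ b₀}, some v ≠ e v₀ → (2 * j + 1) * (Nat.doubleFactorial (2 * j - 1)) ^ 2
        ≤ linkCount (removeNone (swap none (some v) * e.permCongr P * swap none (some v)))
          (removeNone (e.permCongr S)) := by
      intro v hv
      set P₂ := swap none (some v) * e.permCongr P * swap none (some v) with hP₂
      have hP₂i : P₂⁻¹ = P₂ := swap_conj_inv_eq (permCongr_inv_eq e hP) _ _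
      have hP₂f : ∀ x, P₂ x = x ↔ x = swap none (some v) (e v₀) := by
        intro x
        rw [hP₂, Perm.mul_apply, Perm.mul_apply, Equiv.swap_apply_eq_iff, hP',
          Equiv.swap_apply_eq_iff]
      have hf : swap none (some v) (e v₀) ≠ none := by
        rw [Ne, Equiv.swap_apply_eq_iff, swap_apply_left]
        exact hv.symm
      obtain ⟨f, hf'⟩ := Option.ne_none_iff_exists'.1 hf
      have hn : P₂ none ≠ none := fun h => hf ((hP₂f _).1 h).symm
      obtain ⟨w, hw⟩ := Option.ne_none_iff_exists'.1 hn
      have hw' : P₂ (some w) = none := by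
        have h2 := Perm.inv_eq_iff_eq.2 hw.symm
        rwa [hP₂i] at h2
      have hP₃w : removeNone P₂ w = w := (removeNone_eq_self_iff hP₂i w).2 (Or.inr hw')
      refine linkCount_even_step (u := w) (v := f) ih hcard ?_ ?_ ?_ ?_ ?_
      · rw [removeNone_inv, hP₂i]
      · rw [removeNone_inv, permCongr_inv_eq e hS]
      · intro x
        rw [Ne, removeNone_eq_self_iff (permCongr_inv_eq e hS), hS']
        rintro (h | h)
        · simp at h
        · have h3 : e.permCongr S none = some x := by
            have h2 := Perm.inv_eq_iff_eq.2 h.symm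
            rwa [permCongr_inv_eq e hS] at h2
          rw [hSn] at h3
          simp at h3
      · rintro rfl
        have := (hP₂f (some f)).2 hf'.symm
        rw [hw'] at this
        simp at this
      · intro x hx
        rw [removeNone_eq_self_iff hP₂i]
        constructor
        · rintro ((h | h) | h)
          · have := (hP₂f _).1 h
            rw [hf', Option.some_inj] at this
            exact this
          · exfalso
            apply hx
            have h2 := Perm.inv_eq_iff_eq.2 h.symm
            rw [hP₂i, hw, Option.some_inj] at h2
            exact h2.symm
          · exact absurd ((removeNone P₂).injective (h.trans hP₃w.symm)) hx
        · rintro rfl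
          exact Or.inl (Or.inl ((hP₂f _).2 hf'.symm))
    refine le_trans (le_of_eq ?_) (card_pred_mul_le_linkCount hP' key)
    rw [hcard]
    have : Nat.doubleFactorial (2 * (j + 1) - 1) =
        (2 * j + 1) * Nat.doubleFactorial (2 * j - 1) := by
      rcases j with _ | j
      · rfl
      · rw [show 2 * (j + 1 + 1) - 1 = 2 * (j + 1) - 1 + 2 by omega, Nat.doubleFactorial_add_two]
        congr 1
    rw [this, show 2 * j + 2 - 1 = 2 * j + 1 by omega]
    ring

theorem mul_sq_doubleFactorial_le_linkCount (j : ℕ) {A : Type} [Finite A] [DecidableEq A]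
    {P S : Perm A} (hA : Nat.card A = 2 * j + 2) (hP : P⁻¹ = P) (hS : S⁻¹ = S)
    (hP' : ∀ x, P x ≠ x) (hS' : ∀ x, S x ≠ x) :
    (2 * j + 1) * (Nat.doubleFactorial (2 * j - 1)) ^ 2 ≤ linkCount P S := by
  have hne : Nonempty A := (Nat.card_pos_iff.1 (by omega)).1
  obtain ⟨u⟩ := hne
  refine linkCount_even_step (u := u) (v := P u) (sq_doubleFactorial_le_linkCount j) hA hP hS hS'
    (hP' u) fun x hx => ?_
  constructor
  · rintro (h | h)
    · exact absurd h (hP' x)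
    · have h2 := Perm.inv_eq_iff_eq.2 h.symm
      rw [hP] at h2
      exact h2.symm
  · intro h
    right
    have h2 := Perm.inv_eq_iff_eq.2 h
    rwa [hP] at h2

/-- On `n ≥ 2` points a full cycle is an `n`-cycle, and there are `n! / n` of these. -/
theorem card_isFullCycle_le (A : Type*) [Finite A] [Nonempty A] :
    Nat.card {z : Perm A // IsFullCycle z} ≤ (Nat.card A - 1).factorial := by
  classical
  have := Fintype.ofFinite A
  rcases subsingleton_or_nontrivial A with h | h
  · have : Nat.card A = 1 := Nat.card_unique
    rw [this]
    exact Finite.card_le_one_iff_subsingleton.2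
      (inferInstance : Subsingleton {z : Perm A // IsFullCycle z})
  · have hsub : ∀ z : Perm A, IsFullCycle z → z.cycleType = {Nat.card A} := by
      intro z hz
      obtain ⟨x, y, hxy⟩ := exists_pair_ne A
      have hc : z.IsCycle := ⟨x, hz.apply_ne hxy, fun y _ => hz x y⟩
      rw [hc.cycleType]
      have : z.support = Finset.univ := by
        ext a
        obtain ⟨b, hb⟩ := exists_ne a
        simp [hz.apply_ne hb.symm]
      rw [this, Nat.card_eq_fintype_card, Finset.card_univ]
    have h1 := Perm.card_of_cycleType A {Nat.card A}
    have h2 : 2 ≤ Fintype.card A := Fintype.one_lt_card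
    rw [if_pos (by simp [Nat.card_eq_fintype_card]; omega)] at h1
    rw [Nat.card_eq_fintype_card, Fintype.card_subtype]
    refine (Finset.card_le_card (t := Finset.univ.filter fun z : Perm A =>
      z.cycleType = {Nat.card A}) fun z hz => ?_).trans ?_
    · simp only [Finset.mem_filter, Finset.mem_univ, true_and] at hz ⊢
      exact hsub z hz
    · rw [h1]
      simp only [Nat.card_eq_fintype_card, Multiset.sum_singleton, Nat.sub_self, Nat.factorial_zero,
        Multiset.prod_singleton, one_mul, Multiset.toFinset_singleton, Finset.prod_singleton,
        Multiset.count_singleton_self, Nat.factorial_one, mul_one]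
      obtain ⟨n, hn⟩ : ∃ n, Fintype.card A = n + 1 := ⟨_, (Nat.sub_add_cancel (by omega)).symm⟩
      rw [hn, Nat.factorial_succ, Nat.mul_div_cancel_left _ (by omega)]
      simp

end joint

/-! ### Counting maps whose orbits reach a given set. -/

section forests

variable {V : Type*}

/-- `Hits f S v a`: the orbit of `v` under `f` enters the set `S`, first at the point `a`. -/
inductive Hits (f : V → V) (S : Finset V) : V → V → Prop
  | base {v : V} : v ∈ S → Hits f S v v
  | step {v a : V} : v ∉ S → Hits f S (f v) a → Hits f S v a

theorem Hits.mem {f : V → V} {S : Finset V} {v a : V} (h : Hits f S v a) : a ∈ S := by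
  induction h with
  | base h => exact h
  | step _ _ ih => exact ih

theorem Hits.eq_of_mem {f : V → V} {S : Finset V} {v a : V} (h : Hits f S v a) (hv : v ∈ S) :
    a = v := by
  cases h with
  | base => rfl
  | step h => exact absurd hv h

theorem Hits.of_notMem {f : V → V} {S : Finset V} {v a : V} (h : Hits f S v a) (hv : v ∉ S) :
    Hits f S (f v) a := by
  cases h with
  | base h => exact absurd h hv
  | step _ h => exact h

theorem Hits.unique {f : V → V} {S : Finset V} {v a b : V} (h : Hits f S v a)
    (h' : Hits f S v b) : a = b := by
  induction h with
  | base h => exact (h'.eq_of_mem h).symm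
  | step h _ ih => exact ih (h'.of_notMem h)

theorem Hits.map {f : V → V} {S : Finset V} {v a : V} (h : Hits f S v a) (π : Perm V)
    (hS : ∀ x ∈ S, π x ∈ S) (hS' : ∀ x ∉ S, π x = x) : Hits (π ∘ f) S (π v) (π a) := by
  induction h with
  | base h => exact .base (hS _ h)
  | step h _ ih =>
    rw [hS' _ h]
    exact .step h ih

theorem Hits.exists_of_subset {f : V → V} {S S' : Finset V} {v a : V} (h : Hits f S v a)
    (hS : S ⊆ S') : ∃ b, Hits f S' v b := by
  classical
  induction h with
  | base h => exact ⟨_, .base (hS h)⟩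
  | @step v a h _ ih =>
    by_cases hv : v ∈ S'
    · exact ⟨v, .base hv⟩
    · obtain ⟨b, hb⟩ := ih
      exact ⟨b, .step hv hb⟩

variable [DecidableEq V]

theorem Hits.of_insert {f : V → V} {S : Finset V} {e v b : V} (h : Hits f (insert e S) v b)
    (hb : b ∈ S) : Hits f S v b := by
  induction h with
  | base => exact .base hb
  | step h _ ih =>
    rw [Finset.mem_insert, not_or] at h
    exact .step h.2 (ih hb)

theorem Hits.trans_of_insert {f : V → V} {S : Finset V} {e v a : V}
    (h : Hits f (insert e S) v e) (he : Hits f S e a) : Hits f S v a := by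
  suffices H : ∀ b, Hits f (insert e S) v b → b = e → Hits f S v a from H e h rfl
  clear h
  intro b h hb
  induction h with
  | base => exact hb ▸ he
  | step h _ ih =>
    rw [Finset.mem_insert, not_or] at h
    exact .step h.2 (ih hb)

/-- If the orbit of `f e` returns to `e` before it meets `S`, then `e` lies on a cycle that avoids
`S`, and every orbit that enters this cycle misses `S`. -/
theorem not_hits_of_loop {f : V → V} {S : Finset V} {e : V} (he : e ∉ S)
    (hloop : Hits f (insert e S) (f e) e) {v a : V} (h : Hits f S v a)
    (hv : Hits f (insert e S) v e) : False := by
  induction h with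
  | base h =>
    have := hv.eq_of_mem (Finset.mem_insert_of_mem h)
    exact he (this ▸ h)
  | @step v a h _ ih =>
    apply ih
    by_cases hve : v = e
    · rw [hve]; exact hloop
    · exact hv.of_notMem (by simp [hve, h])

variable [Fintype V]

open Classical in
/-- The maps under whose iteration each point reaches `S`. -/
noncomputable def reaching (S : Finset V) : Finset (V → V) :=
  Finset.univ.filter fun f => ∀ v, ∃ a, Hits f S v a

theorem mem_reaching {S : Finset V} {f : V → V} :
    f ∈ reaching S ↔ ∀ v, ∃ a, Hits f S v a := by
  simp [reaching]

-- The maps that reach `insert e S` are sorted by the point where the orbit of `f e` first enters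
-- this set. All `S.card + 1` points are equally frequent, and the map reaches `S` unless the point
-- is `e` itself.
open Classical in
theorem card_reaching_insert {S : Finset V} {e : V} (he : e ∉ S) :
    (S.card + 1) * (reaching S).card = S.card * (reaching (insert e S)).card := by
  set S' := insert e S with hS'
  set F : V → Finset (V → V) := fun a => (reaching S').filter fun f => Hits f S' (f e) a with hF
  have hdisj : ∀ R : Finset V, (R : Set V).PairwiseDisjoint F := by
    intro R a _ b _ hab
    rw [Function.onFun, Finset.disjoint_left]
    intro f hf hf'
    exact hab ((Finset.mem_filter.1 hf).2.unique (Finset.mem_filter.1 hf').2)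
  have h1 : reaching S' = S'.biUnion F := by
    ext f
    simp only [hF, Finset.mem_biUnion, Finset.mem_filter]
    constructor
    · intro h
      obtain ⟨a, ha⟩ := mem_reaching.1 h (f e)
      exact ⟨a, ha.mem, h, ha⟩
    · rintro ⟨a, -, h, -⟩
      exact h
  have h2 : reaching S = S.biUnion F := by
    ext f
    simp only [hF, Finset.mem_biUnion, Finset.mem_filter]
    constructor
    · intro h
      have h' : f ∈ reaching S' := mem_reaching.2 fun v => by
        obtain ⟨a, ha⟩ := mem_reaching.1 h v
        exact ha.exists_of_subset (Finset.subset_insert e S)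
      obtain ⟨a, ha⟩ := mem_reaching.1 h' (f e)
      refine ⟨a, ?_, h', ha⟩
      rcases Finset.mem_insert.1 ha.mem with rfl | h3
      · obtain ⟨b, hb⟩ := mem_reaching.1 h (f a)
        exact (not_hits_of_loop he ha hb ha).elim
      · exact h3
    · rintro ⟨a, ha, h, hfe⟩
      refine mem_reaching.2 fun v => ?_
      obtain ⟨b, hb⟩ := mem_reaching.1 h v
      rcases Finset.mem_insert.1 hb.mem with rfl | h3
      · exact ⟨a, hb.trans_of_insert (.step he (hfe.of_insert ha))⟩
      · exact ⟨b, hb.of_insert h3⟩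
  -- Composing `f` with the transposition of `a` and `b`, both in `S'`, exchanges these two as entry
  -- points.
  have h3 : ∀ a ∈ S', ∀ b ∈ S', (F a).card ≤ (F b).card := by
    intro a ha b hb
    have hS1 : ∀ x ∈ S', swap a b x ∈ S' := by
      intro x hx
      rw [swap_apply_def]
      split_ifs <;> assumption
    have hS2 : ∀ x ∉ S', swap a b x = x := by
      intro x hx
      apply swap_apply_of_ne_of_ne
      · rintro rfl; exact hx ha
      · rintro rfl; exact hx hb
    refine Finset.card_le_card_of_injOn (fun f => swap a b ∘ f) ?_ ?_
    · intro f hf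
      obtain ⟨hf1, hf2⟩ := Finset.mem_filter.1 hf
      refine Finset.mem_filter.2 ⟨mem_reaching.2 fun v => ?_, ?_⟩
      · obtain ⟨c, hc⟩ := mem_reaching.1 hf1 (swap a b v)
        refine ⟨swap a b c, ?_⟩
        have := hc.map (swap a b) hS1 hS2
        rwa [swap_apply_self] at this
      · have := hf2.map (swap a b) hS1 hS2
        rwa [swap_apply_left] at this
    · intro f _ g _ h
      exact (swap a b).injective.comp_left h
  have h4 : ∀ a ∈ S', (F a).card = (F e).card := fun a ha =>
    le_antisymm (h3 _ ha _ (by simp [hS'])) (h3 _ (by simp [hS']) _ ha)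
  rw [h1, h2, Finset.card_biUnion (hdisj _), Finset.card_biUnion (hdisj _),
    Finset.sum_congr rfl fun a ha => h4 a (Finset.mem_insert_of_mem ha),
    Finset.sum_congr rfl h4, Finset.sum_const, Finset.sum_const, smul_eq_mul, smul_eq_mul, hS',
    Finset.card_insert_of_notMem he]
  ring

/-- `S` is enlarged point by point to the whole set, which every map reaches. This is a form of
Cayley's formula for rooted forests. -/
theorem card_mul_card_reaching (S : Finset V) :
    Fintype.card V * (reaching S).card = S.card * Fintype.card V ^ Fintype.card V := by
  induction h : Fintype.card V - S.card generalizing S with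
  | zero =>
    have hS : S = Finset.univ := by
      rw [← Finset.card_eq_iff_eq_univ]
      have := Finset.card_le_univ S
      omega
    have : reaching S = Finset.univ := by
      rw [Finset.eq_univ_iff_forall]
      exact fun f => mem_reaching.2 fun v => ⟨v, .base (by simp [hS])⟩
    rw [this, hS]
    simp
  | succ n ih =>
    obtain ⟨e, he⟩ : ∃ e, e ∉ S := by
      by_contra hcon
      push Not at hcon
      rw [Finset.eq_univ_of_forall hcon, Finset.card_univ] at h
      omega
    have h1 := card_reaching_insert he
    have h2 := ih (insert e S) (by rw [Finset.card_insert_of_notMem he]; omega)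
    rw [Finset.card_insert_of_notMem he] at h2
    apply Nat.eq_of_mul_eq_mul_left (Nat.add_pos_right S.card one_pos)
    calc (S.card + 1) * (Fintype.card V * (reaching S).card)
        = Fintype.card V * ((S.card + 1) * (reaching S).card) := by ring
      _ = S.card * (Fintype.card V * (reaching (insert e S)).card) := by rw [h1]; ring
      _ = _ := by rw [h2]; ring

end forests

/-! ### Orders of exits with prescribed last exits. -/

theorem card_filter_perm_apply_eq {n : ℕ} (a b : Fin (n + 1)) :
    (Finset.univ.filter fun p : Perm (Fin (n + 1)) => p a = b).card = n.factorial := by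
  have h1 : ∀ c, (Finset.univ.filter fun p : Perm (Fin (n + 1)) => p a = c).card =
      (Finset.univ.filter fun p : Perm (Fin (n + 1)) => p a = b).card := by
    intro c
    refine Finset.card_bij (fun p _ => swap b c * p) ?_ ?_ ?_
    · intro p hp
      simp only [Finset.mem_filter, Finset.mem_univ, true_and] at hp ⊢
      simp [hp]
    · intro p _ q _ h
      exact mul_left_cancel h
    · intro p hp
      refine ⟨swap b c * p, ?_, ?_⟩
      · simp only [Finset.mem_filter, Finset.mem_univ, true_and] at hp ⊢
        simp [hp]
      · rw [← mul_assoc, swap_mul_self, one_mul]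
  have h2 := Finset.card_eq_sum_card_fiberwise (f := fun p : Perm (Fin (n + 1)) => p a)
    (s := Finset.univ) (t := Finset.univ) (by simp)
  rw [Finset.sum_congr rfl fun c _ => h1 c] at h2
  simp only [Finset.card_univ, Fintype.card_perm, Fintype.card_fin, Finset.sum_const,
    smul_eq_mul, Nat.factorial_succ] at h2
  exact (Nat.eq_of_mul_eq_mul_left (Nat.succ_pos n) h2).symm

/-- Each map in `reaching {s}` is the map of last exits of `n! ^ (n + 1)` lists. Its value at `s` is
free, and the tree condition leaves one map in `n + 1`. -/
theorem card_exit_lists {n : ℕ} (s : Fin (n + 1)) :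
    (n + 1) * Nat.card {L : Fin (n + 1) → Perm (Fin (n + 1)) //
      (fun c => L c (Fin.last n)) ∈ reaching {s}} = (n + 1).factorial ^ (n + 1) := by
  classical
  rw [Nat.card_eq_fintype_card, Fintype.card_subtype]
  have h1 := Finset.card_eq_sum_card_fiberwise
    (f := fun (L : Fin (n + 1) → Perm (Fin (n + 1))) c => L c (Fin.last n))
    (s := Finset.univ.filter fun L : Fin (n + 1) → Perm (Fin (n + 1)) =>
      (fun c => L c (Fin.last n)) ∈ reaching {s}) (t := reaching {s})
    (by intro L hL; simpa using hL)
  have h2 : ∀ f ∈ reaching {s}, ((Finset.univ.filter fun L : Fin (n + 1) → Perm (Fin (n + 1)) =>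
      (fun c => L c (Fin.last n)) ∈ reaching {s}).filter fun L =>
        (fun c => L c (Fin.last n)) = f).card = n.factorial ^ (n + 1) := by
    intro f hf
    have : ((Finset.univ.filter fun L : Fin (n + 1) → Perm (Fin (n + 1)) =>
      (fun c => L c (Fin.last n)) ∈ reaching {s}).filter fun L =>
        (fun c => L c (Fin.last n)) = f) = Fintype.piFinset fun c =>
          Finset.univ.filter fun p : Perm (Fin (n + 1)) => p (Fin.last n) = f c := by
      ext L
      simp only [Finset.mem_filter, Finset.mem_univ, true_and, Fintype.mem_piFinset]
      constructor
      · rintro ⟨-, h⟩ c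
        exact congrFun h c
      · intro h
        have h' : (fun c => L c (Fin.last n)) = f := funext h
        exact ⟨h' ▸ hf, h'⟩
    rw [this, Fintype.card_piFinset]
    simp [card_filter_perm_apply_eq]
  rw [h1, Finset.sum_congr rfl h2, Finset.sum_const, smul_eq_mul, ← mul_assoc]
  have h3 := card_mul_card_reaching ({s} : Finset (Fin (n + 1)))
  rw [Fintype.card_fin, Finset.card_singleton, one_mul] at h3
  rw [h3, ← mul_pow, Nat.factorial_succ]

/-! ### Rotor walks and completeness of the circuits they trace. -/

section rotor

variable {n : ℕ}

/-- The rotor walk for the exit lists `L` started at `s`: the current letter and the number of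
exits made so far from each letter. -/
def rotorState (L : Fin (n + 1) → Perm (Fin (n + 1))) (s : Fin (n + 1)) :
    ℕ → Fin (n + 1) × (Fin (n + 1) → ℕ)
  | 0 => (s, fun _ => 0)
  | t + 1 => (L (rotorState L s t).1 (Fin.ofNat (n + 1) ((rotorState L s t).2 (rotorState L s t).1)),
      fun c => (rotorState L s t).2 c + if (rotorState L s t).1 = c then 1 else 0)

/-- The letter at time `t` of the rotor walk. -/
def rotorWalk (L : Fin (n + 1) → Perm (Fin (n + 1))) (s : Fin (n + 1)) (t : ℕ) : Fin (n + 1) :=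
  (rotorState L s t).1

/-- The number of exits from `c` before time `t` in the rotor walk. -/
def rotorCount (L : Fin (n + 1) → Perm (Fin (n + 1))) (s : Fin (n + 1)) (t : ℕ)
    (c : Fin (n + 1)) : ℕ := (rotorState L s t).2 c

variable (L : Fin (n + 1) → Perm (Fin (n + 1))) (s : Fin (n + 1))

theorem rotorWalk_succ (t : ℕ) : rotorWalk L s (t + 1) =
    L (rotorWalk L s t) (Fin.ofNat (n + 1) (rotorCount L s t (rotorWalk L s t))) := rfl

theorem rotorCount_succ (t : ℕ) (c : Fin (n + 1)) : rotorCount L s (t + 1) c =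
    rotorCount L s t c + if rotorWalk L s t = c then 1 else 0 := rfl

theorem rotorCount_zero (c : Fin (n + 1)) : rotorCount L s 0 c = 0 := rfl

theorem rotorWalk_zero : rotorWalk L s 0 = s := rfl

theorem rotorCount_mono (c : Fin (n + 1)) : Monotone fun t => rotorCount L s t c :=
  monotone_nat_of_le_succ fun t => by rw [rotorCount_succ]; omega

theorem rotorCount_lt {i j : ℕ} (hij : i < j) :
    rotorCount L s i (rotorWalk L s i) < rotorCount L s j (rotorWalk L s i) := by
  have h1 := rotorCount_mono L s (rotorWalk L s i) (Nat.succ_le_of_lt hij)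
  have h2 := rotorCount_succ L s i (rotorWalk L s i)
  simp only [if_true] at h2
  simp only [Nat.succ_eq_add_one] at h1
  omega

theorem sum_rotorCount (t : ℕ) : ∑ c, rotorCount L s t c = t := by
  induction t with
  | zero => simp [rotorCount_zero]
  | succ t ih => simp [rotorCount_succ, Finset.sum_add_distrib, ih]

theorem exists_rotorCount_eq (c : Fin (n + 1)) (j : ℕ) : ∀ {t : ℕ}, j < rotorCount L s t c →
    ∃ i < t, rotorWalk L s i = c ∧ rotorCount L s i c = j
  | 0, h => by simp [rotorCount_zero] at h
  | t + 1, h => by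
    by_cases h1 : j < rotorCount L s t c
    · obtain ⟨i, hi, h2⟩ := exists_rotorCount_eq c j h1
      exact ⟨i, by omega, h2⟩
    · rw [rotorCount_succ] at h
      split_ifs at h with h2
      · exact ⟨t, by omega, h2, by omega⟩
      · omega

/-- Balance of entries and exits: the start counts as an entry, and the present visit has not been
left yet. -/
theorem card_entries (t : ℕ) (v : Fin (n + 1)) :
    ((Finset.range t).filter fun i => rotorWalk L s (i + 1) = v).card + (if s = v then 1 else 0) =
      rotorCount L s t v + if rotorWalk L s t = v then 1 else 0 := by
  induction t with
  | zero => rw [rotorCount_zero, rotorWalk_zero]; simp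
  | succ t ih =>
    rw [Finset.range_add_one, Finset.filter_insert, rotorCount_succ, ← ih]
    split_ifs with h <;> simp

theorem exists_exhausted : ∃ t, n < rotorCount L s t (rotorWalk L s t) := by
  by_contra hcon
  push Not at hcon
  have h1 : ∀ t c, rotorCount L s t c ≤ n + 1 := by
    intro t c
    induction t with
    | zero => simp [rotorCount_zero]
    | succ t ih =>
      rw [rotorCount_succ]
      split_ifs with h
      · have := hcon t
        rw [h] at this
        omega
      · omega
  have h2 := sum_rotorCount L s ((n + 1) * (n + 1) + 1)
  have h3 := Finset.sum_le_card_nsmul Finset.univ _ _ fun c _ =>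
    h1 ((n + 1) * (n + 1) + 1) c
  rw [h2] at h3
  simp at h3

theorem eq_of_rotor_arc_eq {N : ℕ} (hN : ∀ i < N, rotorCount L s i (rotorWalk L s i) ≤ n) {i j : ℕ}
    (hi : i < N) (hj : j < N) (h1 : rotorWalk L s i = rotorWalk L s j)
    (h2 : rotorWalk L s (i + 1) = rotorWalk L s (j + 1)) : i = j := by
  have hci := hN i hi
  have hcj := hN j hj
  rw [rotorWalk_succ, rotorWalk_succ, ← h1] at h2
  have h3 := congrArg Fin.val ((L _).injective h2)
  rw [← h1] at hcj
  rw [Fin.val_ofNat, Fin.val_ofNat, Nat.mod_eq_of_lt (by omega), Nat.mod_eq_of_lt (by omega)] at h3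
  rcases lt_trichotomy i j with h | h | h
  · have := rotorCount_lt L s h
    omega
  · exact h
  · have := rotorCount_lt L s h
    rw [← h1] at this
    omega

/-- If all last exits lead to `s`, the rotor walk traverses each arc before it needs an exit from an
exhausted letter. -/
theorem rotor_complete (hL : (fun c => L c (Fin.last n)) ∈ reaching {s}) :
    (∀ c, rotorCount L s ((n + 1) * (n + 1)) c = n + 1) ∧
      rotorWalk L s ((n + 1) * (n + 1)) = s ∧
      ∀ i < (n + 1) * (n + 1), rotorCount L s i (rotorWalk L s i) ≤ n := by
  classical
  have hex := exists_exhausted L s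
  set N := Nat.find hex with hNdef
  have hN : ∀ i < N, rotorCount L s i (rotorWalk L s i) ≤ n := fun i hi =>
    not_lt.1 (Nat.find_min hex hi)
  have hNs : n < rotorCount L s N (rotorWalk L s N) := Nat.find_spec hex
  have hle : ∀ c, rotorCount L s N c ≤ n + 1 := by
    intro c
    by_contra hcon
    push Not at hcon
    obtain ⟨i, hi, h1, h2⟩ := exists_rotorCount_eq L s c (n + 1) hcon
    have := hN i hi
    rw [h1] at this
    omega
  set E : Fin (n + 1) → Finset ℕ := fun v =>
    (Finset.range N).filter fun i => rotorWalk L s (i + 1) = v with hE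
  have hinj : ∀ v, Set.InjOn (rotorWalk L s) (E v) := by
    intro v i hi j hj h
    simp only [hE, Finset.coe_filter, Finset.mem_range, Set.mem_ofPred_eq] at hi hj
    exact eq_of_rotor_arc_eq L s hN hi.1 hj.1 h (hi.2.trans hj.2.symm)
  have hEle : ∀ v, (E v).card ≤ n + 1 := by
    intro v
    have := Finset.card_le_univ ((E v).image (rotorWalk L s))
    rwa [Finset.card_image_of_injOn (hinj v), Fintype.card_fin] at this
  -- At any other letter the walk would have entered once more than it left, hence more than `n + 1`
  -- times, although no arc is used twice.
  have hws : rotorWalk L s N = s := by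
    by_contra hcon
    have h1 := card_entries L s N (rotorWalk L s N)
    rw [if_neg (Ne.symm hcon), if_pos rfl] at h1
    have := hEle (rotorWalk L s N)
    simp only [hE] at this
    omega
  have hall : ∀ c, rotorCount L s N c = n + 1 → ∀ c', ∃ i < N, rotorWalk L s i = c' ∧
      rotorWalk L s (i + 1) = c := by
    intro c hc c'
    have h1 := card_entries L s N c
    rw [hws, hc] at h1
    have h2 : ((E c).image (rotorWalk L s)).card = n + 1 := by
      rw [Finset.card_image_of_injOn (hinj c)]
      simp only [hE]
      omega
    have h3 : (E c).image (rotorWalk L s) = Finset.univ := by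
      rw [← Finset.card_eq_iff_eq_univ, h2, Fintype.card_fin]
    have h4 : c' ∈ (E c).image (rotorWalk L s) := h3 ▸ Finset.mem_univ _
    simp only [hE, Finset.mem_image, Finset.mem_filter, Finset.mem_range] at h4
    obtain ⟨i, ⟨h5, h6⟩, h7⟩ := h4
    exact ⟨i, h5, h7, h6⟩
  -- Induction along the tree of last exits, starting at `s`: if all exits of a letter are used, so
  -- are all arcs into it. Among these is the last exit of each of its children in the tree, whose
  -- exits are then used up too.
  have hfull : ∀ c, rotorCount L s N c = n + 1 := by
    intro c
    obtain ⟨a, ha⟩ := mem_reaching.1 hL c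
    induction ha with
    | base h =>
      rw [Finset.mem_singleton.1 h]
      rw [hws] at hNs
      exact le_antisymm (hle _) hNs
    | @step v a h _ ih =>
      obtain ⟨i, hi, h1, h2⟩ := hall _ ih v
      have h3 := hN i hi
      rw [rotorWalk_succ, h1] at h2
      have h4 := congrArg Fin.val ((L _).injective h2)
      rw [h1] at h3
      rw [Fin.val_ofNat, Nat.mod_eq_of_lt (by omega), Fin.val_last] at h4
      have h5 := rotorCount_lt L s hi
      rw [h1] at h5
      exact le_antisymm (hle _) (by omega)
  have hNeq : N = (n + 1) * (n + 1) := by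
    have := sum_rotorCount L s N
    rw [Finset.sum_congr rfl fun c _ => hfull c] at this
    simpa using this.symm
  rw [← hNeq]
  exact ⟨hfull, hws, hN⟩

end rotor

/-! ### Counting Eulerian transition systems. -/

/-- A permutation of the arcs that moves each arc to an adjacent one comes from a transition
system. -/
theorem exists_stepPerm_eq {V : Type*} (G : Perm (V × V)) (hG : ∀ x, (G x).1 = x.2) :
    ∃ T : V → Perm V, stepPerm T = G := by
  have hG' : ∀ x, (G.symm x).2 = x.1 := fun x => by rw [← hG, apply_symm_apply]
  have e1 : ∀ c e, (e, (G (c, e)).2) = G (c, e) := fun c e => Prod.ext (hG (c, e)).symm rfl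
  have e2 : ∀ c e, ((G.symm (e, c)).1, e) = G.symm (e, c) := fun c e =>
    Prod.ext rfl (hG' (e, c)).symm
  refine ⟨fun e => ⟨fun c => (G (c, e)).2, fun c => (G.symm (e, c)).1, fun c => ?_, fun c => ?_⟩,
    Equiv.ext fun x => Prod.ext (hG x).symm rfl⟩
  · dsimp only
    rw [e1, symm_apply_apply]
  · dsimp only
    rw [e2, apply_symm_apply]

theorem isFullCycle_finRotate (m : ℕ) : IsFullCycle (finRotate (m + 1)) := by
  have h : ∀ i : Fin (m + 1), (finRotate (m + 1)).SameCycle 0 i := by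
    intro i
    induction i using Fin.induction with
    | zero => rfl
    | succ i ih =>
      have : finRotate (m + 1) i.castSucc = i.succ := by
        rw [finRotate_apply, Fin.coeSucc_eq_succ]
      rw [← this, Perm.sameCycle_apply_right]
      exact ih
  exact fun x y => (h x).symm.trans (h y)

theorem exists_walk_eq_rotorWalk {n : ℕ} (L : Fin (n + 1) → Perm (Fin (n + 1))) (s : Fin (n + 1))
    (hL : (fun c => L c (Fin.last n)) ∈ reaching {s}) :
    ∃ T, IsFullCycle (stepPerm T) ∧ ∃ x, ∀ t ≤ (n + 1) * (n + 1),
      walk T x t = rotorWalk L s t := by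
  obtain ⟨h1, h2, h3⟩ := rotor_complete L s hL
  obtain ⟨m, hm⟩ : ∃ m, (n + 1) * (n + 1) = m + 1 := ⟨_, rfl⟩
  rw [hm] at h1 h2 h3 ⊢
  -- The exit index `n + 1` is reduced modulo `n + 1`, so after the circuit closes the walk leaves
  -- `s` by its first exit again.
  have hlast : rotorWalk L s (m + 1 + 1) = rotorWalk L s 1 := by
    rw [rotorWalk_succ, h2, h1, rotorWalk_succ, rotorWalk_zero, rotorCount_zero]
    congr 1
    apply Fin.ext
    simp
  set g : Fin (m + 1) → Fin (n + 1) × Fin (n + 1) := fun i =>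
    (rotorWalk L s i, rotorWalk L s (i + 1)) with hg
  have hginj : Function.Injective g := fun i j h => by
    rw [hg, Prod.mk.injEq] at h
    exact Fin.ext (eq_of_rotor_arc_eq L s h3 i.2 j.2 h.1 h.2)
  have hgbij : Function.Bijective g :=
    (Fintype.bijective_iff_injective_and_card g).2 ⟨hginj, by simp [hm]⟩
  set e := Equiv.ofBijective g hgbij with he
  have hrot : ∀ i : Fin (m + 1), g (finRotate (m + 1) i) =
      (rotorWalk L s (i + 1), rotorWalk L s (i + 1 + 1)) := by
    intro i
    rcases Fin.eq_castSucc_or_eq_last i with ⟨j, rfl⟩ | rfl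
    · rw [finRotate_apply, Fin.coeSucc_eq_succ]
      rfl
    · rw [finRotate_last]
      simp only [hg, Fin.val_last, Fin.val_zero, zero_add, hlast, h2, rotorWalk_zero]
  have hadj : ∀ x, (e.permCongr (finRotate (m + 1)) x).1 = x.2 := by
    intro x
    obtain ⟨i, rfl⟩ := e.surjective x
    rw [permCongr_apply, symm_apply_apply, he, ofBijective_apply, hrot]
    rfl
  obtain ⟨T, hT⟩ := exists_stepPerm_eq _ hadj
  refine ⟨T, by rw [hT]; exact (isFullCycle_finRotate m).permCongr e, g 0, ?_⟩
  have key : ∀ t, t ≤ m → (stepPerm T ^ t) (g 0) = (rotorWalk L s t, rotorWalk L s (t + 1)) := by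
    intro t ht
    induction t with
    | zero => rfl
    | succ t ih =>
      rw [pow_succ', Perm.mul_apply, ih (by omega), hT]
      have : (rotorWalk L s t, rotorWalk L s (t + 1)) = e ⟨t, by omega⟩ := rfl
      rw [this, permCongr_apply, symm_apply_apply, he, ofBijective_apply, hrot]
  intro t ht
  rcases Nat.lt_or_ge m t with h | h
  · have : t = m + 1 := by omega
    subst this
    have := stepPerm_pow_apply T (g 0) m
    rw [key m le_rfl] at this
    exact (congrArg Prod.snd this).symm
  · exact congrArg Prod.fst (key t h)

/-- The complete walk uses the `j`-th exit of each letter for every `j`, so all lists can be read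
off from it. -/
theorem rotor_eq_of_walk_eq {n : ℕ} {L L' : Fin (n + 1) → Perm (Fin (n + 1))} {s s' : Fin (n + 1)}
    (hL : (fun c => L c (Fin.last n)) ∈ reaching {s})
    (h : ∀ t ≤ (n + 1) * (n + 1), rotorWalk L s t = rotorWalk L' s' t) : s = s' ∧ L = L' := by
  refine ⟨h 0 (Nat.zero_le _), ?_⟩
  obtain ⟨h1, h2, h3⟩ := rotor_complete L s hL
  have hcnt : ∀ t ≤ (n + 1) * (n + 1), ∀ c, rotorCount L s t c = rotorCount L' s' t c := by
    intro t ht c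
    induction t with
    | zero => rfl
    | succ t ih => rw [rotorCount_succ, rotorCount_succ, ih (by omega), h t (by omega)]
  funext c
  ext1 j
  obtain ⟨i, hi, h4, h5⟩ := exists_rotorCount_eq L s c j (t := (n + 1) * (n + 1))
    (by rw [h1]; exact j.2)
  have h6 := h (i + 1) (by omega)
  rw [rotorWalk_succ, rotorWalk_succ, ← h i hi.le, h4, ← hcnt i hi.le, h5] at h6
  simpa using h6

/-- A lower bound for the number of Eulerian transition systems of the complete digraph with
loops. -/
theorem factorial_pow_le_card_eulerian {k : ℕ} (hk : 1 ≤ k) :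
    k.factorial ^ k ≤ Nat.card {T : Fin k → Perm (Fin k) // IsFullCycle (stepPerm T)} * k ^ 2 := by
  obtain ⟨n, rfl⟩ := Nat.exists_eq_add_of_le' hk
  classical
  let D := Σ s : Fin (n + 1), {L : Fin (n + 1) → Perm (Fin (n + 1)) //
      (fun c => L c (Fin.last n)) ∈ reaching {s}}
  -- Each of the `n + 1` starting letters contributes the share `1 / (n + 1)` of all lists.
  have hD : Nat.card D = (n + 1).factorial ^ (n + 1) := by
    apply Nat.eq_of_mul_eq_mul_left (Nat.succ_pos n)
    rw [Nat.card_sigma, Finset.mul_sum, Finset.sum_congr rfl fun s _ => card_exit_lists s]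
    simp
  have hP : Nat.card ({T : Fin (n + 1) → Perm (Fin (n + 1)) // IsFullCycle (stepPerm T)} ×
      (Fin (n + 1) × Fin (n + 1))) =
      Nat.card {T : Fin (n + 1) → Perm (Fin (n + 1)) // IsFullCycle (stepPerm T)} *
        (n + 1) ^ 2 := by
    rw [Nat.card_prod, Nat.card_prod, Nat.card_eq_fintype_card (α := Fin (n + 1)),
      Fintype.card_fin, sq]
  rw [← hD, ← hP]
  choose T hT x hx using fun d : D => exists_walk_eq_rotorWalk d.2.1 d.1 d.2.2
  refine Nat.card_le_card_of_injective (fun d => (⟨T d, hT d⟩, x d)) fun d d' h => ?_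
  rw [Prod.mk.injEq, Subtype.mk.injEq] at h
  obtain ⟨h1, h2⟩ := rotor_eq_of_walk_eq (s' := d'.1) (L' := d'.2.1) d.2.2 fun t ht => by
    rw [← hx d t ht, ← hx d' t ht, h.1, h.2]
  obtain ⟨s, L, hL⟩ := d
  obtain ⟨s', L', hL'⟩ := d'
  dsimp only at h1 h2
  subst h1 h2
  rfl

/-! ### Changing the transitions at one letter. -/

section local_change

variable {V : Type} [DecidableEq V]

/-- The transition system `T` with the arcs into `e` permuted by `ρ` before the transition. -/
def twist (T : V → Perm V) (e : V) (ρ : Perm V) : V → Perm V := Function.update T e (T e * ρ)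

theorem twist_self (T : V → Perm V) (e : V) (ρ : Perm V) : twist T e ρ e = T e * ρ := by
  simp [twist]

theorem twist_of_ne (T : V → Perm V) {e e' : V} (h : e' ≠ e) (ρ : Perm V) :
    twist T e ρ e' = T e' := by
  simp [twist, h]

theorem twist_twist_inv (T : V → Perm V) (e : V) (ρ : Perm V) :
    twist (twist T e ρ) e ρ⁻¹ = T := by
  simp [twist]

variable [Fintype V]

/-- A twist at `e` multiplies `stepPerm T` by a permutation supported on the arcs into `e`; `r` is
the first return map to these arcs. -/
theorem exists_isFullCycle_twist_iff {T : V → Perm V} (hT : IsFullCycle (stepPerm T)) (e : V) :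
    ∃ r : Perm V, ∀ ρ, IsFullCycle (stepPerm (twist T e ρ)) ↔ IsFullCycle (r * ρ) := by
  let A : {x : V × V // x.2 = e} ≃ V :=
    ⟨fun x => x.1.1, fun c => ⟨(c, e), rfl⟩, by rintro ⟨⟨c, e⟩, rfl⟩; rfl, fun c => rfl⟩
  let E : V × V ≃ V ⊕ Fin (Fintype.card {x : V × V // ¬ x.2 = e}) :=
    (Equiv.sumCompl fun x : V × V => x.2 = e).symm.trans
      (Equiv.sumCongr A (Fintype.equivFin _))
  have : Nonempty V := ⟨e⟩
  obtain ⟨r, hr⟩ := exists_return_perm_sum V _ (E.permCongr (stepPerm T)) (hT.permCongr E)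
  refine ⟨r, fun ρ => ?_⟩
  rw [← hr, ← isFullCycle_permCongr E]
  have : E.permCongr (stepPerm (twist T e ρ)) =
      E.permCongr (stepPerm T) * Perm.sumCongr ρ 1 := by
    ext1 y
    obtain ⟨⟨c, d⟩, rfl⟩ := E.surjective y
    rw [Perm.mul_apply, permCongr_apply, permCongr_apply, symm_apply_apply]
    congr 1
    by_cases hd : d = e
    · subst hd
      have h1 : ∀ c, E (c, d) = Sum.inl c := by
        intro c
        simp only [E, trans_apply]
        rw [sumCompl_symm_apply_of_pos (p := fun x : V × V => x.2 = d) (a := (c, d)) rfl]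
        rfl
      rw [h1, Perm.sumCongr_apply, Sum.map_inl, ← h1, symm_apply_apply]
      simp [stepPerm, twist_self]
    · have h1 : Perm.sumCongr ρ 1 (E (c, d)) = E (c, d) := by
        simp only [E, trans_apply]
        rw [sumCompl_symm_apply_of_neg (p := fun x : V × V => x.2 = e) (a := (c, d)) hd]
        simp
      rw [h1, symm_apply_apply]
      simp [stepPerm, twist_of_ne T hd]
  rw [this]

/-- The conjugate of `σ` by the transition at `e`. -/
def pulledBack (σ : Perm V) (T : V → Perm V) (e : V) : Perm V := (T e)⁻¹ * σ * T e

/-- At the pair `{e, σ e}` the two conjugates of `σ` act jointly transitively. -/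
def LinkedAt (σ : Perm V) (T : V → Perm V) (e : V) : Prop :=
  JointlyTransitive (pulledBack σ T e) (pulledBack σ T (σ e))

theorem JointlyTransitive.symm {A : Type*} {P Q : Perm A} (h : JointlyTransitive P Q) :
    JointlyTransitive Q P := fun x y =>
  eqvGen_rec ⟨fun _ => .refl _, fun h => .symm _ _ h, fun h h' => .trans _ _ _ h h'⟩
    (fun _ _ hab => .rel _ _ hab.symm) (h x y)

theorem card_isFullCycle_twist_le (T : V → Perm V) (e : V) :
    Nat.card {ρ : Perm V // IsFullCycle (stepPerm (twist T e ρ))} ≤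
      (Fintype.card V - 1).factorial := by
  have : Nonempty V := ⟨e⟩
  rcases isEmpty_or_nonempty {ρ : Perm V // IsFullCycle (stepPerm (twist T e ρ))} with h | ⟨ρ₀, h₀⟩
  · simp
  · obtain ⟨r, hr⟩ := exists_isFullCycle_twist_iff h₀ e
    have h2 := card_isFullCycle_le V
    rw [Nat.card_eq_fintype_card (α := V)] at h2
    have h3 : ∀ ρ : {ρ : Perm V // IsFullCycle (stepPerm (twist T e ρ))},
        IsFullCycle (r * (ρ₀⁻¹ * ρ.1)) := by
      intro ρ
      rw [← hr]
      convert ρ.2 using 2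
      simp [twist]
    refine (Nat.card_le_card_of_injective (fun ρ => ⟨r * (ρ₀⁻¹ * ρ.1), h3 ρ⟩) ?_).trans h2
    intro ρ ρ' h
    simpa [Subtype.ext_iff] using h

/-- With `ρ = r⁻¹ * z` the twist is Eulerian exactly for full cycles `z`, and it turns the matching
at `σ e` into a conjugate by `z`, while the matching at `e` stays. Hence `linkCount` counts the good
twists. -/
theorem le_card_linkedAt_twist {σ : Perm V} {T : V → Perm V} (hT : IsFullCycle (stepPerm T))
    {e : V} (he : σ e ≠ e) {a : ℕ}
    (ha : ∀ τ υ : Perm V, a ≤ linkCount (τ⁻¹ * σ * τ) (υ⁻¹ * σ * υ)) :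
    a ≤ Nat.card {ρ : Perm V // IsFullCycle (stepPerm (twist T (σ e) ρ)) ∧
      LinkedAt σ (twist T (σ e) ρ) e} := by
  obtain ⟨r, hr⟩ := exists_isFullCycle_twist_iff hT (σ e)
  refine (ha (T e) (T (σ e) * r⁻¹)).trans ?_
  refine Nat.card_le_card_of_injective (fun z => ⟨r⁻¹ * z.1, ?_, ?_⟩) ?_
  · rw [hr, mul_inv_cancel_left]
    exact z.2.1
  · have h := z.2.2
    unfold LinkedAt pulledBack
    rw [twist_self, twist_of_ne _ he.symm]
    convert h using 1
    simp [mul_assoc]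
  · intro z z' h
    simpa [Subtype.ext_iff] using h

/-- Double counting of pairs `(T, ρ)`: each `T` has at least `a` twists into the linked systems, and
each linked system is reached from at most `(k - 1)!` systems, through the inverse twists. -/
theorem mul_card_le_card_linkedAt {σ : Perm V} {e : V} (he : σ e ≠ e) {a : ℕ}
    (ha : ∀ τ υ : Perm V, a ≤ linkCount (τ⁻¹ * σ * τ) (υ⁻¹ * σ * υ))
    (Q : (V → Perm V) → Prop) (hQ : ∀ T ρ, Q T → Q (twist T (σ e) ρ)) :
    a * Nat.card {T : V → Perm V // IsFullCycle (stepPerm T) ∧ Q T} ≤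
      (Fintype.card V - 1).factorial *
        Nat.card {T : V → Perm V // IsFullCycle (stepPerm T) ∧ Q T ∧ LinkedAt σ T e} := by
  have h1 := card_mul_le_card_sigma
    (I := {T : V → Perm V // IsFullCycle (stepPerm T) ∧ Q T})
    (fun T => le_card_linkedAt_twist T.2.1 he ha)
  have h2 : Nat.card (Σ T : {T : V → Perm V // IsFullCycle (stepPerm T) ∧ Q T ∧ LinkedAt σ T e},
      {ρ : Perm V // IsFullCycle (stepPerm (twist T.1 (σ e) ρ))}) ≤
      Nat.card {T : V → Perm V // IsFullCycle (stepPerm T) ∧ Q T ∧ LinkedAt σ T e} *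
        (Fintype.card V - 1).factorial := by
    have := Fintype.ofFinite {T : V → Perm V // IsFullCycle (stepPerm T) ∧ Q T ∧ LinkedAt σ T e}
    rw [Nat.card_sigma, Nat.card_eq_fintype_card, ← smul_eq_mul, ← Finset.card_univ]
    exact Finset.sum_le_card_nsmul _ _ _ fun T _ => card_isFullCycle_twist_le T.1 (σ e)
  rw [mul_comm]
  refine h1.trans (le_trans ?_ (h2.trans (mul_comm _ _).le))
  refine Nat.card_le_card_of_injective (fun p => ⟨⟨twist p.1.1 (σ e) p.2.1, p.2.2.1,
    hQ _ _ p.1.2.2, p.2.2.2⟩, ⟨p.2.1⁻¹, ?_⟩⟩) ?_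
  · dsimp only
    rw [twist_twist_inv]
    exact p.1.2.1
  · rintro ⟨⟨T, hT⟩, ⟨ρ, hρ⟩⟩ ⟨⟨T', hT'⟩, ⟨ρ', hρ'⟩⟩ h
    simp only [Sigma.mk.injEq, Subtype.mk.injEq] at h
    obtain ⟨h3, h4⟩ := h
    have h5 : ρ = ρ' := by
      rw [← inv_inj]
      have h6 : ∀ {p p' : (V → Perm V)} {q : (V → Perm V) → Perm V → Prop}
          (x : Subtype (q p)) (y : Subtype (q p')), p = p' → x ≍ y → x.1 = y.1 := by
        rintro p _ q x y rfl h
        rw [eq_of_heq h]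
      exact h6 (q := fun T ρ => IsFullCycle (stepPerm (twist T (σ e) ρ))) _ _ h3 h4
    subst h5
    have h7 : T = T' := by
      rw [← twist_twist_inv T (σ e) ρ, h3, twist_twist_inv]
    subst h7
    rfl

/-- The condition on `J` makes the pairs `{e, σ e}` disjoint, so a twist at `σ e` does not disturb
the links already obtained. -/
theorem pow_mul_card_le_card_linkedAt {σ : Perm V} {a : ℕ}
    (ha : ∀ τ υ : Perm V, a ≤ linkCount (τ⁻¹ * σ * τ) (υ⁻¹ * σ * υ)) (J : Finset V)
    (hJ : ∀ e ∈ J, σ e ∉ J) :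
    a ^ J.card * Nat.card {T : V → Perm V // IsFullCycle (stepPerm T)} ≤
      (Fintype.card V - 1).factorial ^ J.card *
        Nat.card {T : V → Perm V // IsFullCycle (stepPerm T) ∧ ∀ e ∈ J, LinkedAt σ T e} := by
  induction J using Finset.induction_on with
  | empty => simp
  | insert e J he ih =>
    have h1 := ih fun e' he' h => hJ e' (Finset.mem_insert_of_mem he') (Finset.mem_insert_of_mem h)
    have hne : σ e ∉ insert e J := hJ e (Finset.mem_insert_self e J)
    rw [Finset.mem_insert, not_or] at hne
    have h2 := mul_card_le_card_linkedAt hne.1 ha (fun T => ∀ e ∈ J, LinkedAt σ T e) (by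
      intro T ρ h e' he'
      unfold LinkedAt pulledBack
      rw [twist_of_ne, twist_of_ne]
      · exact h e' he'
      · rw [Ne, σ.injective.eq_iff]
        rintro rfl
        exact he he'
      · rintro rfl
        exact hne.2 he')
    rw [Finset.card_insert_of_notMem he, pow_succ', pow_succ', mul_assoc, mul_assoc]
    calc _ ≤ a * ((Fintype.card V - 1).factorial ^ J.card * _) := Nat.mul_le_mul_left a h1
      _ = (Fintype.card V - 1).factorial ^ J.card * (a * _) := by ring
      _ ≤ _ := Nat.mul_le_mul_left _ h2
      _ = _ := by
        rw [mul_left_comm]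
        congr 4
        ext T
        simp [and_comm]

end local_change

/-! ### Positions of arcs in a walk. -/

section positions

variable {k : ℕ} {T : Fin k → Perm (Fin k)}

theorem walk_sq (hT : IsFullCycle (stepPerm T)) (x : Fin k × Fin k) :
    walk T x (k * k) = x.1 := by
  have := walk_add_card hT x 0
  rwa [Fintype.card_fin] at this

theorem walk_sq_succ (hT : IsFullCycle (stepPerm T)) (x : Fin k × Fin k) :
    walk T x (k * k + 1) = x.2 := by
  have := walk_add_card hT x 1
  rwa [Fintype.card_fin] at this

/-- The position at which the walk traverses the arc from `c` to `e`. -/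
noncomputable def arcPos (hT : IsFullCycle (stepPerm T)) (x : Fin k × Fin k) (c e : Fin k) : ℕ :=
  (exists_walk_eq hT x c e).choose

variable (hT : IsFullCycle (stepPerm T)) (x : Fin k × Fin k)

theorem arcPos_lt (c e : Fin k) : arcPos hT x c e < k * k := by
  have : arcPos hT x c e < Fintype.card (Fin k) * Fintype.card (Fin k) :=
    (exists_walk_eq hT x c e).choose_spec.1
  rwa [Fintype.card_fin] at this

theorem walk_arcPos (c e : Fin k) : walk T x (arcPos hT x c e) = c :=
  (exists_walk_eq hT x c e).choose_spec.2.1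

theorem walk_arcPos_succ (c e : Fin k) : walk T x (arcPos hT x c e + 1) = e :=
  (exists_walk_eq hT x c e).choose_spec.2.2

theorem arcPos_eq {t : ℕ} (ht : t < k * k) {c e : Fin k} (hc : walk T x t = c)
    (he : walk T x (t + 1) = e) : arcPos hT x c e = t :=
  walk_injOn hT x (by rw [Fintype.card_fin]; exact arcPos_lt hT x c e)
    (by rwa [Fintype.card_fin]) ((walk_arcPos hT x c e).trans hc.symm)
    ((walk_arcPos_succ hT x c e).trans he.symm)

theorem walk_arcPos_add_two (c e : Fin k) : walk T x (arcPos hT x c e + 2) = T e c := by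
  rw [walk_add_two, walk_arcPos, walk_arcPos_succ]

theorem arcPos_inj {c c' e e' : Fin k} (h : arcPos hT x c e = arcPos hT x c' e') :
    c = c' ∧ e = e' :=
  ⟨by rw [← walk_arcPos hT x c e, h, walk_arcPos],
    by rw [← walk_arcPos_succ hT x c e, h, walk_arcPos_succ]⟩

theorem arcPos_self : arcPos hT x x.1 x.2 = 0 :=
  arcPos_eq hT x (by have := arcPos_lt hT x x.1 x.2; omega) rfl rfl

/-- The position after the arc `(c, e)` is the final one only if the next arc is the first arc `x`
again; there the label is not governed by the next letter. -/
theorem arcPos_succ_lt {c e : Fin k} (h : e ≠ x.1 ∨ T e c ≠ x.2) :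
    arcPos hT x c e + 1 < k * k := by
  have h1 := arcPos_lt hT x c e
  by_contra hcon
  have h2 : arcPos hT x c e + 1 = k * k := by omega
  rcases h with h | h
  · rw [← walk_arcPos_succ hT x c e, h2, walk_sq hT] at h
    exact h rfl
  · rw [← walk_arcPos_add_two hT x c e, show arcPos hT x c e + 2 = k * k + 1 by omega,
      walk_sq_succ hT] at h
    exact h rfl

theorem arcPos_succ_eq {c : Fin k} (h : T x.1 c = x.2) :
    arcPos hT x c x.1 + 1 = k * k := by
  have h0 := arcPos_lt hT x c x.1
  by_contra hcon
  have h1 : arcPos hT x c x.1 + 1 < k * k := by omega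
  have h2 := arcPos_eq hT x h1 (walk_arcPos_succ hT x c x.1) (walk_arcPos_add_two hT x c x.1)
  rw [h, arcPos_self] at h2
  omega

theorem transitions_eq_of_walk_eq {T' : Fin k → Perm (Fin k)} {x x' : Fin k × Fin k}
    (hT : IsFullCycle (stepPerm T)) (hT' : IsFullCycle (stepPerm T'))
    (h : ∀ t ≤ k * k, walk T x t = walk T' x' t) : T = T' ∧ x = x' := by
  have hpos : 0 < k * k := by
    have := arcPos_lt hT x x.1 x.2
    omega
  have hx : x = x' := Prod.ext (h 0 (Nat.zero_le _)) (h 1 hpos)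
  refine ⟨funext fun e => Equiv.ext fun c => ?_, hx⟩
  have h1 := arcPos_lt hT x c e
  have h2 : arcPos hT x c e = arcPos hT' x' c e := (arcPos_eq hT' x' h1
    ((h _ h1.le).symm.trans (walk_arcPos hT x c e))
    ((h _ h1).symm.trans (walk_arcPos_succ hT x c e))).symm
  rw [← walk_arcPos_add_two hT x, ← walk_arcPos_add_two hT' x', ← h2]
  rcases Nat.lt_or_ge (arcPos hT x c e + 1) (k * k) with h3 | h3
  · exact h _ h3
  · have h4 : arcPos hT x c e + 2 = k * k + 1 := by omega
    rw [h4, walk_sq_succ hT, walk_sq_succ hT', hx]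

end positions

/-! ### Recovering the walk from the pattern. -/

section decoding

variable {k : ℕ}

/-- The representative of the pair `{f, σ f}`. -/
def pairRep (σ : Perm (Fin k)) (f : Fin k) : Fin k := min f (σ f)

theorem pairRep_eq_iff {σ : Perm (Fin k)} (hσ : ∀ e, σ (σ e) = e) {f g : Fin k} :
    pairRep σ f = pairRep σ g ↔ g = f ∨ g = σ f := by
  unfold pairRep
  constructor
  · intro h
    rcases min_choice f (σ f) with h1 | h1 <;> rcases min_choice g (σ g) with h2 | h2 <;>
      rw [h1, h2] at h
    · exact Or.inl h.symm
    · exact Or.inr (by rw [h, hσ])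
    · exact Or.inr h.symm
    · exact Or.inl (σ.injective h.symm)
  · rintro (rfl | rfl)
    · rfl
    · rw [hσ, min_comm]

/-- The two letters `a` and `b`, as predecessors of `e`, are joined if the refined letters that
follow the arcs to `e` or those that follow the arcs to `σ e` agree. -/
def LabelJoined {T : Fin k → Perm (Fin k)} (hT : IsFullCycle (stepPerm T)) (σ : Perm (Fin k))
    (x : Fin k × Fin k) (lab : ℕ → Fin k) (e a b : Fin k) : Prop :=
  lab (arcPos hT x a e + 1) = lab (arcPos hT x b e + 1) ∨
    lab (arcPos hT x a (σ e) + 1) = lab (arcPos hT x b (σ e) + 1)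

/-- A labelling of the positions of a walk from whose pattern the walk can be recovered up to a
renaming of the letters: the label is the pair of the next letter if this letter is not fixed by
`σ`, and enough positions carry the same label. -/
structure IsScheme (σ : Perm (Fin k)) (T : Fin k → Perm (Fin k)) (x : Fin k × Fin k)
    (lab : ℕ → Fin k) : Prop where
  full : IsFullCycle (stepPerm T)
  invol : ∀ e, σ (σ e) = e
  fixed_unique : ∀ a b, σ a = a → σ b = b → a = b
  lab_eq : ∀ t < k * k, σ (walk T x (t + 1)) ≠ walk T x (t + 1) →
    lab t = pairRep σ (walk T x (t + 1))
  linked : ∀ e, σ e ≠ e → ∀ c c', Relation.EqvGen (LabelJoined full σ x lab e) c c'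
  repeat_start : ∃ t, 1 ≤ t ∧ t ≤ k * k ∧ walk T x t = x.1 ∧ lab t = lab 0

/-- The positions before a letter fixed by `σ`. -/
def markedPositions (σ : Perm (Fin k)) (w : ℕ → Fin k) : Finset ℕ :=
  (Finset.range (k * k)).filter fun t => σ (w (t + 1)) = w (t + 1)

theorem mem_markedPositions {σ : Perm (Fin k)} {w : ℕ → Fin k} {t : ℕ} :
    t ∈ markedPositions σ w ↔ t < k * k ∧ σ (w (t + 1)) = w (t + 1) := by
  simp [markedPositions]

variable {σ σ' : Perm (Fin k)} {T T' : Fin k → Perm (Fin k)} {x x' : Fin k × Fin k}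
  {lab lab' : ℕ → Fin k}

theorem IsScheme.lab_eq_iff (h : IsScheme σ T x lab) {t t' : ℕ} (ht : t < k * k)
    (ht' : t' < k * k) (hf : σ (walk T x (t + 1)) ≠ walk T x (t + 1))
    (hf' : σ (walk T x (t' + 1)) ≠ walk T x (t' + 1)) :
    lab t = lab t' ↔ walk T x (t' + 1) = walk T x (t + 1) ∨
      walk T x (t' + 1) = σ (walk T x (t + 1)) := by
  rw [h.lab_eq t ht hf, h.lab_eq t' ht' hf', pairRep_eq_iff h.invol]

/-- The positions of the arcs `(c, e)` and `(c, σ e)` share a variable, hence also in the second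
walk, where the next letters are thus equal or partners under `σ'`. Equality would make the second
walk use an arc twice. -/
theorem IsScheme.next_letter_eq (h : IsScheme σ T x lab) (h' : IsScheme σ' T' x' lab')
    (hcode : labelCode (walk T x) lab = labelCode (walk T' x') lab')
    (hmark : markedPositions σ (walk T x) = markedPositions σ' (walk T' x'))
    {e : Fin k} (he : σ e ≠ e) (c : Fin k) :
    walk T' x' (arcPos h.full x c (σ e) + 1) = σ' (walk T' x' (arcPos h.full x c e + 1)) := by
  have ht := arcPos_lt h.full x c e
  have ht' := arcPos_lt h.full x c (σ e)
  have hf : σ (walk T x (arcPos h.full x c e + 1)) ≠ walk T x (arcPos h.full x c e + 1) := by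
    rwa [walk_arcPos_succ]
  have hf' : σ (walk T x (arcPos h.full x c (σ e) + 1)) ≠
      walk T x (arcPos h.full x c (σ e) + 1) := by
    rw [walk_arcPos_succ]
    exact fun h' => he (σ.injective h')
  have hm : ∀ t < k * k, σ (walk T x (t + 1)) ≠ walk T x (t + 1) →
      σ' (walk T' x' (t + 1)) ≠ walk T' x' (t + 1) := by
    intro t ht hne heq
    have : t ∈ markedPositions σ' (walk T' x') := mem_markedPositions.2 ⟨ht, heq⟩
    rw [← hmark] at this
    exact hne (mem_markedPositions.1 this).2
  have h1 : lab (arcPos h.full x c e) = lab (arcPos h.full x c (σ e)) := by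
    rw [h.lab_eq_iff ht ht' hf hf', walk_arcPos_succ, walk_arcPos_succ]
    exact Or.inr rfl
  obtain ⟨h2, h3⟩ := (labelCode_eq_labelCode hcode ht.le ht'.le).1
    ⟨by rw [walk_arcPos, walk_arcPos], h1⟩
  rw [h'.lab_eq_iff ht ht' (hm _ ht hf) (hm _ ht' hf')] at h3
  rcases h3 with h3 | h3
  · have := walk_injOn h'.full x' (by rwa [Fintype.card_fin]) (by rwa [Fintype.card_fin]) h2 h3.symm
    exact absurd (arcPos_inj h.full x this).2.symm he
  · exact h3

theorem IsScheme.exists_renaming (h : IsScheme σ T x lab) (h' : IsScheme σ' T' x' lab')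
    (hcode : labelCode (walk T x) lab = labelCode (walk T' x') lab')
    (hmark : markedPositions σ (walk T x) = markedPositions σ' (walk T' x')) :
    ∃ π : Perm (Fin k), ∀ t ≤ k * k, walk T' x' t = π (walk T x t) := by
  -- The letter of the second walk at an occurrence of `e` does not depend on the predecessor.
  -- Agreement at `e` joins two predecessors directly; agreement at `σ e` is transferred by
  -- `next_letter_eq` and the injectivity of `σ'`.
  have key : ∀ e c c', walk T' x' (arcPos h.full x c e + 1) =
      walk T' x' (arcPos h.full x c' e + 1) := by
    intro e c c'
    by_cases he : σ e = e
    · have hfix : ∀ c, σ' (walk T' x' (arcPos h.full x c e + 1)) =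
          walk T' x' (arcPos h.full x c e + 1) := by
        intro c
        have : arcPos h.full x c e ∈ markedPositions σ (walk T x) :=
          mem_markedPositions.2 ⟨arcPos_lt h.full x c e, by rw [walk_arcPos_succ, he]⟩
        rw [hmark] at this
        exact (mem_markedPositions.1 this).2
      exact h'.fixed_unique _ _ (hfix c) (hfix c')
    · refine eqvGen_rec (s := fun c c' => walk T' x' (arcPos h.full x c e + 1) =
        walk T' x' (arcPos h.full x c' e + 1)) ⟨fun _ => rfl, Eq.symm, Eq.trans⟩ ?_
        (h.linked e he c c')
      rintro a b (hab | hab)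
      · exact ((labelCode_eq_labelCode hcode (arcPos_lt h.full x a e)
          (arcPos_lt h.full x b e)).1 ⟨by rw [walk_arcPos_succ, walk_arcPos_succ], hab⟩).1
      · have h1 := ((labelCode_eq_labelCode hcode (arcPos_lt h.full x a (σ e))
          (arcPos_lt h.full x b (σ e))).1 ⟨by rw [walk_arcPos_succ, walk_arcPos_succ], hab⟩).1
        rw [h.next_letter_eq h' hcode hmark he, h.next_letter_eq h' hcode hmark he] at h1
        exact σ'.injective h1
  have hrep : ∀ t, 1 ≤ t → t ≤ k * k → walk T' x' t =
      walk T' x' (arcPos h.full x x.1 (walk T x t) + 1) := by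
    intro t h1 h2
    obtain ⟨t, rfl⟩ := Nat.exists_eq_add_of_le' h1
    rw [← arcPos_eq h.full x (t := t) (by omega) rfl rfl, key _ _ x.1, walk_arcPos_succ]
  set π : Fin k → Fin k := fun e => walk T' x' (arcPos h.full x x.1 e + 1) with hπ
  have hall : ∀ t ≤ k * k, walk T' x' t = π (walk T x t) := by
    intro t ht
    rcases Nat.eq_zero_or_pos t with rfl | h1
    -- Position `0` has no predecessor; its letter is taken from another position with the same
    -- variable.
    · obtain ⟨t₀, h2, h3, h4, h5⟩ := h.repeat_start
      rw [walk_zero (T := T), ← h4]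
      refine Eq.trans ?_ (hrep t₀ h2 h3)
      exact ((labelCode_eq_labelCode hcode (Nat.zero_le _) h3).1 ⟨h4.symm, h5.symm⟩).1
    · exact hrep t h1 ht
  have hsurj : Function.Surjective π := fun e =>
    ⟨walk T x (arcPos h'.full x' e e), by
      rw [← hall _ (arcPos_lt h'.full x' e e).le, walk_arcPos]⟩
  exact ⟨Equiv.ofBijective π (Finite.surjective_iff_bijective.1 hsurj), hall⟩

theorem IsScheme.involution_eq (h : IsScheme σ T x lab) (h' : IsScheme σ' T' x' lab')
    (hcode : labelCode (walk T x) lab = labelCode (walk T' x') lab')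
    (hmark : markedPositions σ (walk T x) = markedPositions σ' (walk T' x'))
    (hw : ∀ t ≤ k * k, walk T x t = walk T' x' t) : σ = σ' := by
  ext1 e
  by_cases he : σ e = e
  · have : arcPos h.full x e e ∈ markedPositions σ (walk T x) :=
      mem_markedPositions.2 ⟨arcPos_lt h.full x e e, by rw [walk_arcPos_succ, he]⟩
    rw [hmark] at this
    have h1 := (mem_markedPositions.1 this).2
    rw [← hw _ (arcPos_lt h.full x e e), walk_arcPos_succ] at h1
    rw [he, h1]
  · have h1 := h.next_letter_eq h' hcode hmark he e
    rwa [← hw _ (arcPos_lt h.full x e e), ← hw _ (arcPos_lt h.full x e (σ e)), walk_arcPos_succ,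
      walk_arcPos_succ] at h1

/-- If two conjugates of `σ` act jointly transitively at `{e, σ e}`, it suffices that the labels
join the letters exchanged by these conjugates. -/
theorem eqvGen_labelJoined_of_linkedAt (hT : IsFullCycle (stepPerm T)) {e : Fin k}
    (hl : LinkedAt σ T e)
    (h1 : ∀ c, Relation.EqvGen (LabelJoined hT σ x lab e) c (pulledBack σ T e c))
    (h2 : ∀ c, Relation.EqvGen (LabelJoined hT σ x lab e) c (pulledBack σ T (σ e) c)) (c c' : Fin k) :
    Relation.EqvGen (LabelJoined hT σ x lab e) c c' := by
  refine eqvGen_rec ⟨fun _ => .refl _, fun h => .symm _ _ h, fun h h' => .trans _ _ _ h h'⟩ ?_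
    (hl c c')
  rintro a b (rfl | rfl)
  · exact h1 a
  · exact h2 a

theorem apply_pulledBack (σ : Perm (Fin k)) (T : Fin k → Perm (Fin k)) (e c : Fin k) :
    T e (pulledBack σ T e c) = σ (T e c) := by
  simp [pulledBack]

theorem pulledBack_pulledBack (hσ : ∀ e, σ (σ e) = e) (e c : Fin k) :
    pulledBack σ T e (pulledBack σ T e c) = c := by
  apply (T e).injective
  rw [apply_pulledBack, apply_pulledBack, hσ]

/-- Both positions are followed by letters of the same pair. The hypothesis `h1` keeps them away
from the final position. -/
theorem lab_pulledBack_eq (hT : IsFullCycle (stepPerm T)) (hσ : ∀ e, σ (σ e) = e)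
    (hlab : ∀ t < k * k, σ (walk T x (t + 1)) ≠ walk T x (t + 1) →
      lab t = pairRep σ (walk T x (t + 1))) {e c : Fin k}
    (h1 : e ≠ x.1 ∨ (T e c ≠ x.2 ∧ σ (T e c) ≠ x.2)) :
    lab (arcPos hT x c e + 1) = lab (arcPos hT x (pulledBack σ T e c) e + 1) := by
  by_cases hf : σ (T e c) = T e c
  · have : pulledBack σ T e c = c := (T e).injective (by rw [apply_pulledBack, hf])
    rw [this]
  · have h2 : walk T x (arcPos hT x (pulledBack σ T e c) e + 1 + 1) = σ (T e c) := by
      rw [walk_arcPos_add_two hT x, apply_pulledBack]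
    have h3 : walk T x (arcPos hT x c e + 1 + 1) = T e c := walk_arcPos_add_two hT x c e
    rw [hlab _ (arcPos_succ_lt hT x (h1.imp_right And.left)), hlab _ (arcPos_succ_lt hT x
      (h1.imp_right fun h => by rw [apply_pulledBack]; exact h.2)), h2, h3, pairRep_eq_iff hσ]
    · exact Or.inr rfl
    · rw [h2]
      exact fun h => hf (σ.injective h)
    · rwa [h3]

theorem labelJoined_symm (hT : IsFullCycle (stepPerm T)) (hσ : ∀ e, σ (σ e) = e) (e : Fin k) :
    LabelJoined hT σ x lab (σ e) = LabelJoined hT σ x lab e := by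
  funext a b
  unfold LabelJoined
  rw [hσ]
  exact propext or_comm

theorem linkedAt_symm (hσ : ∀ e, σ (σ e) = e) {e : Fin k} (h : LinkedAt σ T e) :
    LinkedAt σ T (σ e) := by
  unfold LinkedAt
  rw [hσ]
  exact h.symm

end decoding

/-! ### Fibres of the coding and the number of pairings. -/

section counting

theorem card_le_mul_ncard_of_fiber_le {D C : Type*} [Finite D] (code : D → C) {S : Set C}
    (hS : S.Finite) (hmem : ∀ d, code d ∈ S) {B : ℕ}
    (hB : ∀ d₀, Nat.card {d // code d = code d₀} ≤ B) : Nat.card D ≤ B * S.ncard := by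
  classical
  have := Fintype.ofFinite D
  have h1 := Finset.card_le_mul_card_image (f := code) Finset.univ B (by
    intro b hb
    obtain ⟨d₀, -, rfl⟩ := Finset.mem_image.1 hb
    have := hB d₀
    rwa [Nat.card_eq_fintype_card, Fintype.card_subtype] at this)
  rw [Nat.card_eq_fintype_card, ← Finset.card_univ]
  refine h1.trans (Nat.mul_le_mul_left B ?_)
  rw [Set.ncard_eq_toFinset_card S hS]
  exact Finset.card_le_card fun c hc => by
    obtain ⟨d, -, rfl⟩ := Finset.mem_image.1 hc
    simpa using hmem d

theorem card_sigma_mul_le {I : Type*} {B : I → Type*} [Finite I] [∀ i, Finite (B i)] {c m : ℕ}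
    (h : ∀ i, c ≤ Nat.card (B i) * m) : Nat.card I * c ≤ Nat.card (Σ i, B i) * m := by
  have := Fintype.ofFinite I
  rw [Nat.card_sigma, Nat.card_eq_fintype_card, ← smul_eq_mul, ← Finset.card_univ, Finset.sum_mul]
  exact Finset.card_nsmul_le_sum _ _ _ fun i _ => h i

variable {k : ℕ}

theorem two_mul_card_filter_lt {P : Perm (Fin k)} (hP : ∀ e, P (P e) = e) (C : Finset (Fin k))
    (hC : ∀ c ∈ C, P c ∈ C) :
    2 * (C.filter fun e => e < P e).card + (C.filter fun e => P e = e).card = C.card := by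
  have h1 : (C.filter fun e => P e < e).card = (C.filter fun e => e < P e).card := by
    refine Finset.card_bij (fun e _ => P e) ?_ (fun _ _ _ _ h => P.injective h) ?_
    · intro e he
      rw [Finset.mem_filter] at he ⊢
      rw [hP]
      exact ⟨hC _ he.1, he.2⟩
    · intro e he
      rw [Finset.mem_filter] at he
      exact ⟨P e, Finset.mem_filter.2 ⟨hC _ he.1, by rw [hP]; exact he.2⟩, hP e⟩
  have h2 : (C.filter fun e => e < P e) ∪ ((C.filter fun e => P e < e) ∪
      C.filter fun e => P e = e) = C := by
    ext e
    simp only [Finset.mem_union, Finset.mem_filter]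
    rcases lt_trichotomy e (P e) with h | h | h
    · tauto
    · have := h.symm; tauto
    · tauto
  have h3 : Disjoint (C.filter fun e => P e < e) (C.filter fun e => P e = e) :=
    Finset.disjoint_filter.2 fun e _ h h' => by rw [h'] at h; exact lt_irrefl _ h
  have h4 : Disjoint (C.filter fun e => e < P e) ((C.filter fun e => P e < e) ∪
      C.filter fun e => P e = e) := by
    rw [← Finset.filter_or]
    refine Finset.disjoint_filter.2 fun e _ h h' => ?_
    rcases h' with h' | h'
    · exact lt_asymm h h'
    · rw [h'] at h; exact lt_irrefl _ h
  rw [← congrArg Finset.card h2, Finset.card_union_of_disjoint h4, Finset.card_union_of_disjoint h3,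
    h1]
  ring

/-- The letters that represent the pairs of `σ`. -/
def pairReps (σ : Perm (Fin k)) : Finset (Fin k) := Finset.univ.filter fun e => e < σ e

theorem mem_pairReps {σ : Perm (Fin k)} {e : Fin k} : e ∈ pairReps σ ↔ e < σ e := by
  simp [pairReps]

theorem pairRep_mem_pairReps {σ : Perm (Fin k)} (hσ : ∀ e, σ (σ e) = e) {e : Fin k}
    (he : σ e ≠ e) : pairRep σ e ∈ pairReps σ := by
  rw [mem_pairReps, pairRep]
  rcases lt_or_gt_of_ne he with h | h
  · rw [min_eq_right h.le, hσ]; exact h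
  · rw [min_eq_left h.le]; exact h

theorem pairRep_of_mem {σ : Perm (Fin k)} {e : Fin k} (he : e ∈ pairReps σ) :
    pairRep σ e = e := min_eq_left (mem_pairReps.1 he).le

theorem linkedAt_of_pairReps {σ : Perm (Fin k)} {T : Fin k → Perm (Fin k)}
    (hσ : ∀ e, σ (σ e) = e) (h : ∀ e ∈ pairReps σ, LinkedAt σ T e) {e : Fin k} (he : σ e ≠ e) :
    LinkedAt σ T e := by
  rcases lt_or_gt_of_ne he with h1 | h1
  · have := linkedAt_symm hσ (h (σ e) (mem_pairReps.2 (by rwa [hσ])))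
    rwa [hσ] at this
  · exact h e (mem_pairReps.2 h1)

/-- The permutations with cycle type `2 ^ h`. -/
abbrev Pairing (k h : ℕ) : Type := {σ : Perm (Fin k) // σ.cycleType = Multiset.replicate h 2}

theorem Pairing.invol {h : ℕ} (σ : Pairing k h) (e : Fin k) : σ.1 (σ.1 e) = e := by
  have h1 : σ.1 ^ 2 = 1 := by
    rw [← orderOf_dvd_iff_pow_eq_one, ← Perm.lcm_cycleType, σ.2]
    exact Multiset.lcm_dvd.2 fun b hb => (Multiset.eq_of_mem_replicate hb).dvd
  rw [sq] at h1
  exact Perm.congr_fun h1 e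

theorem Pairing.card_support {h : ℕ} (σ : Pairing k h) : σ.1.support.card = h * 2 := by
  rw [← Perm.sum_cycleType, σ.2]
  simp

theorem Pairing.card_pairReps {h : ℕ} (σ : Pairing k h) : (pairReps σ.1).card = h := by
  have h1 := two_mul_card_filter_lt σ.invol Finset.univ (by simp)
  have h2 := σ.card_support
  have h3 := Finset.card_filter_add_card_filter_not (s := (Finset.univ : Finset (Fin k)))
    (fun e => σ.1 e = e)
  have h4 : σ.1.support = Finset.univ.filter fun e => ¬ σ.1 e = e := by ext; simp
  rw [← h4] at h3
  unfold pairReps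
  omega

theorem card_pairing {h : ℕ} (hk : k = 2 * h ∨ k = 2 * h + 1) :
    Nat.card (Pairing k h) * (2 ^ h * h.factorial) = k.factorial := by
  have h1 := Perm.card_of_cycleType_mul_eq (Fin k) (Multiset.replicate h 2)
  rw [if_pos ⟨by simp; omega, fun a ha => (Multiset.eq_of_mem_replicate ha).ge⟩] at h1
  rw [Nat.card_eq_fintype_card, Fintype.card_subtype]
  rw [Fintype.card_fin] at h1
  rw [← h1]
  congr 1
  have h2 : (k - (Multiset.replicate h 2).sum).factorial = 1 := by
    rw [Nat.factorial_eq_one]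
    simp
    omega
  rw [h2, one_mul, Multiset.prod_replicate]
  congr 1
  rcases Nat.eq_zero_or_pos h with rfl | hpos
  · simp
  · have h3 : (Multiset.replicate h 2).toFinset = {2} := by
      ext a
      rw [Multiset.mem_toFinset, Multiset.mem_replicate, Finset.mem_singleton]
      omega
    rw [h3]
    simp

/-- Within a fibre, the renaming from `d₀` determines the walk, which determines the involution, the
transitions and the first arc. -/
theorem card_scheme_fiber_le {D : Type*} [Finite D] (σ : D → Perm (Fin k))
    (T : D → Fin k → Perm (Fin k)) (x : D → Fin k × Fin k) (lab : D → ℕ → Fin k)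
    (hs : ∀ d, IsScheme (σ d) (T d) (x d) (lab d))
    (hdet : ∀ d d', labelCode (walk (T d) (x d)) (lab d) = labelCode (walk (T d') (x d')) (lab d') →
      σ d = σ d' → T d = T d' → x d = x d' → d = d') (d₀ : D) :
    Nat.card {d // labelCode (walk (T d) (x d)) (lab d) =
        labelCode (walk (T d₀) (x d₀)) (lab d₀) ∧
      markedPositions (σ d) (walk (T d) (x d)) =
        markedPositions (σ d₀) (walk (T d₀) (x d₀))} ≤ k.factorial := by
  set F := {d // labelCode (walk (T d) (x d)) (lab d) =
        labelCode (walk (T d₀) (x d₀)) (lab d₀) ∧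
      markedPositions (σ d) (walk (T d) (x d)) =
        markedPositions (σ d₀) (walk (T d₀) (x d₀))} with hF
  have hπ : ∀ d : F, ∃ π : Perm (Fin k), ∀ t ≤ k * k,
      walk (T d.1) (x d.1) t = π (walk (T d₀) (x d₀) t) := fun d =>
    (hs d₀).exists_renaming (hs d.1) d.2.1.symm d.2.2.symm
  choose π hπ using hπ
  have hinj : Function.Injective π := by
    intro d d' h
    have hw : ∀ t ≤ k * k, walk (T d.1) (x d.1) t = walk (T d'.1) (x d'.1) t := by
      intro t ht
      rw [hπ d t ht, hπ d' t ht, h]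
    have hc := d.2.1.trans d'.2.1.symm
    have hTx := transitions_eq_of_walk_eq (hs d.1).full (hs d'.1).full hw
    exact Subtype.ext (hdet _ _ hc ((hs d.1).involution_eq (hs d'.1) hc
      (d.2.2.trans d'.2.2.symm) hw) hTx.1 hTx.2)
  have := Nat.card_le_card_of_injective π hinj
  rwa [Nat.card_eq_fintype_card (α := Perm (Fin k)), Fintype.card_perm, Fintype.card_fin] at this

theorem exists_lt_of_ne {P : ℕ → Prop} {n t t' : ℕ} (hne : t ≠ t') (ht : t ≤ n) (ht' : t' ≤ n)
    (h : P t) (h' : P t') : ∃ t t', t < t' ∧ t' ≤ n ∧ P t ∧ P t' := by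
  rcases lt_or_gt_of_ne hne with h1 | h1
  · exact ⟨t, t', h1, ht', h, h'⟩
  · exact ⟨t', t, h1, ht, h', h⟩

end counting

/-! ### An even number of letters. -/

section even

variable {k : ℕ}

/-- The labelling by the pair of the next letter, with the label `g` at the end. -/
def evenLabel (σ : Perm (Fin k)) (T : Fin k → Perm (Fin k)) (x : Fin k × Fin k) (g : Fin k)
    (t : ℕ) : Fin k := if t < k * k then pairRep σ (walk T x (t + 1)) else g

/-- In the union of two perfect matchings `P` and `Q`, the ends of an edge of `P` remain connected
when this edge is deleted. -/
theorem rel_of_matchings {P Q : Perm (Fin k)} (hP : ∀ e, P (P e) = e) (hP' : ∀ e, P e ≠ e)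
    (hQ : ∀ e, Q (Q e) = e) (hQ' : ∀ e, Q e ≠ e) {r : Fin k → Fin k → Prop} (hr : Equivalence r)
    {a : Fin k} (hrP : ∀ c, c ≠ a → c ≠ P a → r c (P c)) (hrQ : ∀ c, r c (Q c)) : r a (P a) := by
  classical
  -- If `a` and `P a` were separated, the class of `a` would be closed under `Q`, hence of even
  -- size, and without `a` it would be closed under `P`, hence again of even size.
  by_contra hcon
  set C := Finset.univ.filter fun c => r a c with hC
  have h1 := two_mul_card_filter_lt hQ C (by
    intro c hc
    rw [hC, Finset.mem_filter] at hc ⊢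
    exact ⟨Finset.mem_univ _, hr.trans hc.2 (hrQ c)⟩)
  have h2 := two_mul_card_filter_lt hP (C.erase a) (by
    intro c hc
    rw [Finset.mem_erase, hC, Finset.mem_filter] at hc ⊢
    have hca : c ≠ P a := by
      rintro rfl
      exact hcon hc.2.2
    refine ⟨fun h => hca (by rw [← h, hP]), Finset.mem_univ _, hr.trans hc.2.2 (hrP c hc.1 hca)⟩)
  rw [Finset.filter_false_of_mem fun c _ => hQ' c] at h1
  rw [Finset.filter_false_of_mem fun c _ => hP' c,
    Finset.card_erase_of_mem (by simp [hC, hr.refl a])] at h2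
  have h3 : 0 < C.card := Finset.card_pos.2 ⟨a, by simp [hC, hr.refl a]⟩
  rw [Finset.card_empty] at h1 h2
  omega

variable {σ : Perm (Fin k)} {T : Fin k → Perm (Fin k)}

theorem isScheme_evenLabel (hT : IsFullCycle (stepPerm T)) (hσ : ∀ e, σ (σ e) = e)
    (hσ' : ∀ e, σ e ≠ e) (hl : ∀ e ∈ pairReps σ, LinkedAt σ T e) (x : Fin k × Fin k) (g : Fin k) :
    IsScheme σ T x (evenLabel σ T x g) := by
  have hlab : ∀ t < k * k, σ (walk T x (t + 1)) ≠ walk T x (t + 1) →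
      evenLabel σ T x g t = pairRep σ (walk T x (t + 1)) := fun t ht _ => if_pos ht
  have hfix : ∀ e c, pulledBack σ T e c ≠ c := by
    intro e c h
    have := apply_pulledBack σ T e c
    rw [h] at this
    exact hσ' _ this.symm
  -- The final position carries `g` instead of the pair of `x.2`, so one edge of the matching at
  -- `x.1` may be missing. Two perfect matchings survive this by `rel_of_matchings`.
  have hs : ∀ c c', Relation.EqvGen (LabelJoined hT σ x (evenLabel σ T x g) x.1) c c' := by
    have hQ : ∀ c, Relation.EqvGen (LabelJoined hT σ x (evenLabel σ T x g) x.1) c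
        (pulledBack σ T (σ x.1) c) := fun c =>
      .rel _ _ (Or.inr (lab_pulledBack_eq hT hσ hlab (Or.inl (hσ' x.1))))
    have hinv : ∀ c, c = pulledBack σ T x.1 ((T x.1)⁻¹ x.2) ↔ σ (T x.1 c) = x.2 := by
      intro c
      rw [← apply_pulledBack, ← Perm.eq_inv_iff_eq]
      constructor
      · rintro rfl
        rw [pulledBack_pulledBack hσ]
      · intro h
        rw [← h, pulledBack_pulledBack hσ]
    have hP : ∀ c, c ≠ (T x.1)⁻¹ x.2 → c ≠ pulledBack σ T x.1 ((T x.1)⁻¹ x.2) →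
        Relation.EqvGen (LabelJoined hT σ x (evenLabel σ T x g) x.1) c
          (pulledBack σ T x.1 c) := by
      intro c h1 h2
      rw [Ne, Perm.eq_inv_iff_eq] at h1
      rw [Ne, hinv] at h2
      exact .rel _ _ (Or.inl (lab_pulledBack_eq hT hσ hlab (Or.inr ⟨h1, h2⟩)))
    have ha := rel_of_matchings (pulledBack_pulledBack hσ x.1) (hfix x.1)
      (pulledBack_pulledBack hσ (σ x.1)) (hfix (σ x.1))
      ⟨fun _ => .refl _, fun h => .symm _ _ h, fun h h' => .trans _ _ _ h h'⟩ hP hQ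
    refine eqvGen_labelJoined_of_linkedAt hT (linkedAt_of_pairReps hσ hl (hσ' _)) ?_ hQ
    intro c
    by_cases h1 : c = (T x.1)⁻¹ x.2
    · rw [h1]; exact ha
    · by_cases h2 : c = pulledBack σ T x.1 ((T x.1)⁻¹ x.2)
      · rw [h2, pulledBack_pulledBack hσ]; exact .symm _ _ ha
      · exact hP c h1 h2
  refine ⟨hT, hσ, fun a b ha => absurd ha (hσ' a), hlab, fun e he c c' => ?_, ?_⟩
  · by_cases h1 : e = x.1
    · rw [h1]; exact hs c c'
    · by_cases h2 : σ e = x.1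
      · have := hs c c'
        rw [← h2, labelJoined_symm hT hσ] at this
        exact this
      · refine eqvGen_labelJoined_of_linkedAt hT (linkedAt_of_pairReps hσ hl (hσ' _)) ?_ ?_ c c'
        · exact fun c => .rel _ _ (Or.inl (lab_pulledBack_eq hT hσ hlab (Or.inl h1)))
        · exact fun c => .rel _ _ (Or.inr (lab_pulledBack_eq hT hσ hlab (Or.inl h2)))
  · have h0 := arcPos_self hT x
    have hlt := arcPos_lt hT x x.1 x.2
    refine ⟨arcPos hT x x.1 (σ x.2), ?_, (arcPos_lt hT x _ _).le, walk_arcPos hT x _ _, ?_⟩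
    · by_contra hcon
      have : arcPos hT x x.1 (σ x.2) = arcPos hT x x.1 x.2 := by omega
      exact hσ' _ (arcPos_inj hT x this).2
    · rw [evenLabel, evenLabel, if_pos (arcPos_lt hT x _ _), if_pos (by omega), walk_arcPos_succ,
        zero_add, walk_one, pairRep_eq_iff hσ, hσ]
      exact Or.inr rfl

theorem evenLabel_mem_PiDB {m : ℕ} (hk : k = 2 * m) (hcard : (pairReps σ).card = m)
    (hT : IsFullCycle (stepPerm T)) (hσ : ∀ e, σ (σ e) = e)
    (hσ' : ∀ e, σ e ≠ e) (x : Fin k × Fin k) {g : Fin k} (hg : g ∈ pairReps σ) :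
    labelCode (walk T x) (evenLabel σ T x g) ∈ PiDB k := by
  refine labelCode_mem_PiDB (wordOf_walk_mem hT x) (fun _ => pairReps σ) ?_ ?_ ?_
  · intro j
    rw [count_wordOf_walk hT, hcard]
    split_ifs <;> omega
  · intro t _
    rw [evenLabel]
    split_ifs
    · exact pairRep_mem_pairReps hσ (hσ' _)
    · exact hg
  · intro j l hl
    have h1 := arcPos_lt hT x j l
    have h2 := arcPos_lt hT x j (σ l)
    obtain ⟨t, t', h3, h4, h5, h6⟩ := exists_lt_of_ne
      (P := fun t => walk T x t = j ∧ evenLabel σ T x g t = l)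
      (fun h => hσ' l (arcPos_inj hT x h).2.symm) h1.le h2.le
      ⟨walk_arcPos hT x j l, by rw [evenLabel, if_pos h1, walk_arcPos_succ, pairRep_of_mem hl]⟩
      ⟨walk_arcPos hT x j (σ l), by
        rw [evenLabel, if_pos h2, walk_arcPos_succ]
        nth_rw 2 [← pairRep_of_mem hl]
        rw [pairRep_eq_iff hσ, hσ]
        exact Or.inr rfl⟩
    exact ⟨t, t', h3, h4, h5.1, h6.1, h5.2, h6.2⟩

/-- The data of a labelled walk for an even number of letters. -/
abbrev EvenData (k m : ℕ) : Type := Σ σ : Pairing k m,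
  {T : Fin k → Perm (Fin k) // IsFullCycle (stepPerm T) ∧ ∀ e ∈ pairReps σ.1, LinkedAt σ.1 T e} ×
    (Fin k × Fin k) × {g // g ∈ pairReps σ.1}

theorem Pairing.apply_ne {m : ℕ} (hk : k = 2 * m) (σ : Pairing k m) (e : Fin k) :
    σ.1 e ≠ e := by
  have h1 : σ.1.support = Finset.univ := by
    rw [← Finset.card_eq_iff_eq_univ, σ.card_support, Fintype.card_fin, hk, mul_comm]
  exact Perm.mem_support.1 (h1 ▸ Finset.mem_univ e)

theorem card_evenData_le {m : ℕ} (hk : k = 2 * m) (hk1 : 1 ≤ k) :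
    Nat.card (EvenData k m) ≤ k.factorial * (PiDB k).ncard := by
  refine card_le_mul_ncard_of_fiber_le (fun d : EvenData k m =>
    labelCode (walk d.2.1.1 d.2.2.1) (evenLabel d.1.1 d.2.1.1 d.2.2.1 d.2.2.2.1)) (finite_PiDB hk1)
    (fun d => evenLabel_mem_PiDB hk d.1.card_pairReps d.2.1.2.1 d.1.invol (d.1.apply_ne hk) _
      d.2.2.2.2) fun d₀ => ?_
  have hmark : ∀ d : EvenData k m, markedPositions d.1.1 (walk d.2.1.1 d.2.2.1) = ∅ := fun d =>
    Finset.filter_false_of_mem fun t _ => d.1.apply_ne hk _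
  have h := card_scheme_fiber_le (fun d : EvenData k m => d.1.1) (fun d => d.2.1.1)
    (fun d => d.2.2.1) (fun d => evenLabel d.1.1 d.2.1.1 d.2.2.1 d.2.2.2.1)
    (fun d => isScheme_evenLabel d.2.1.2.1 d.1.invol (d.1.apply_ne hk) d.2.1.2.2 _ _) ?_ d₀
  · simp only [hmark, and_true] at h
    exact h
  · rintro ⟨⟨σ, hσ⟩, ⟨T, hT, hl⟩, x, ⟨g, hg⟩⟩ ⟨⟨σ', hσ'⟩, ⟨T', hT', hl'⟩, x', ⟨g', hg'⟩⟩ hcode h1 h2 h3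
    dsimp only at hcode h1 h2 h3
    subst h1 h2 h3
    have hlt := arcPos_lt hT x x.1 g
    -- The final position shares its variable with the exit from `x.1` to `g`, which reveals `g`.
    have h4 := (labelCode_eq_labelCode hcode hlt.le le_rfl).1
      ⟨by rw [walk_arcPos, walk_sq hT], by
        rw [evenLabel, evenLabel, if_pos hlt, if_neg (lt_irrefl _), walk_arcPos_succ,
          pairRep_of_mem hg]⟩
    have h5 := h4.2
    rw [evenLabel, evenLabel, if_pos hlt, if_neg (lt_irrefl _), walk_arcPos_succ,
      pairRep_of_mem hg] at h5
    subst h5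
    rfl

theorem mul_le_card_evenData {m a : ℕ} (hk1 : 1 ≤ k)
    (ha : ∀ σ : Pairing k m, ∀ τ υ : Perm (Fin k),
      a ≤ linkCount (τ⁻¹ * σ.1 * τ) (υ⁻¹ * σ.1 * υ)) :
    Nat.card (Pairing k m) * (m * a ^ m * k.factorial ^ k) ≤
      Nat.card (EvenData k m) * (k - 1).factorial ^ m := by
  refine card_sigma_mul_le fun σ => ?_
  rw [Nat.card_prod, Nat.card_prod, Nat.card_prod, Nat.card_eq_fintype_card (α := Fin k),
    Fintype.card_fin, Nat.card_eq_fintype_card (α := {g // g ∈ pairReps σ.1}), Fintype.card_coe,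
    σ.card_pairReps]
  have h1 := pow_mul_card_le_card_linkedAt (ha σ) (pairReps σ.1) (by
    intro e he h
    rw [mem_pairReps] at he h
    rw [σ.invol] at h
    exact lt_asymm he h)
  rw [σ.card_pairReps, Fintype.card_fin] at h1
  have h2 := factorial_pow_le_card_eulerian hk1
  calc m * a ^ m * k.factorial ^ k ≤ m * a ^ m *
        (Nat.card {T : Fin k → Perm (Fin k) // IsFullCycle (stepPerm T)} * k ^ 2) :=
        Nat.mul_le_mul_left _ h2
    _ = m * k ^ 2 * (a ^ m *
        Nat.card {T : Fin k → Perm (Fin k) // IsFullCycle (stepPerm T)}) := by ring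
    _ ≤ m * k ^ 2 * _ := Nat.mul_le_mul_left _ h1
    _ = _ := by ring

end even

/-! ### Inequalities for factorials, and the even case. -/

open scoped Nat

/-- Reversing one of the two factorials pairs `i + 1` with `n - i`, and each such product is at
least `n`. -/
theorem pow_self_le_factorial_sq (n : ℕ) : n ^ n ≤ n ! ^ 2 := by
  have h1 := Finset.prod_range_add_one_eq_factorial n
  have h2 := Finset.prod_range_reflect (fun x => x + 1) n
  have h3 : n ! ^ 2 = ∏ i ∈ Finset.range n, (i + 1) * (n - 1 - i + 1) := by
    rw [Finset.prod_mul_distrib, h2, h1, sq]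
  rw [h3]
  calc n ^ n = ∏ _x ∈ Finset.range n, n := by simp
    _ ≤ _ := Finset.prod_le_prod' fun i hi => by
      have := Finset.mem_range.1 hi
      obtain ⟨r, hr⟩ : ∃ r, n = i + 1 + r := ⟨n - 1 - i, by omega⟩
      rw [show n - 1 - i + 1 = r + 1 by omega, hr]
      nlinarith [Nat.zero_le (i * r)]

/-- A Wallis type estimate; the quotient of the squares is asymptotically `π * j`. -/
theorem doubleFactorial_even_sq_le (j : ℕ) (hj : 1 ≤ j) :
    (2 * j)‼ ^ 2 ≤ 4 * j * (2 * j - 1)‼ ^ 2 := by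
  induction j, hj using Nat.le_induction with
  | base => decide
  | succ j hj ih =>
    have h1 : (2 * (j + 1))‼ = (2 * j + 2) * (2 * j)‼ := Nat.doubleFactorial_add_two _
    have h2 : (2 * (j + 1) - 1)‼ = (2 * j + 1) * (2 * j - 1)‼ := by
      obtain ⟨i, rfl⟩ := Nat.exists_eq_add_of_le' hj
      exact Nat.doubleFactorial_add_two _
    rw [h1, h2, mul_pow, mul_pow]
    calc (2 * j + 2) ^ 2 * (2 * j)‼ ^ 2 ≤ (2 * j + 2) ^ 2 * (4 * j * (2 * j - 1)‼ ^ 2) :=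
          Nat.mul_le_mul_left _ ih
      _ = ((2 * j + 2) ^ 2 * (4 * j)) * (2 * j - 1)‼ ^ 2 := by ring
      _ ≤ (4 * (j + 1) * (2 * j + 1) ^ 2) * (2 * j - 1)‼ ^ 2 :=
          Nat.mul_le_mul_right _ (by nlinarith)
      _ = _ := by ring

theorem four_mul_pow_le (j : ℕ) :
    (4 * j) ^ (j + 1) ≤ (j + 1) ^ 2 * (2 * j + 1)‼ ^ 2 := by
  rcases Nat.lt_or_ge j 3 with h | h
  · interval_cases j <;> decide
  · have h1 := doubleFactorial_even_sq_le (j + 1) (by omega)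
    rw [Nat.doubleFactorial_two_mul, show 2 * (j + 1) - 1 = 2 * j + 1 by omega] at h1
    have h2 := pow_self_le_factorial_sq (j + 1)
    have h3 : j ^ (j + 1) ≤ (j + 1) ^ (j + 1) := Nat.pow_le_pow_left (by omega) _
    refine le_of_mul_le_mul_left ?_ (show 0 < 4 by norm_num)
    calc 4 * (4 * j) ^ (j + 1) = 4 * (4 ^ (j + 1) * j ^ (j + 1)) := by rw [mul_pow]
      _ ≤ (j + 1) * (4 ^ (j + 1) * (j + 1) ! ^ 2) :=
        Nat.mul_le_mul (by omega) (Nat.mul_le_mul_left _ (h3.trans h2))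
      _ = (j + 1) * (2 ^ (j + 1) * (j + 1) !) ^ 2 := by
        rw [mul_pow, ← pow_mul, mul_comm (j + 1) 2, pow_mul]; norm_num
      _ ≤ (j + 1) * (4 * (j + 1) * (2 * j + 1)‼ ^ 2) := Nat.mul_le_mul_left _ h1
      _ = _ := by ring

theorem even_count_bound (j : ℕ) :
    (2 * j + 1)! ^ (j + 1) * (2 ^ (j + 1) * (j + 1)!) ≤
      (j + 1) * ((2 * j + 1) * (2 * j - 1)‼ ^ 2) ^ (j + 1) * (2 * j + 2)! := by
  have key : (2 * j)‼ ^ (j + 1) ≤ (j + 1) * (2 * j - 1)‼ ^ (j + 1) * (2 * j + 1)‼ := by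
    rcases Nat.eq_zero_or_pos j with rfl | hj
    · decide
    rw [← Nat.pow_le_pow_iff_left (n := 2) two_ne_zero]
    calc ((2 * j)‼ ^ (j + 1)) ^ 2 = ((2 * j)‼ ^ 2) ^ (j + 1) :=
        pow_right_comm _ _ _
      _ ≤ (4 * j * (2 * j - 1)‼ ^ 2) ^ (j + 1) :=
        Nat.pow_le_pow_left (doubleFactorial_even_sq_le j hj) _
      _ = (4 * j) ^ (j + 1) * ((2 * j - 1)‼ ^ (j + 1)) ^ 2 := by
        rw [mul_pow, pow_right_comm]
      _ ≤ ((j + 1) ^ 2 * (2 * j + 1)‼ ^ 2) * ((2 * j - 1)‼ ^ (j + 1)) ^ 2 :=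
        Nat.mul_le_mul_right _ (four_mul_pow_le j)
      _ = _ := by ring
  have h1 : (2 * j + 1)! = (2 * j + 1) * ((2 * j)‼ * (2 * j - 1)‼) := by
    rw [Nat.factorial_succ]
    congr 1
    rcases j with _ | j
    · rfl
    · exact Nat.factorial_eq_mul_doubleFactorial (2 * j + 1)
  have h2 : (2 * j + 2)! = (2 ^ (j + 1) * (j + 1)!) * (2 * j + 1)‼ := by
    rw [← Nat.doubleFactorial_two_mul]
    exact Nat.factorial_eq_mul_doubleFactorial (2 * j + 1)
  rw [h2, h1, mul_pow, mul_pow, mul_pow]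
  calc _ = (2 * j)‼ ^ (j + 1) * ((2 * j + 1) ^ (j + 1) * (2 * j - 1)‼ ^ (j + 1) *
        (2 ^ (j + 1) * (j + 1)!)) := by ring
    _ ≤ ((j + 1) * (2 * j - 1)‼ ^ (j + 1) * (2 * j + 1)‼) * ((2 * j + 1) ^ (j + 1) *
        (2 * j - 1)‼ ^ (j + 1) * (2 ^ (j + 1) * (j + 1)!)) := Nat.mul_le_mul_right _ key
    _ = _ := by ring

/-- Here `3 ^ (2 * h)` is absorbed by `h ^ (2 * h)`, and the remaining inequality `h3` also starts
at `h = 3`, with `96 ≤ 105`. -/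
theorem odd_count_bound {h : ℕ} (hh : 3 ≤ h) :
    2 * 3 ^ (2 * h) * ((2 * h)! ^ h * (2 ^ h * h !)) ≤
      h ^ (2 * h) * ((2 * h - 1)‼ ^ 2) ^ h * (2 * h + 1)! := by
  have h3 : 2 * (2 ^ h * h !) ≤ (2 * h + 1)‼ := by
    rw [← Nat.doubleFactorial_two_mul]
    induction h, hh using Nat.le_induction with
    | base => decide
    | succ h _ ih =>
      have h1 : (2 * (h + 1))‼ = (2 * h + 2) * (2 * h)‼ := Nat.doubleFactorial_add_two _
      have h2 : (2 * (h + 1) + 1)‼ = (2 * h + 3) * (2 * h + 1)‼ := Nat.doubleFactorial_add_two _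
      rw [h1, h2]
      nlinarith
  have key : 2 * 3 ^ (2 * h) * (2 * h)‼ ^ h ≤ h ^ (2 * h) * (2 * h - 1)‼ ^ h * (2 * h + 1)‼ := by
    rw [← Nat.pow_le_pow_iff_left (n := 2) two_ne_zero]
    calc (2 * 3 ^ (2 * h) * (2 * h)‼ ^ h) ^ 2
        = 4 * (3 ^ (2 * h)) ^ 2 * ((2 * h)‼ ^ 2) ^ h := by ring
      _ ≤ 4 * (h ^ (2 * h)) ^ 2 * (4 * h * (2 * h - 1)‼ ^ 2) ^ h := by
        gcongr
        exact doubleFactorial_even_sq_le h (by omega)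
      _ = 4 * (h ^ (2 * h)) ^ 2 * (4 ^ h * h ^ h) * ((2 * h - 1)‼ ^ h) ^ 2 := by
        rw [mul_pow, mul_pow]; ring
      _ ≤ 4 * (h ^ (2 * h)) ^ 2 * (4 ^ h * h ! ^ 2) * ((2 * h - 1)‼ ^ h) ^ 2 := by
        have := pow_self_le_factorial_sq h
        exact Nat.mul_le_mul_right _ (Nat.mul_le_mul_left _ (Nat.mul_le_mul_left _ this))
      _ = (h ^ (2 * h)) ^ 2 * (2 * (2 ^ h * h !)) ^ 2 * ((2 * h - 1)‼ ^ h) ^ 2 := by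
        rw [show 4 ^ h = (2 ^ h) ^ 2 by rw [pow_right_comm]; norm_num]; ring
      _ ≤ (h ^ (2 * h)) ^ 2 * (2 * h + 1)‼ ^ 2 * ((2 * h - 1)‼ ^ h) ^ 2 := by
        gcongr
      _ = _ := by ring
  have h1 : (2 * h)! = (2 * h)‼ * (2 * h - 1)‼ := by
    obtain ⟨i, rfl⟩ := Nat.exists_eq_add_of_le' (show 1 ≤ h by omega)
    exact Nat.factorial_eq_mul_doubleFactorial (2 * i + 1)
  have h2 : (2 * h + 1)! = (2 * h + 1)‼ * (2 ^ h * h !) := by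
    rw [← Nat.doubleFactorial_two_mul]
    exact Nat.factorial_eq_mul_doubleFactorial (2 * h)
  rw [h2, h1]
  calc _ = (2 * 3 ^ (2 * h) * (2 * h)‼ ^ h) * ((2 * h - 1)‼ ^ h * (2 ^ h * h !)) := by ring
    _ ≤ (h ^ (2 * h) * (2 * h - 1)‼ ^ h * (2 * h + 1)‼) *
        ((2 * h - 1)‼ ^ h * (2 ^ h * h !)) := Nat.mul_le_mul_right _ key
    _ = _ := by ring

theorem conj_inv_eq {A : Type*} {σ : Perm A} (hσ : ∀ e, σ (σ e) = e) (τ : Perm A) :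
    (τ⁻¹ * σ * τ)⁻¹ = τ⁻¹ * σ * τ := by
  have : σ⁻¹ = σ := by
    rw [inv_eq_iff_mul_eq_one]
    exact Equiv.ext hσ
  rw [mul_inv_rev, mul_inv_rev, inv_inv, this, mul_assoc]

theorem conj_apply_eq_self_iff {A : Type*} (σ τ : Perm A) (x : A) :
    (τ⁻¹ * σ * τ) x = x ↔ σ (τ x) = τ x := by
  rw [Perm.mul_apply, Perm.mul_apply, Perm.inv_eq_iff_eq]

/-- Bookkeeping for both parities: `P` pairings, `D` data, at most `k ! * M` data per pattern, `N`
patterns; `A / B` collects the choices of labels and starting arcs and the share of linked systems.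
-/
theorem factorial_pow_le_of_counts {k P A B D E M N : ℕ} (hk : 1 ≤ k) (hA : 0 < A)
    (h1 : P * E = k !) (h2 : P * (A * k ! ^ k) ≤ D * B) (h3 : D ≤ k ! * M * N)
    (h4 : B * M * E ≤ A * k !) : k ! ^ (k - 1) ≤ N := by
  have hpos : 0 < k ! * (k ! * A) := by positivity
  refine le_of_mul_le_mul_left ?_ hpos
  have h5 : k ! ^ k = k ! * k ! ^ (k - 1) := by
    rw [← pow_succ', Nat.sub_add_cancel hk]
  calc k ! * (k ! * A) * k ! ^ (k - 1) = k ! * (A * k ! ^ k) := by rw [h5]; ring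
    _ = (P * (A * k ! ^ k)) * E := by rw [← h1]; ring
    _ ≤ (D * B) * E := Nat.mul_le_mul_right _ h2
    _ ≤ (k ! * M * N * B) * E := Nat.mul_le_mul_right _ (Nat.mul_le_mul_right _ h3)
    _ = k ! * N * (B * M * E) := by ring
    _ ≤ k ! * N * (A * k !) := Nat.mul_le_mul_left _ h4
    _ = _ := by ring

theorem factorial_pow_le_ncard_PiDB_of_even {k : ℕ} (hk : 1 ≤ k) (he : Even k) :
    k ! ^ (k - 1) ≤ (PiDB k).ncard := by
  obtain ⟨j, rfl⟩ : ∃ j, k = 2 * (j + 1) := by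
    obtain ⟨m, rfl⟩ := he
    exact ⟨m - 1, by omega⟩
  have ha : ∀ σ : Pairing (2 * (j + 1)) (j + 1), ∀ τ υ : Perm (Fin (2 * (j + 1))),
      (2 * j + 1) * (2 * j - 1)‼ ^ 2 ≤ linkCount (τ⁻¹ * σ.1 * τ) (υ⁻¹ * σ.1 * υ) := by
    intro σ τ υ
    refine mul_sq_doubleFactorial_le_linkCount j (by simp; ring) (conj_inv_eq σ.invol τ)
      (conj_inv_eq σ.invol υ) ?_ ?_
    · intro x
      rw [Ne, conj_apply_eq_self_iff]
      exact σ.apply_ne rfl _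
    · intro x
      rw [Ne, conj_apply_eq_self_iff]
      exact σ.apply_ne rfl _
  refine factorial_pow_le_of_counts (M := 1) hk ?_ (card_pairing (Or.inl rfl))
    (mul_le_card_evenData hk ha) ((card_evenData_le rfl hk).trans (by rw [mul_one])) ?_
  · have := Nat.doubleFactorial_pos (2 * j - 1)
    positivity
  · rw [mul_one]
    exact even_count_bound j

/-! ### An odd number of letters: the labelling. -/

section odd

variable {k : ℕ}

theorem Pairing.exists_center {h : ℕ} (hk : k = 2 * h + 1) (σ : Pairing k h) :
    ∃ o, ∀ e, σ.1 e = e ↔ e = o := by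
  have h1 : (Finset.univ.filter fun e => σ.1 e = e).card = 1 := by
    have h2 := two_mul_card_filter_lt σ.invol Finset.univ (by simp)
    have h3 := σ.card_pairReps
    unfold pairReps at h3
    rw [Finset.card_univ, Fintype.card_fin] at h2
    omega
  obtain ⟨o, ho⟩ := Finset.card_eq_one.1 h1
  exact ⟨o, fun e => by simpa using Finset.ext_iff.1 ho e⟩

/-- Each letter other than `s` chooses a pair to which its exit to the letter fixed by `σ` is
added, and `s` chooses this letter itself. -/
def IsExitChoice (σ : Perm (Fin k)) (s : Fin k) (g : Fin k → Fin k) : Prop :=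
  σ (g s) = g s ∧ ∀ c, c ≠ s → g c ∈ pairReps σ

/-- The labelling by the pair of the next letter, where `g` is used if the next letter is fixed by
`σ` and at the end. -/
def oddLabel (σ : Perm (Fin k)) (T : Fin k → Perm (Fin k)) (x : Fin k × Fin k)
    (g : Fin k → Fin k) (t : ℕ) : Fin k :=
  if t < k * k ∧ σ (walk T x (t + 1)) ≠ walk T x (t + 1) then pairRep σ (walk T x (t + 1))
  else g (walk T x t)

variable {σ : Perm (Fin k)} {T : Fin k → Perm (Fin k)} {x : Fin k × Fin k} {g : Fin k → Fin k}

theorem oddLabel_of_ne {t : ℕ} (ht : t < k * k)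
    (h : σ (walk T x (t + 1)) ≠ walk T x (t + 1)) :
    oddLabel σ T x g t = pairRep σ (walk T x (t + 1)) := if_pos ⟨ht, h⟩

theorem oddLabel_of_eq {t : ℕ} (h : σ (walk T x (t + 1)) = walk T x (t + 1)) :
    oddLabel σ T x g t = g (walk T x t) := if_neg fun h' => h'.2 h

theorem oddLabel_last (hT : IsFullCycle (stepPerm T)) :
    oddLabel σ T x g (k * k) = g x.1 := by
  rw [oddLabel, if_neg fun h' => lt_irrefl _ h'.1, walk_sq hT]

theorem oddLabel_arcPos_of_ne (hT : IsFullCycle (stepPerm T)) {c e : Fin k} (he : σ e ≠ e) :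
    oddLabel σ T x g (arcPos hT x c e) = pairRep σ e := by
  rw [oddLabel_of_ne (arcPos_lt hT x c e) (by rwa [walk_arcPos_succ]), walk_arcPos_succ]

theorem oddLabel_arcPos_of_eq (hT : IsFullCycle (stepPerm T)) {c e : Fin k} (he : σ e = e) :
    oddLabel σ T x g (arcPos hT x c e) = g c := by
  rw [oddLabel_of_eq (by rwa [walk_arcPos_succ]), walk_arcPos]

/-- The equivalence generated by the conjugates of `σ` at `s` and `σ s`, where the edge at `a` of
the former is left out. -/
def BrokenRel (σ : Perm (Fin k)) (T : Fin k → Perm (Fin k)) (s a : Fin k) :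
    Fin k → Fin k → Prop :=
  Relation.EqvGen fun c c' => pulledBack σ T (σ s) c = c' ∨
    (pulledBack σ T s c = c' ∧ c ≠ a ∧ c ≠ pulledBack σ T s a)

theorem brokenRel_pulledBack (hσ : ∀ e, σ (σ e) = e) (s a : Fin k) :
    BrokenRel σ T s (pulledBack σ T s a) = BrokenRel σ T s a := by
  unfold BrokenRel
  congr 1
  funext c c'
  rw [pulledBack_pulledBack hσ]
  apply propext
  tauto

/-- Deleting one edge of a connected graph leaves every vertex joined to one of the ends of that
edge. -/
theorem brokenRel_or (hσ : ∀ e, σ (σ e) = e) {s : Fin k} (hl : LinkedAt σ T s) (a c : Fin k) :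
    BrokenRel σ T s a c a ∨ BrokenRel σ T s a c (pulledBack σ T s a) := by
  set b := pulledBack σ T s a with hb
  set r := BrokenRel σ T s a with hr
  have hre : Equivalence r :=
    ⟨fun _ => .refl _, fun h => .symm _ _ h, fun h h' => .trans _ _ _ h h'⟩
  have key := eqvGen_rec (s := fun c c' => r c c' ∨ ((r c a ∨ r c b) ∧ (r c' a ∨ r c' b))) ?_ ?_
    (hl c a)
  · rcases key with h | h
    · exact Or.inl h
    · exact h.1
  · refine ⟨fun c => Or.inl (hre.refl c), ?_, ?_⟩
    · rintro c c' (h | h)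
      · exact Or.inl (hre.symm h)
      · exact Or.inr h.symm
    · rintro c c' c'' (h | ⟨h1, h2⟩) (h' | ⟨h1', h2'⟩)
      · exact Or.inl (hre.trans h h')
      · exact Or.inr ⟨h1'.imp (hre.trans h) (hre.trans h), h2'⟩
      · exact Or.inr ⟨h1, h2.imp (hre.trans (hre.symm h')) (hre.trans (hre.symm h'))⟩
      · exact Or.inr ⟨h1, h2'⟩
  · rintro c c' (h | h)
    · by_cases h1 : c = a
      · right
        rw [← h, h1]
        exact ⟨Or.inl (hre.refl _), Or.inr (hre.refl _)⟩
      · by_cases h2 : c = b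
        · right
          rw [← h, h2, hb, pulledBack_pulledBack hσ]
          exact ⟨Or.inr (hre.refl _), Or.inl (hre.refl _)⟩
        · exact Or.inl (.rel _ _ (Or.inr ⟨h, h1, h2⟩))
    · exact Or.inl (.rel _ _ (Or.inl h))

/-- The labels join all predecessors of each letter not fixed by `σ`. -/
def OddValid (hT : IsFullCycle (stepPerm T)) (σ : Perm (Fin k)) (x : Fin k × Fin k)
    (g : Fin k → Fin k) : Prop :=
  ∀ e, σ e ≠ e → ∀ c c', Relation.EqvGen (LabelJoined hT σ x (oddLabel σ T x g) e) c c'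

theorem oddValid_of_start (hT : IsFullCycle (stepPerm T)) (hσ : ∀ e, σ (σ e) = e)
    (hl : ∀ e ∈ pairReps σ, LinkedAt σ T e)
    (hs : σ x.1 ≠ x.1 → ∀ c, Relation.EqvGen (LabelJoined hT σ x (oddLabel σ T x g) x.1) c
      (pulledBack σ T x.1 c)) : OddValid hT σ x g := by
  have hlab : ∀ t < k * k, σ (walk T x (t + 1)) ≠ walk T x (t + 1) →
      oddLabel σ T x g t = pairRep σ (walk T x (t + 1)) := fun t => oddLabel_of_ne
  have hs' : σ x.1 ≠ x.1 →
      ∀ c c', Relation.EqvGen (LabelJoined hT σ x (oddLabel σ T x g) x.1) c c' := fun h1 =>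
    eqvGen_labelJoined_of_linkedAt hT (linkedAt_of_pairReps hσ hl h1) (hs h1) fun c =>
      .rel _ _ (Or.inr (lab_pulledBack_eq hT hσ hlab (Or.inl h1)))
  intro e he c c'
  by_cases h1 : e = x.1
  · rw [h1] at he ⊢
    exact hs' he c c'
  · by_cases h2 : σ e = x.1
    · have h3 : σ x.1 ≠ x.1 := by
        rw [← h2]
        exact fun h => he (σ.injective h)
      have := hs' h3 c c'
      rw [← h2, labelJoined_symm hT hσ] at this
      exact this
    · refine eqvGen_labelJoined_of_linkedAt hT (linkedAt_of_pairReps hσ hl he) ?_ ?_ c c'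
      · exact fun c => .rel _ _ (Or.inl (lab_pulledBack_eq hT hσ hlab (Or.inl h1)))
      · exact fun c => .rel _ _ (Or.inr (lab_pulledBack_eq hT hσ hlab (Or.inl h2)))

theorem pulledBack_inv_apply (σ : Perm (Fin k)) (T : Fin k → Perm (Fin k)) (s f : Fin k) :
    pulledBack σ T s ((T s)⁻¹ f) = (T s)⁻¹ (σ f) := by
  simp [pulledBack]

theorem oddValid_of_fixed (hT : IsFullCycle (stepPerm T)) (hσ : ∀ e, σ (σ e) = e)
    (hl : ∀ e ∈ pairReps σ, LinkedAt σ T e) {s f : Fin k} (h : σ f = f ∨ σ s = s) :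
    OddValid hT σ (s, f) g := by
  refine oddValid_of_start hT hσ hl fun hs c => ?_
  replace h : σ f = f := h.resolve_right hs
  by_cases hc : T s c = f
  · have : pulledBack σ T s c = c := (T s).injective (by rw [apply_pulledBack, hc, h])
    dsimp only
    rw [this]
    exact .refl _
  · refine .rel _ _ (Or.inl (lab_pulledBack_eq hT hσ (fun t => oddLabel_of_ne) (Or.inr ⟨hc, ?_⟩)))
    intro h'
    dsimp only at h'
    rw [← h] at h'
    exact hc (σ.injective h')

/-- The final position and the position before the exit `(s, o)` both have label `g s`. This gives a
new edge from the predecessor at `f` to the one at `o`, which replaces the missing edge if the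
latter lies on the side of `σ f`. -/
theorem oddValid_of_brokenRel (hT : IsFullCycle (stepPerm T)) (hσ : ∀ e, σ (σ e) = e)
    (hl : ∀ e ∈ pairReps σ, LinkedAt σ T e) {s f o : Fin k} (ho : σ o = o)
    (hb : BrokenRel σ T s ((T s)⁻¹ f) ((T s)⁻¹ o) ((T s)⁻¹ (σ f))) :
    OddValid hT σ (s, f) g := by
  refine oddValid_of_start hT hσ hl fun hs => ?_
  dsimp only at hs ⊢
  set r := Relation.EqvGen (LabelJoined hT σ (s, f) (oddLabel σ T (s, f) g) s) with hr
  have hre : Equivalence r :=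
    ⟨fun _ => .refl _, fun h => .symm _ _ h, fun h h' => .trans _ _ _ h h'⟩
  have hP : ∀ c, c ≠ (T s)⁻¹ f → c ≠ (T s)⁻¹ (σ f) → r c (pulledBack σ T s c) := by
    intro c h1 h2
    rw [Ne, Perm.eq_inv_iff_eq] at h1 h2
    refine .rel _ _ (Or.inl (lab_pulledBack_eq hT hσ (fun t => oddLabel_of_ne) (Or.inr ⟨h1, ?_⟩)))
    intro h'
    apply h2
    dsimp only at h'
    rw [← h', hσ]
  have h1 : r ((T s)⁻¹ o) ((T s)⁻¹ (σ f)) := by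
    refine eqvGen_rec hre ?_ hb
    rintro c c' (rfl | ⟨rfl, h1, h2⟩)
    · exact .rel _ _ (Or.inr (lab_pulledBack_eq hT hσ (fun t => oddLabel_of_ne) (Or.inl hs)))
    · rw [pulledBack_inv_apply] at h2
      exact hP c h1 h2
  have h2 : r ((T s)⁻¹ f) ((T s)⁻¹ o) := by
    refine .rel _ _ (Or.inl ?_)
    have h3 := arcPos_succ_eq hT (s, f) (c := (T s)⁻¹ f) (by simp)
    dsimp only at h3
    rw [h3, oddLabel_last hT, oddLabel_of_eq, walk_arcPos_succ]
    have h4 := walk_arcPos_add_two hT (s, f) ((T s)⁻¹ o) s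
    rw [show T s ((T s)⁻¹ o) = o by simp] at h4
    rw [h4, ho]
  have h3 := hre.trans h2 h1
  intro c
  by_cases h4 : c = (T s)⁻¹ f
  · rw [h4, pulledBack_inv_apply]
    exact h3
  · by_cases h5 : c = (T s)⁻¹ (σ f)
    · rw [h5, pulledBack_inv_apply, hσ]
      exact hre.symm h3
    · exact hP c h4 h5

/-- The choices `f` and `σ f` of the second letter lose the same edge, but the substitute edge
starts at opposite ends of it. So one of them reconnects the two sides. -/
theorem oddValid_or (hT : IsFullCycle (stepPerm T)) (hσ : ∀ e, σ (σ e) = e)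
    (hl : ∀ e ∈ pairReps σ, LinkedAt σ T e) {o : Fin k} (ho : σ o = o) (s f : Fin k) :
    OddValid hT σ (s, f) g ∨ OddValid hT σ (s, σ f) g := by
  by_cases hf : σ f = f
  · exact Or.inl (oddValid_of_fixed hT hσ hl (Or.inl hf))
  by_cases hs : σ s = s
  · exact Or.inl (oddValid_of_fixed hT hσ hl (Or.inr hs))
  have h := brokenRel_or hσ (linkedAt_of_pairReps hσ hl hs) ((T s)⁻¹ f) ((T s)⁻¹ o)
  rw [pulledBack_inv_apply] at h
  rcases h with h | h
  · right
    apply oddValid_of_brokenRel hT hσ hl ho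
    rwa [hσ, ← pulledBack_inv_apply, brokenRel_pulledBack hσ]
  · left
    exact oddValid_of_brokenRel hT hσ hl ho h

theorem le_two_mul_card_oddValid (hT : IsFullCycle (stepPerm T)) (hσ : ∀ e, σ (σ e) = e)
    (hl : ∀ e ∈ pairReps σ, LinkedAt σ T e) {o : Fin k} (ho : σ o = o) (s : Fin k) :
    k ≤ Nat.card {f // OddValid hT σ (s, f) g} * 2 := by
  classical
  rw [Nat.card_eq_fintype_card, Fintype.card_subtype]
  have h1 := Finset.card_filter_add_card_filter_not (s := (Finset.univ : Finset (Fin k)))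
    (fun f => OddValid hT σ (s, f) g)
  have h2 : (Finset.univ.filter fun f => ¬ OddValid hT σ (s, f) g).card ≤
      (Finset.univ.filter fun f => OddValid hT σ (s, f) g).card := by
    refine Finset.card_le_card_of_injOn σ ?_ σ.injective.injOn
    intro f hf
    simp only [Finset.coe_filter, Finset.mem_univ, true_and, Set.mem_ofPred_eq] at hf ⊢
    exact (oddValid_or hT hσ hl ho s f).resolve_left hf
  rw [Finset.card_univ, Fintype.card_fin] at h1
  omega

theorem isScheme_oddLabel (hT : IsFullCycle (stepPerm T)) (hσ : ∀ e, σ (σ e) = e)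
    (hu : ∀ a b, σ a = a → σ b = b → a = b) (hv : OddValid hT σ x g) :
    IsScheme σ T x (oddLabel σ T x g) := by
  have h0 := arcPos_self hT x
  have hlt := arcPos_lt hT x x.1 x.2
  refine ⟨hT, hσ, hu, fun t => oddLabel_of_ne, hv, ?_⟩
  by_cases hx : σ x.2 = x.2
  · refine ⟨k * k, by omega, le_rfl, walk_sq hT x, ?_⟩
    rw [oddLabel_last hT, ← h0, oddLabel_arcPos_of_eq hT hx]
  · refine ⟨arcPos hT x x.1 (σ x.2), ?_, (arcPos_lt hT x _ _).le, walk_arcPos hT x _ _, ?_⟩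
    · by_contra hcon
      have : arcPos hT x x.1 (σ x.2) = arcPos hT x x.1 x.2 := by omega
      exact hx (arcPos_inj hT x this).2
    · rw [oddLabel_arcPos_of_ne hT fun h => hx (σ.injective h), ← h0,
        oddLabel_arcPos_of_ne hT hx, pairRep_eq_iff hσ, hσ]
      exact Or.inr rfl

theorem oddLabel_mem_PiDB {h : ℕ} (hk : k = 2 * h + 1) (hcard : (pairReps σ).card = h)
    (hT : IsFullCycle (stepPerm T)) (hσ : ∀ e, σ (σ e) = e) (hg : IsExitChoice σ x.1 g) :
    labelCode (walk T x) (oddLabel σ T x g) ∈ PiDB k := by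
  have hgs : g x.1 ∉ pairReps σ := fun h => by
    have := mem_pairReps.1 h
    rw [hg.1] at this
    exact lt_irrefl _ this
  have hne : ∀ l ∈ pairReps σ, σ l ≠ l := fun l hl => (mem_pairReps.1 hl).ne'
  have hsub : ∀ j, pairReps σ ⊆ if j = x.1 then insert (g x.1) (pairReps σ) else pairReps σ := by
    intro j
    split_ifs
    · exact Finset.subset_insert _ _
    · exact subset_rfl
  -- The start letter has `2 * h + 2` occurrences and needs one more variable: it consists of the
  -- exit to the fixed letter and the final position.
  refine labelCode_mem_PiDB (wordOf_walk_mem hT x)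
    (fun j => if j = x.1 then insert (g x.1) (pairReps σ) else pairReps σ) ?_ ?_ ?_
  · intro j
    rw [count_wordOf_walk hT]
    split_ifs
    · rw [Finset.card_insert_of_notMem hgs, hcard]
      omega
    · rw [hcard]
      omega
  · intro t _
    rw [oddLabel]
    by_cases h1 : t < k * k ∧ σ (walk T x (t + 1)) ≠ walk T x (t + 1)
    · rw [if_pos h1]
      exact hsub _ (pairRep_mem_pairReps hσ h1.2)
    · rw [if_neg h1]
      split_ifs with h2
      · rw [h2]
        exact Finset.mem_insert_self _ _
      · exact hg.2 _ h2
  · intro j l hl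
    by_cases hl' : l ∈ pairReps σ
    · have h1 := arcPos_lt hT x j l
      have h2 := arcPos_lt hT x j (σ l)
      obtain ⟨t, t', h3, h4, h5, h6⟩ := exists_lt_of_ne
        (P := fun t => walk T x t = j ∧ oddLabel σ T x g t = l)
        (fun h => hne l hl' (arcPos_inj hT x h).2.symm) h1.le h2.le
        ⟨walk_arcPos hT x j l, by
          rw [oddLabel_arcPos_of_ne hT (hne l hl'), pairRep_of_mem hl']⟩
        ⟨walk_arcPos hT x j (σ l), by
          rw [oddLabel_arcPos_of_ne hT fun h => hne l hl' (σ.injective h)]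
          nth_rw 2 [← pairRep_of_mem hl']
          rw [pairRep_eq_iff hσ, hσ]
          exact Or.inr rfl⟩
      exact ⟨t, t', h3, h4, h5.1, h6.1, h5.2, h6.2⟩
    · split_ifs at hl with hj
      · obtain rfl := (Finset.mem_insert.1 hl).resolve_right hl'
        subst hj
        exact ⟨arcPos hT x x.1 (g x.1), k * k, arcPos_lt hT x _ _, le_rfl, walk_arcPos hT x _ _,
          walk_sq hT x, oddLabel_arcPos_of_eq hT hg.1, oddLabel_last hT⟩
      · exact absurd hl hl'

end odd

/-! ### Locating the exits to the fixed letter in the pattern. -/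

section marks

variable {k : ℕ}

/-- The positions that carry the same letter and label as the position `t`. -/
def labelClass (w : ℕ → Fin k) (lab : ℕ → Fin k) (t : ℕ) : Finset ℕ :=
  (Finset.range (k * k + 1)).filter fun t' => w t' = w t ∧ lab t' = lab t

theorem mem_labelClass {w lab : ℕ → Fin k} {t t' : ℕ} :
    t' ∈ labelClass w lab t ↔ t' ≤ k * k ∧ w t' = w t ∧ lab t' = lab t := by
  simp [labelClass]

theorem labelClass_eq_of_mem {w lab : ℕ → Fin k} {t t' : ℕ} (h : t' ∈ labelClass w lab t) :
    labelClass w lab t' = labelClass w lab t := by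
  ext u
  rw [mem_labelClass, mem_labelClass, (mem_labelClass.1 h).2.1, (mem_labelClass.1 h).2.2]

theorem labelClass_eq_of_code_eq {w lab w' lab' : ℕ → Fin k}
    (h : labelCode w lab = labelCode w' lab') {t : ℕ} (ht : t ≤ k * k) :
    labelClass w lab t = labelClass w' lab' t := by
  ext u
  rw [mem_labelClass, mem_labelClass]
  exact and_congr_right fun hu => labelCode_eq_labelCode h hu ht

variable {σ : Perm (Fin k)} {T : Fin k → Perm (Fin k)} {x : Fin k × Fin k} {g : Fin k → Fin k}

theorem oddLabel_of_mem_marked {t : ℕ} (ht : t ∈ markedPositions σ (walk T x)) :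
    oddLabel σ T x g t = g (walk T x t) := oddLabel_of_eq (mem_markedPositions.1 ht).2

theorem marked_eq_of_walk_eq (hT : IsFullCycle (stepPerm T))
    (hu : ∀ a b, σ a = a → σ b = b → a = b) {t t' : ℕ}
    (ht : t ∈ markedPositions σ (walk T x)) (ht' : t' ∈ markedPositions σ (walk T x))
    (h : walk T x t = walk T x t') : t = t' := by
  rw [mem_markedPositions] at ht ht'
  exact walk_injOn hT x (by rw [Fintype.card_fin]; exact ht.1) (by rw [Fintype.card_fin]; exact ht'.1)
    h (hu _ _ ht.2 ht'.2)

theorem arcPos_mem_marked (hT : IsFullCycle (stepPerm T)) {o : Fin k} (ho : σ o = o) (c : Fin k) :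
    arcPos hT x c o ∈ markedPositions σ (walk T x) :=
  mem_markedPositions.2 ⟨arcPos_lt hT x c o, by rw [walk_arcPos_succ, ho]⟩

theorem labelClass_erase_of_marked (hT : IsFullCycle (stepPerm T)) (hσ : ∀ e, σ (σ e) = e)
    (hu : ∀ a b, σ a = a → σ b = b → a = b) (hg : IsExitChoice σ x.1 g) {t : ℕ}
    (ht : t ∈ markedPositions σ (walk T x)) (hs : walk T x t = x.1) :
    (labelClass (walk T x) (oddLabel σ T x g) t).erase (k * k) ⊆ {t} := by
  intro t' ht'
  rw [Finset.mem_erase, mem_labelClass, oddLabel_of_mem_marked ht, hs] at ht'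
  obtain ⟨h1, h2, h3, h4⟩ := ht'
  have hlt : t' < k * k := lt_of_le_of_ne h2 h1
  rw [Finset.mem_singleton]
  by_cases hf : σ (walk T x (t' + 1)) = walk T x (t' + 1)
  · exact marked_eq_of_walk_eq hT hu (mem_markedPositions.2 ⟨hlt, hf⟩) ht (h3.trans hs.symm)
  · rw [oddLabel_of_ne hlt hf] at h4
    have h5 := mem_pairReps.1 (pairRep_mem_pairReps hσ hf)
    rw [h4, hg.1] at h5
    exact absurd h5 (lt_irrefl _)

/-- The class consists of the exits from `c` to the fixed letter, to `g c` and to `σ (g c)`. -/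
theorem card_labelClass_of_marked (hT : IsFullCycle (stepPerm T)) (hσ : ∀ e, σ (σ e) = e)
    (hu : ∀ a b, σ a = a → σ b = b → a = b) (hg : IsExitChoice σ x.1 g) {t : ℕ}
    (ht : t ∈ markedPositions σ (walk T x)) (hs : walk T x t ≠ x.1) :
    (labelClass (walk T x) (oddLabel σ T x g) t).card = 3 := by
  set c := walk T x t with hc
  obtain ⟨ht1, ht2⟩ := mem_markedPositions.1 ht
  set o := walk T x (t + 1) with ho
  have hgc := hg.2 c hs
  have hgne : σ (g c) ≠ g c := (mem_pairReps.1 hgc).ne'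
  have hgne' : σ (σ (g c)) ≠ σ (g c) := fun h => hgne (σ.injective h)
  have h1 : labelClass (walk T x) (oddLabel σ T x g) t =
      ({o, g c, σ (g c)} : Finset (Fin k)).image fun e => arcPos hT x c e := by
    ext t'
    rw [mem_labelClass, oddLabel_of_mem_marked ht, ← hc]
    simp only [Finset.mem_image, Finset.mem_insert, Finset.mem_singleton]
    constructor
    · rintro ⟨h1, h2, h3⟩
      have hlt : t' < k * k := by
        refine lt_of_le_of_ne h1 ?_
        rintro rfl
        rw [walk_sq hT] at h2
        exact hs h2.symm
      refine ⟨walk T x (t' + 1), ?_, arcPos_eq hT x hlt h2 rfl⟩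
      by_cases hf : σ (walk T x (t' + 1)) = walk T x (t' + 1)
      · exact Or.inl (hu _ _ hf ht2)
      · rw [oddLabel_of_ne hlt hf, ← pairRep_of_mem hgc, eq_comm, pairRep_eq_iff hσ] at h3
        exact Or.inr h3
    · rintro ⟨e, he, rfl⟩
      refine ⟨(arcPos_lt hT x c e).le, walk_arcPos hT x c e, ?_⟩
      rcases he with rfl | rfl | rfl
      · exact oddLabel_arcPos_of_eq hT ht2
      · rw [oddLabel_arcPos_of_ne hT hgne, pairRep_of_mem hgc]
      · rw [oddLabel_arcPos_of_ne hT hgne']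
        nth_rw 2 [← pairRep_of_mem hgc]
        rw [pairRep_eq_iff hσ, hσ]
        exact Or.inr rfl
  rw [h1, Finset.card_image_of_injective _ fun e e' h => (arcPos_inj hT x h).2,
    Finset.card_eq_three]
  refine ⟨_, _, _, ?_, ?_, hgne.symm, rfl⟩
  · intro h
    rw [← h] at hgne
    exact hgne ht2
  · intro h
    rw [← h] at hgne'
    exact hgne' ht2

theorem special_of_marked (hT : IsFullCycle (stepPerm T)) (hσ : ∀ e, σ (σ e) = e)
    (hu : ∀ a b, σ a = a → σ b = b → a = b) (hg : IsExitChoice σ x.1 g) {t : ℕ}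
    (ht : t ∈ markedPositions σ (walk T x)) :
    k * k ∈ labelClass (walk T x) (oddLabel σ T x g) t ∨
      (labelClass (walk T x) (oddLabel σ T x g) t).card = 3 := by
  by_cases hs : walk T x t = x.1
  · left
    rw [mem_labelClass, oddLabel_last hT, oddLabel_of_mem_marked ht, hs]
    exact ⟨le_rfl, walk_sq hT x, rfl⟩
  · exact Or.inr (card_labelClass_of_marked hT hσ hu hg ht hs)

/-- A class without the final position and without marked positions contains only exits to the two
letters of one pair. So size three or containing the final position, both visible in the pattern,
reveals a mark. -/
theorem exists_marked_of_special (hT : IsFullCycle (stepPerm T)) (hg : IsExitChoice σ x.1 g)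
    {t : ℕ} (h : k * k ∈ labelClass (walk T x) (oddLabel σ T x g) t ∨
      (labelClass (walk T x) (oddLabel σ T x g) t).card = 3) :
    ∃ t' ∈ labelClass (walk T x) (oddLabel σ T x g) t, t' ∈ markedPositions σ (walk T x) := by
  by_cases hN : k * k ∈ labelClass (walk T x) (oddLabel σ T x g) t
  · refine ⟨arcPos hT x x.1 (g x.1), ?_, arcPos_mem_marked hT hg.1 _⟩
    rw [← labelClass_eq_of_mem hN, mem_labelClass, walk_arcPos, walk_sq hT,
      oddLabel_arcPos_of_eq hT hg.1, oddLabel_last hT]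
    exact ⟨(arcPos_lt hT x _ _).le, rfl, rfl⟩
  · replace h := h.resolve_left hN
    by_contra hcon
    push Not at hcon
    set l := oddLabel σ T x g t with hl
    have h1 : labelClass (walk T x) (oddLabel σ T x g) t ⊆
        ({l, σ.symm l} : Finset (Fin k)).image fun e => arcPos hT x (walk T x t) e := by
      intro t' ht'
      have hm := hcon t' ht'
      have hlt : t' < k * k := by
        refine lt_of_le_of_ne (mem_labelClass.1 ht').1 ?_
        rintro rfl
        exact hN ht'
      rw [mem_labelClass] at ht'
      have hf : σ (walk T x (t' + 1)) ≠ walk T x (t' + 1) := fun h =>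
        hm (mem_markedPositions.2 ⟨hlt, h⟩)
      have h2 := ht'.2.2
      rw [oddLabel_of_ne hlt hf, pairRep, ← hl] at h2
      refine Finset.mem_image.2 ⟨walk T x (t' + 1), ?_, arcPos_eq hT x hlt ht'.2.1 rfl⟩
      rw [Finset.mem_insert, Finset.mem_singleton, Equiv.eq_symm_apply]
      rcases min_choice (walk T x (t' + 1)) (σ (walk T x (t' + 1))) with h3 | h3
      · exact Or.inl (h3.symm.trans h2)
      · exact Or.inr (h3.symm.trans h2)
    have h2 := (Finset.card_le_card h1).trans (Finset.card_image_le.trans Finset.card_le_two)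
    omega

/-- A finite set that contains the sets of marked positions of all walks with a given pattern. -/
def markSets (w lab : ℕ → Fin k) (p : Fin k → ℕ) : Finset (Finset ℕ) :=
  (Fintype.piFinset fun c => (labelClass w lab (p c)).erase (k * k)).image fun m =>
    Finset.univ.image m

/-- There are three candidates for each letter other than the start letter, whose class leaves one
candidate after the final position is erased. -/
theorem card_markSets_le {h : ℕ} (hk : k = 2 * h + 1) (hT : IsFullCycle (stepPerm T))
    (hσ : ∀ e, σ (σ e) = e)
    (hu : ∀ a b, σ a = a → σ b = b → a = b) (hg : IsExitChoice σ x.1 g) {o : Fin k}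
    (ho : σ o = o) :
    (markSets (walk T x) (oddLabel σ T x g) fun c => arcPos hT x c o).card ≤ 3 ^ (2 * h) := by
  refine Finset.card_image_le.trans ?_
  rw [Fintype.card_piFinset, ← Finset.mul_prod_erase _ _ (Finset.mem_univ x.1)]
  have h1 : ((labelClass (walk T x) (oddLabel σ T x g) (arcPos hT x x.1 o)).erase
      (k * k)).card ≤ 1 := by
    have := Finset.card_le_card (labelClass_erase_of_marked hT hσ hu hg
      (arcPos_mem_marked hT ho x.1) (walk_arcPos hT x _ _))
    simpa using this
  have h2 : ∀ c ∈ Finset.univ.erase x.1, ((labelClass (walk T x) (oddLabel σ T x g)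
      (arcPos hT x c o)).erase (k * k)).card ≤ 3 := by
    intro c hc
    refine Finset.card_erase_le.trans (card_labelClass_of_marked hT hσ hu hg
      (arcPos_mem_marked hT ho c) ?_).le
    rw [walk_arcPos]
    exact Finset.ne_of_mem_erase hc
  calc _ ≤ 1 * 3 ^ (Finset.univ.erase x.1).card :=
        Nat.mul_le_mul h1 (Finset.prod_le_pow_card _ _ _ h2)
    _ = _ := by
      rw [one_mul, Finset.card_erase_of_mem (Finset.mem_univ _), Finset.card_univ, Fintype.card_fin,
        hk, Nat.add_sub_cancel]

theorem markedPositions_mem_markSets {σ' : Perm (Fin k)} {T' : Fin k → Perm (Fin k)}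
    {x' : Fin k × Fin k} {g' : Fin k → Fin k}
    (hT : IsFullCycle (stepPerm T)) (hσ : ∀ e, σ (σ e) = e)
    (hu : ∀ a b, σ a = a → σ b = b → a = b) (hg : IsExitChoice σ x.1 g) {o : Fin k}
    (ho : σ o = o) (hT' : IsFullCycle (stepPerm T')) (hσ' : ∀ e, σ' (σ' e) = e)
    (hu' : ∀ a b, σ' a = a → σ' b = b → a = b) (hg' : IsExitChoice σ' x'.1 g')
    (hcode : labelCode (walk T' x') (oddLabel σ' T' x' g') =
      labelCode (walk T x) (oddLabel σ T x g)) :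
    markedPositions σ' (walk T' x') ∈
      markSets (walk T x) (oddLabel σ T x g) fun c => arcPos hT x c o := by
  have hcls : ∀ t ≤ k * k, labelClass (walk T' x') (oddLabel σ' T' x' g') t =
      labelClass (walk T x) (oddLabel σ T x g) t := fun t => labelClass_eq_of_code_eq hcode
  have hex : ∀ c, ∃ t ∈ labelClass (walk T x) (oddLabel σ T x g) (arcPos hT x c o),
      t ∈ markedPositions σ' (walk T' x') := by
    intro c
    have h1 := special_of_marked hT hσ hu hg (arcPos_mem_marked hT ho c)
    rw [← hcls _ (arcPos_lt hT x c o).le] at h1 ⊢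
    exact exists_marked_of_special hT' hg' h1
  choose m hm hm' using hex
  refine Finset.mem_image.2 ⟨m, Fintype.mem_piFinset.2 fun c => Finset.mem_erase.2
    ⟨(mem_markedPositions.1 (hm' c)).1.ne, hm c⟩, ?_⟩
  ext t
  rw [Finset.mem_image]
  constructor
  · rintro ⟨c, -, rfl⟩
    exact hm' c
  · intro ht
    have ht1 := (mem_markedPositions.1 ht).1.le
    have h1 := special_of_marked hT' hσ' hu' hg' ht
    rw [hcls t ht1] at h1
    obtain ⟨t₀, h2, h3⟩ := exists_marked_of_special hT hg h1
    refine ⟨walk T x t₀, Finset.mem_univ _, ?_⟩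
    have h4 : arcPos hT x (walk T x t₀) o = t₀ := by
      rw [mem_markedPositions] at h3
      exact arcPos_eq hT x h3.1 rfl (hu _ _ h3.2 ho)
    have h5 := hm (walk T x t₀)
    rw [h4, labelClass_eq_of_mem h2, ← hcls t ht1, mem_labelClass] at h5
    exact marked_eq_of_walk_eq hT' hu' (hm' _) ht h5.2.1

end marks

/-! ### An odd number of letters: the count. -/

section oddCount

variable {k h : ℕ}

theorem Pairing.fixed_unique (hk : k = 2 * h + 1) (σ : Pairing k h) (a b : Fin k)
    (ha : σ.1 a = a) (hb : σ.1 b = b) : a = b := by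
  obtain ⟨o, ho⟩ := σ.exists_center hk
  rw [(ho a).1 ha, (ho b).1 hb]

/-- The data of a labelled walk for an odd number of letters. -/
abbrev OddData (k h : ℕ) : Type := Σ σ : Pairing k h,
  Σ T : {T : Fin k → Perm (Fin k) // IsFullCycle (stepPerm T) ∧
    ∀ e ∈ pairReps σ.1, LinkedAt σ.1 T e},
  Σ s : Fin k, Σ g : {g : Fin k → Fin k // IsExitChoice σ.1 s g},
    {f // OddValid T.2.1 σ.1 (s, f) g.1}

/-- The walk that belongs to the data. -/
def OddData.walk (d : OddData k h) : ℕ → Fin k := _root_.walk d.2.1.1 (d.2.2.1, d.2.2.2.2.1)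

/-- The labelling that belongs to the data. -/
def OddData.label (d : OddData k h) : ℕ → Fin k :=
  oddLabel d.1.1 d.2.1.1 (d.2.2.1, d.2.2.2.2.1) d.2.2.2.1.1

theorem card_oddData_le (hk : k = 2 * h + 1) :
    Nat.card (OddData k h) ≤ k ! * 3 ^ (2 * h) * (PiDB k).ncard := by
  refine card_le_mul_ncard_of_fiber_le (fun d : OddData k h => labelCode d.walk d.label)
    (finite_PiDB (by omega))
    (fun d => oddLabel_mem_PiDB hk d.1.card_pairReps d.2.1.2.1 d.1.invol d.2.2.2.1.2) fun d₀ => ?_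
  obtain ⟨o, ho⟩ := d₀.1.exists_center hk
  set S := markSets d₀.walk d₀.label fun c => arcPos d₀.2.1.2.1 (d₀.2.2.1, d₀.2.2.2.2.1) c o with hS
  have h1 : S.card ≤ 3 ^ (2 * h) := card_markSets_le hk d₀.2.1.2.1 d₀.1.invol
    (d₀.1.fixed_unique hk) d₀.2.2.2.1.2 ((ho o).2 rfl)
  have h2 := card_le_mul_ncard_of_fiber_le
    (fun d : {d : OddData k h // labelCode d.walk d.label = labelCode d₀.walk d₀.label} =>
      markedPositions d.1.1.1 d.1.walk) (S := (S : Set (Finset ℕ))) (Finset.finite_toSet S)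
    (fun d => markedPositions_mem_markSets d₀.2.1.2.1 d₀.1.invol
      (d₀.1.fixed_unique hk) d₀.2.2.2.1.2 ((ho o).2 rfl) d.1.2.1.2.1 d.1.1.invol
      (d.1.1.fixed_unique hk) d.1.2.2.2.1.2 d.2) (B := k !) ?_
  · rw [Set.ncard_coe_finset] at h2
    exact h2.trans (Nat.mul_le_mul_left _ h1)
  · intro d₁
    have h3 := card_scheme_fiber_le (fun d : OddData k h => d.1.1) (fun d => d.2.1.1)
      (fun d => (d.2.2.1, d.2.2.2.2.1)) (fun d => d.label)
      (fun d => isScheme_oddLabel d.2.1.2.1 d.1.invol (d.1.fixed_unique hk) d.2.2.2.2.2) ?_ d₁.1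
    · refine le_trans (Nat.card_le_card_of_injective (fun d => ⟨d.1.1,
        d.1.2.trans d₁.2.symm, d.2⟩) ?_) h3
      intro d d' hd
      have h4 := congrArg Subtype.val hd
      exact Subtype.ext (Subtype.ext h4)
    · rintro ⟨⟨σ, hσ⟩, ⟨T, hT, hl⟩, s, ⟨g, hg⟩, f, hf⟩ ⟨⟨σ', hσ'⟩, ⟨T', hT', hl'⟩, s', ⟨g', hg'⟩, f', hf'⟩
        hcode e1 e2 e3
      dsimp only at e1 e2 e3 hcode
      subst e1 e2
      rw [Prod.mk.injEq] at e3
      obtain ⟨rfl, rfl⟩ := e3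
      -- For `c ≠ s` the exit from `c` to the fixed letter, which is `g s`, shares its variable with
      -- the exit to `g c`.
      have hgg : g = g' := by
        funext c
        by_cases hc : c = s
        · rw [hc]
          exact Pairing.fixed_unique hk ⟨σ, hσ⟩ _ _ hg.1 hg'.1
        · have hgc := hg.2 c hc
          have hne : σ (g c) ≠ g c := (mem_pairReps.1 hgc).ne'
          have h4 := (labelCode_eq_labelCode hcode (arcPos_lt hT (s, f) c (g s)).le
            (arcPos_lt hT (s, f) c (g c)).le).1
            ⟨by rw [walk_arcPos, walk_arcPos], by
              simp only [OddData.label]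
              rw [oddLabel_arcPos_of_eq hT hg.1, oddLabel_arcPos_of_ne hT hne, pairRep_of_mem hgc]⟩
          have h5 := h4.2
          simp only [OddData.label] at h5
          rw [oddLabel_arcPos_of_eq hT hg.1, oddLabel_arcPos_of_ne hT hne,
            pairRep_of_mem hgc] at h5
          exact h5.symm
      subst hgg
      rfl

theorem card_exitChoice (hk : k = 2 * h + 1) (σ : Pairing k h) (s : Fin k) :
    h ^ (2 * h) ≤ Nat.card {g : Fin k → Fin k // IsExitChoice σ.1 s g} := by
  classical
  obtain ⟨o, ho⟩ := σ.exists_center hk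
  set S : Finset (Fin k → Fin k) := Fintype.piFinset fun c =>
    if c = s then {o} else pairReps σ.1 with hS
  have h1 : S.card = h ^ (2 * h) := by
    rw [hS, Fintype.card_piFinset, ← Finset.mul_prod_erase _ _ (Finset.mem_univ s), if_pos rfl,
      Finset.card_singleton, one_mul, Finset.prod_congr rfl (g := fun _ => h), Finset.prod_const,
      Finset.card_erase_of_mem (Finset.mem_univ _), Finset.card_univ, Fintype.card_fin, hk,
      Nat.add_sub_cancel]
    intro c hc
    rw [if_neg (Finset.ne_of_mem_erase hc), σ.card_pairReps]
  rw [← h1, Nat.card_eq_fintype_card, Fintype.card_subtype]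
  refine Finset.card_le_card fun g hg => ?_
  rw [hS, Fintype.mem_piFinset] at hg
  refine Finset.mem_filter.2 ⟨Finset.mem_univ _, ?_, fun c hc => ?_⟩
  · have := hg s
    rw [if_pos rfl, Finset.mem_singleton] at this
    rw [ho, this]
  · have := hg c
    rwa [if_neg hc] at this

theorem mul_le_card_oddData {a : ℕ} (hk : k = 2 * h + 1)
    (ha : ∀ σ : Pairing k h, ∀ τ υ : Perm (Fin k),
      a ≤ linkCount (τ⁻¹ * σ.1 * τ) (υ⁻¹ * σ.1 * υ)) :
    Nat.card (Pairing k h) * (h ^ (2 * h) * a ^ h * k ! ^ k) ≤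
      Nat.card (OddData k h) * (2 * (k - 1)! ^ h) := by
  refine card_sigma_mul_le fun σ => ?_
  obtain ⟨o, ho⟩ := σ.exists_center hk
  have h1 := pow_mul_card_le_card_linkedAt (ha σ) (pairReps σ.1) (by
    intro e he h
    rw [mem_pairReps] at he h
    rw [σ.invol] at h
    exact lt_asymm he h)
  rw [σ.card_pairReps, Fintype.card_fin] at h1
  have h2 := factorial_pow_le_card_eulerian (k := k) (by omega)
  have h3 := card_sigma_mul_le (m := 2) (I := {T : Fin k → Perm (Fin k) //
    IsFullCycle (stepPerm T) ∧ ∀ e ∈ pairReps σ.1, LinkedAt σ.1 T e})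
    (B := fun T => Σ s : Fin k, Σ g : {g : Fin k → Fin k // IsExitChoice σ.1 s g},
      {f // OddValid T.2.1 σ.1 (s, f) g.1}) (c := k * (h ^ (2 * h) * k)) fun T => by
    have h4 := card_sigma_mul_le (m := 2) (I := Fin k)
      (B := fun s => Σ g : {g : Fin k → Fin k // IsExitChoice σ.1 s g},
        {f // OddValid T.2.1 σ.1 (s, f) g.1}) (c := h ^ (2 * h) * k) fun s => by
      have h5 := card_sigma_mul_le (m := 2) (I := {g : Fin k → Fin k // IsExitChoice σ.1 s g})
        (B := fun g => {f // OddValid T.2.1 σ.1 (s, f) g.1}) (c := k) fun g =>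
          le_two_mul_card_oddValid T.2.1 σ.invol T.2.2 ((ho o).2 rfl) s
      exact (Nat.mul_le_mul_right _ (card_exitChoice hk σ s)).trans h5
    rwa [Nat.card_eq_fintype_card (α := Fin k), Fintype.card_fin] at h4
  calc h ^ (2 * h) * a ^ h * k ! ^ k ≤ h ^ (2 * h) * a ^ h *
        (Nat.card {T : Fin k → Perm (Fin k) // IsFullCycle (stepPerm T)} * k ^ 2) :=
        Nat.mul_le_mul_left _ h2
    _ = h ^ (2 * h) * k ^ 2 * (a ^ h *
        Nat.card {T : Fin k → Perm (Fin k) // IsFullCycle (stepPerm T)}) := by ring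
    _ ≤ h ^ (2 * h) * k ^ 2 * ((k - 1)! ^ h * _) := Nat.mul_le_mul_left _ h1
    _ = (k - 1)! ^ h * (_ * (k * (h ^ (2 * h) * k))) := by ring
    _ ≤ (k - 1)! ^ h * _ := Nat.mul_le_mul_left _ h3
    _ = _ := by ring

theorem factorial_pow_le_ncard_PiDB_of_odd (hk : k = 2 * h + 1) (hh : 3 ≤ h) :
    k ! ^ (k - 1) ≤ (PiDB k).ncard := by
  have ha : ∀ σ : Pairing k h, ∀ τ υ : Perm (Fin k),
      (2 * h - 1)‼ ^ 2 ≤ linkCount (τ⁻¹ * σ.1 * τ) (υ⁻¹ * σ.1 * υ) := by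
    intro σ τ υ
    obtain ⟨o, ho⟩ := σ.exists_center hk
    refine sq_doubleFactorial_le_linkCount h _ _ (by simp [hk]) (conj_inv_eq σ.invol τ)
      (conj_inv_eq σ.invol υ) ⟨τ⁻¹ o, fun x => ?_⟩ ⟨υ⁻¹ o, fun x => ?_⟩
    · rw [conj_apply_eq_self_iff, ho, Perm.eq_inv_iff_eq]
    · rw [conj_apply_eq_self_iff, ho, Perm.eq_inv_iff_eq]
  refine factorial_pow_le_of_counts (by omega) ?_ (card_pairing (Or.inr hk))
    (mul_le_card_oddData hk ha) (card_oddData_le hk) ?_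
  · have := Nat.doubleFactorial_pos (2 * h - 1)
    positivity
  · subst hk
    rw [Nat.add_sub_cancel]
    refine le_trans (le_of_eq ?_) (odd_count_bound hh)
    ring

end oddCount

/-! ### Fibres of other labellings, and one letter. -/

section letterMaps

variable {k : ℕ}

theorem exists_renaming_of_respects {T T' : Fin k → Perm (Fin k)} {x x' : Fin k × Fin k}
    (hT : IsFullCycle (stepPerm T)) (hT' : IsFullCycle (stepPerm T'))
    (h : ∀ t ≤ k * k, ∀ t' ≤ k * k, walk T x t = walk T x t' → walk T' x' t = walk T' x' t') :
    ∃ π : Perm (Fin k), ∀ t ≤ k * k, walk T' x' t = π (walk T x t) := by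
  set π : Fin k → Fin k := fun e => walk T' x' (arcPos hT x e e) with hπ
  have hall : ∀ t ≤ k * k, walk T' x' t = π (walk T x t) := fun t ht =>
    h t ht _ (arcPos_lt hT x _ _).le (walk_arcPos hT x _ _).symm
  have hsurj : Function.Surjective π := fun e =>
    ⟨walk T x (arcPos hT' x' e e), by
      rw [← hall _ (arcPos_lt hT' x' e e).le, walk_arcPos]⟩
  exact ⟨Equiv.ofBijective π (Finite.surjective_iff_bijective.1 hsurj), hall⟩

theorem card_le_factorial_of_renaming {D : Type*} (T : D → Fin k → Perm (Fin k))
    (x : D → Fin k × Fin k) (hT : ∀ d, IsFullCycle (stepPerm (T d)))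
    (hdet : ∀ d d', T d = T d' → x d = x d' → d = d') (w : ℕ → Fin k)
    (h : ∀ d, ∃ π : Perm (Fin k), ∀ t ≤ k * k, walk (T d) (x d) t = π (w t)) :
    Nat.card D ≤ k ! := by
  choose π hπ using h
  have hinj : Function.Injective π := by
    intro d d' h
    have := transitions_eq_of_walk_eq (hT d) (hT d') fun t ht => by
      rw [hπ d t ht, hπ d' t ht, h]
    exact hdet _ _ this.1 this.2
  have := Nat.card_le_card_of_injective π hinj
  rwa [Nat.card_eq_fintype_card (α := Perm (Fin k)), Fintype.card_perm, Fintype.card_fin] at this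

theorem length_labelCode {L : Type*} [DecidableEq L] (w : ℕ → Fin k) (lab : ℕ → L) :
    (labelCode w lab).length = k * k + 1 := by
  rw [labelCode, canonicalCode, List.length_map, length_wordOf]

/-- The walks with a given pattern are determined by the letters that belong to the variables. -/
theorem card_le_pow_of_code_eq {D L : Type*} [DecidableEq L] {n : ℕ} {α : Pattern}
    (hα : α.vars.card = n + 1) (T : D → Fin k → Perm (Fin k)) (x : D → Fin k × Fin k)
    (lab : D → ℕ → L) (hcode : ∀ d, labelCode (walk (T d) (x d)) (lab d) = α)
    (hT : ∀ d, IsFullCycle (stepPerm (T d))) (hends : ∀ d, lab d 0 ≠ lab d (k * k))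
    (hdet : ∀ d d', T d = T d' → x d = x d' → d = d') : Nat.card D ≤ k ^ n := by
  rcases isEmpty_or_nonempty D with hD | ⟨⟨d₀⟩⟩
  · simp
  have hlen : α.length = k * k + 1 := by rw [← hcode d₀, length_labelCode]
  have hget : ∀ d, ∀ t ≤ k * k, ∀ t' ≤ k * k, α[t]? = α[t']? ↔
      (walk (T d) (x d) t = walk (T d) (x d) t' ∧ lab d t = lab d t') := by
    intro d t ht t' ht'
    rw [← getElem?_labelCode_eq_iff _ _ ht ht', hcode d]
  have hN : k * k < α.length := by omega
  -- The variable at the end needs no letter of its own: the walk is closed, and position `0`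
  -- carries another variable by `hends`.
  set V := α.vars.erase α[k * k] with hV
  have hVcard : V.card = n := by
    rw [hV, Finset.card_erase_of_mem (by simp [Pattern.vars]), hα, Nat.add_sub_cancel]
  have hidx : ∀ d, ∀ t (ht : t ≤ k * k), walk (T d) (x d) t =
      walk (T d) (x d) (α.idxOf (α[t]'(by omega))) := by
    intro d t ht
    have h1 : α.idxOf (α[t]'(by omega)) < α.length :=
      List.idxOf_lt_length_of_mem (List.getElem_mem _)
    refine ((hget d t ht _ (by omega)).1 ?_).1
    rw [List.getElem?_eq_getElem (by omega), List.getElem?_eq_getElem h1, List.getElem_idxOf]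
  let Φ : D → (V → Fin k) := fun d v => walk (T d) (x d) (α.idxOf v.1)
  have hinj : Function.Injective Φ := by
    intro d d' h
    have key : ∀ t ≤ k * k, α[t]? ≠ α[k * k]? →
        walk (T d) (x d) t = walk (T d') (x d') t := by
      intro t ht hne
      have hmem : α[t]'(by omega) ∈ V := by
        refine Finset.mem_erase.2 ⟨fun h => hne ?_, by simp [Pattern.vars]⟩
        rw [List.getElem?_eq_getElem (by omega), List.getElem?_eq_getElem hN, h]
      rw [hidx d t ht, hidx d' t ht]
      exact congrFun h ⟨_, hmem⟩
    have key0 : walk (T d) (x d) 0 = walk (T d') (x d') 0 := by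
      refine key 0 (Nat.zero_le _) fun h => ?_
      exact hends d ((hget d 0 (Nat.zero_le _) _ le_rfl).1 h).2
    have := transitions_eq_of_walk_eq (hT d) (hT d') fun t ht => by
      by_cases hne : α[t]? = α[k * k]?
      · rw [((hget d t ht _ le_rfl).1 hne).1, ((hget d' t ht _ le_rfl).1 hne).1, walk_sq (hT d),
          walk_sq (hT d')]
        exact key0
      · exact key t ht hne
    exact hdet _ _ this.1 this.2
  refine (Nat.card_le_card_of_injective Φ hinj).trans (le_of_eq ?_)
  rw [Nat.card_eq_fintype_card, Fintype.card_fun, Fintype.card_fin, Fintype.card_coe, hVcard]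

end letterMaps

theorem PiDB_one_nonempty : (PiDB 1).Nonempty := by
  have hT : IsFullCycle (stepPerm fun _ : Fin 1 => (1 : Perm (Fin 1))) := fun a b => by
    rw [Subsingleton.elim a b]
  refine ⟨_, labelCode_mem_PiDB (lab := fun _ => (0 : Fin 1)) (wordOf_walk_mem hT (0, 0))
    (fun _ => {0}) ?_ (by simp) ?_⟩
  · intro j
    rw [count_wordOf_walk hT, if_pos (Subsingleton.elim _ _)]
    simp
  · intro j l hl
    exact ⟨0, 1, by norm_num, by norm_num, Subsingleton.elim _ _, Subsingleton.elim _ _,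
      Subsingleton.elim _ _, Subsingleton.elim _ _⟩

/-! ### Three letters. -/

section three

/-- The labelling for three letters that distinguishes the two ends from the other positions. -/
def endLabel (t : ℕ) : Fin 3 := if t = 0 ∨ t = 3 * 3 then 1 else 0

theorem endLabel_of_ne {t : ℕ} (h0 : t ≠ 0) (h : t ≠ 3 * 3) : endLabel t = 0 :=
  if_neg (by omega)

theorem endLabel_zero : endLabel 0 = 1 := if_pos (Or.inl rfl)

theorem endLabel_last : endLabel (3 * 3) = 1 := if_pos (Or.inr rfl)

variable {T T' : Fin 3 → Perm (Fin 3)} {x x' : Fin 3 × Fin 3}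

theorem endLabel_arcPos (hT : IsFullCycle (stepPerm T)) {c e : Fin 3} (h : (c, e) ≠ x) :
    endLabel (arcPos hT x c e) = 0 := by
  refine endLabel_of_ne (fun h0 => h ?_) (arcPos_lt hT x c e).ne
  rw [← arcPos_self hT x] at h0
  obtain ⟨h1, h2⟩ := arcPos_inj hT x h0
  exact Prod.ext h1 h2

theorem endLabel_mem_PiDB (hT : IsFullCycle (stepPerm T)) (x : Fin 3 × Fin 3) :
    labelCode (walk T x) endLabel ∈ PiDB 3 := by
  refine labelCode_mem_PiDB (wordOf_walk_mem hT x)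
    (fun j => if j = x.1 then {0, 1} else {0}) ?_ ?_ ?_
  · intro j
    rw [count_wordOf_walk hT]
    split_ifs <;> rfl
  · intro t ht
    by_cases h0 : t = 0
    · simp [h0, walk_zero, endLabel_zero]
    · by_cases h1 : t = 3 * 3
      · rw [h1, walk_sq hT, if_pos rfl, endLabel_last]
        simp
      · rw [endLabel_of_ne h0 h1]
        split_ifs <;> simp
  · intro j l hl
    have key : ∀ e e', e ≠ e' → (j, e) ≠ x → (j, e') ≠ x → l = 0 → ∃ t t', t < t' ∧ t' ≤ 3 * 3 ∧
        walk T x t = j ∧ walk T x t' = j ∧ endLabel t = l ∧ endLabel t' = l := by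
      rintro e e' hee he he' rfl
      obtain ⟨t, t', h3, h4, h5, h6⟩ := exists_lt_of_ne
        (P := fun t => walk T x t = j ∧ endLabel t = 0)
        (fun h => hee (arcPos_inj hT x h).2) (arcPos_lt hT x j e).le (arcPos_lt hT x j e').le
        ⟨walk_arcPos hT x j e, endLabel_arcPos hT he⟩
        ⟨walk_arcPos hT x j e', endLabel_arcPos hT he'⟩
      exact ⟨t, t', h3, h4, h5.1, h6.1, h5.2, h6.2⟩
    split_ifs at hl with hj
    · rw [Finset.mem_insert, Finset.mem_singleton] at hl
      rcases hl with hl | hl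
      · obtain ⟨e, e', h1, h2, h3⟩ : ∃ e e' : Fin 3, e ≠ e' ∧ e ≠ x.2 ∧ e' ≠ x.2 := by
          generalize x.2 = f
          revert f
          decide
        exact key e e' h1 (fun h => h2 (congrArg Prod.snd h)) (fun h => h3 (congrArg Prod.snd h)) hl
      · rw [hj, hl]
        exact ⟨0, 3 * 3, by norm_num, le_rfl, rfl, walk_sq hT x, endLabel_zero, endLabel_last⟩
    · exact key 0 1 (by decide) (fun h => hj (congrArg Prod.fst h))
        (fun h => hj (congrArg Prod.fst h)) (Finset.mem_singleton.1 hl)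

/-- The inner occurrences of the start letter form a class of size two, while the three exits of any
other letter share one variable. So the pattern shows which class belongs to the start letter. -/
theorem endLabel_respects (hT : IsFullCycle (stepPerm T)) (hT' : IsFullCycle (stepPerm T'))
    (hcode : labelCode (walk T x) endLabel = labelCode (walk T' x') endLabel) {t t' : ℕ}
    (ht : t ≤ 3 * 3) (ht' : t' ≤ 3 * 3) (h : walk T x t = walk T x t') :
    walk T' x' t = walk T' x' t' := by
  have hstart : ∀ t ≤ 3 * 3, walk T x t = x.1 → walk T' x' t = x'.1 := by
    intro t ht hw
    by_cases h0 : t = 0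
    · rw [h0]; rfl
    by_cases h9 : t = 3 * 3
    · rw [h9]; exact walk_sq hT' x'
    by_contra hne
    have h1 : labelClass (walk T x) endLabel t ⊆
        (Finset.univ.erase x.2).image fun e => arcPos hT x x.1 e := by
      intro u hu
      rw [mem_labelClass, endLabel_of_ne h0 h9, hw] at hu
      have hu0 : u ≠ 0 := by
        rintro rfl
        rw [endLabel_zero] at hu
        exact absurd hu.2.2 (by decide)
      have hu9 : u ≠ 3 * 3 := by
        rintro rfl
        rw [endLabel_last] at hu
        exact absurd hu.2.2 (by decide)
      have hlt : u < 3 * 3 := lt_of_le_of_ne hu.1 hu9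
      have h2 := arcPos_eq hT x hlt hu.2.1 rfl
      refine Finset.mem_image.2 ⟨walk T x (u + 1), Finset.mem_erase.2 ⟨fun h => ?_,
        Finset.mem_univ _⟩, h2⟩
      rw [h, arcPos_self] at h2
      exact hu0 h2.symm
    have h2 : (Finset.univ.image fun e => arcPos hT' x' (walk T' x' t) e) ⊆
        labelClass (walk T' x') endLabel t := by
      intro u hu
      obtain ⟨e, -, rfl⟩ := Finset.mem_image.1 hu
      rw [mem_labelClass, walk_arcPos, endLabel_of_ne h0 h9,
        endLabel_arcPos hT' (c := walk T' x' t) (e := e) fun h => hne (Prod.ext_iff.1 h).1]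
      exact ⟨(arcPos_lt hT' x' _ _).le, rfl, rfl⟩
    have h3 := Finset.card_le_card h1
    have h4 := Finset.card_le_card h2
    rw [Finset.card_image_of_injective _ fun e e' h => (arcPos_inj hT x h).2,
      Finset.card_erase_of_mem (Finset.mem_univ _), labelClass_eq_of_code_eq hcode ht] at h3
    rw [Finset.card_image_of_injective _ fun e e' h => (arcPos_inj hT' x' h).2] at h4
    have h5 := h4.trans h3
    simp at h5
  by_cases hw : walk T x t = x.1
  · rw [hstart t ht hw, hstart t' ht' (h ▸ hw)]
  · have hlab : ∀ u, walk T x u ≠ x.1 → endLabel u = 0 := fun u hu => endLabel_of_ne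
      (by rintro rfl; exact hu rfl) (by rintro rfl; exact hu (walk_sq hT x))
    exact ((labelCode_eq_labelCode hcode ht ht').1 ⟨h, by rw [hlab t hw, hlab t' (h ▸ hw)]⟩).1

/-- There are at least `24` transition systems and `9` first arcs, and at most `6` circuits per
pattern: `24 * 9 / 6 = 36`, without any slack. -/
theorem factorial_pow_le_ncard_PiDB_three : 3 ! ^ (3 - 1) ≤ (PiDB 3).ncard := by
  have h1 := card_le_mul_ncard_of_fiber_le (B := 3 !)
    (fun d : {T : Fin 3 → Perm (Fin 3) // IsFullCycle (stepPerm T)} × (Fin 3 × Fin 3) =>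
      labelCode (walk d.1.1 d.2) endLabel) (finite_PiDB (by norm_num))
    (fun d => endLabel_mem_PiDB d.1.2 d.2) fun d₀ => by
      refine card_le_factorial_of_renaming (fun d => d.1.1.1) (fun d => d.1.2)
        (fun d => d.1.1.2) (fun d d' h h' => Subtype.ext (Prod.ext (Subtype.ext h) h'))
        (walk d₀.1.1 d₀.2) fun d => ?_
      exact exists_renaming_of_respects d₀.1.2 d.1.1.2 fun t ht t' ht' h =>
        endLabel_respects d₀.1.2 d.1.1.2 d.2.symm ht ht' h
  have h2 := factorial_pow_le_card_eulerian (k := 3) (by norm_num)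
  rw [Nat.card_prod, Nat.card_prod, Nat.card_eq_fintype_card (α := Fin 3), Fintype.card_fin] at h1
  have h3 : 3 ! = 6 := rfl
  rw [h3] at h1 h2 ⊢
  norm_num at h1 h2 ⊢
  omega

end three

/-! ### Five letters. -/

section five

/-- A partition of the exits of a letter into two classes. -/
def IsSplit (u : Fin 5 → Fin 3) : Prop :=
  (Finset.univ.filter fun e => u e = 0).card = 2 ∧ (Finset.univ.filter fun e => u e = 1).card = 3

/-- A partition of the exits of the first letter into three classes, the first of which is to be
completed by the last position. -/
def IsStartSplit (f : Fin 5) (u : Fin 5 → Fin 3) : Prop :=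
  u f = 1 ∧ (Finset.univ.filter fun e => u e = 0).card = 1 ∧
    (Finset.univ.filter fun e => u e = 1).card = 2

instance : DecidablePred IsSplit := fun _ => inferInstanceAs (Decidable (_ ∧ _))

instance (f : Fin 5) : DecidablePred (IsStartSplit f) :=
  fun _ => inferInstanceAs (Decidable (_ ∧ _ ∧ _))

theorem card_isSplit : (Finset.univ.filter IsSplit).card = 10 := by
  decide +kernel

theorem card_isStartSplit : ∀ f, (Finset.univ.filter (IsStartSplit f)).card = 12 := by
  decide +kernel

theorem card_fibers (u : Fin 5 → Fin 3) :
    (Finset.univ.filter fun e => u e = 0).card + (Finset.univ.filter fun e => u e = 1).card +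
      (Finset.univ.filter fun e => u e = 2).card = 5 := by
  have := Finset.card_eq_sum_card_fiberwise (f := u) (s := Finset.univ) (t := Finset.univ) (by simp)
  rw [Fin.sum_univ_three] at this
  simpa using this.symm

theorem IsSplit.ne_two {u : Fin 5 → Fin 3} (h : IsSplit u) (e : Fin 5) : u e ≠ 2 := by
  intro he
  have h1 := card_fibers u
  rw [h.1, h.2] at h1
  have h2 : 0 < (Finset.univ.filter fun e => u e = 2).card :=
    Finset.card_pos.2 ⟨e, by simpa using he⟩
  omega

theorem IsSplit.eq_of_respects {u v : Fin 5 → Fin 3} (hu : IsSplit u) (hv : IsSplit v)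
    (h : ∀ e e', u e = u e' ↔ v e = v e') : u = v := by
  have key : ∀ u : Fin 5 → Fin 3, IsSplit u → ∀ e,
      u e = if (Finset.univ.filter fun e' => u e = u e').card = 2 then 0 else 1 := by
    intro u hu e
    have h1 : (Finset.univ.filter fun e' => u e = u e') =
        Finset.univ.filter fun e' => u e' = u e := by
      simp only [eq_comm]
    rw [h1]
    have h2 := hu.ne_two e
    generalize hl : u e = l at h2
    fin_cases l
    · exact (if_pos hu.1).symm
    · exact (if_neg (by change ¬ (Finset.univ.filter fun e => u e = 1).card = 2; rw [hu.2]; decide)).symm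
    · exact absurd rfl h2
  funext e
  rw [key u hu e, key v hv e]
  simp only [h]

/-- A choice of a partition of the exits for each letter. -/
def IsSplitChoice (x : Fin 5 × Fin 5) (u : Fin 5 → Fin 5 → Fin 3) : Prop :=
  IsStartSplit x.2 (u x.1) ∧ ∀ c, c ≠ x.1 → IsSplit (u c)

theorem card_isSplitChoice (x : Fin 5 × Fin 5) :
    12 * 10 ^ 4 ≤ Nat.card {u // IsSplitChoice x u} := by
  classical
  set S : Finset (Fin 5 → Fin 5 → Fin 3) := Fintype.piFinset fun c =>
    if c = x.1 then Finset.univ.filter (IsStartSplit x.2) else Finset.univ.filter IsSplit with hS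
  have h1 : S.card = 12 * 10 ^ 4 := by
    rw [hS, Fintype.card_piFinset, ← Finset.mul_prod_erase _ _ (Finset.mem_univ x.1), if_pos rfl,
      card_isStartSplit, Finset.prod_congr rfl (g := fun _ => 10), Finset.prod_const,
      Finset.card_erase_of_mem (Finset.mem_univ _), Finset.card_univ, Fintype.card_fin]
    intro c hc
    rw [if_neg (Finset.ne_of_mem_erase hc), card_isSplit]
  rw [← h1, Nat.card_eq_fintype_card, Fintype.card_subtype]
  refine Finset.card_le_card fun u hu => ?_
  rw [hS, Fintype.mem_piFinset] at hu
  suffices h : IsSplitChoice x u by simpa only [Finset.mem_filter, Finset.mem_univ, true_and]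
  refine ⟨?_, fun c hc => ?_⟩
  · have := hu x.1
    rw [if_pos rfl] at this
    exact (Finset.mem_filter.1 this).2
  · have := hu c
    rw [if_neg hc] at this
    exact (Finset.mem_filter.1 this).2

/-- The labelling for five letters by the class of the next letter. -/
def splitLabel (w : ℕ → Fin 5) (u : Fin 5 → Fin 5 → Fin 3) (t : ℕ) : Fin 3 :=
  if t < 5 * 5 then u (w t) (w (t + 1)) else 0

variable {T : Fin 5 → Perm (Fin 5)} {x : Fin 5 × Fin 5} {u u' : Fin 5 → Fin 5 → Fin 3}

theorem splitLabel_arcPos (hT : IsFullCycle (stepPerm T)) (c e : Fin 5) :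
    splitLabel (walk T x) u (arcPos hT x c e) = u c e := by
  rw [splitLabel, if_pos (arcPos_lt hT x c e), walk_arcPos, walk_arcPos_succ]

theorem splitLabel_last (w : ℕ → Fin 5) : splitLabel w u (5 * 5) = 0 := if_neg (lt_irrefl _)

theorem splitLabel_mem_PiDB (hT : IsFullCycle (stepPerm T)) (hu : IsSplitChoice x u) :
    labelCode (walk T x) (splitLabel (walk T x) u) ∈ PiDB 5 := by
  refine labelCode_mem_PiDB (wordOf_walk_mem hT x)
    (fun j => if j = x.1 then Finset.univ else {0, 1}) ?_ ?_ ?_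
  · intro j
    rw [count_wordOf_walk hT]
    split_ifs <;> rfl
  · intro t ht
    split_ifs with h
    · exact Finset.mem_univ _
    · have hlt : t < 5 * 5 := by
        refine lt_of_le_of_ne ht ?_
        rintro rfl
        exact h (walk_sq hT x)
      rw [splitLabel, if_pos hlt]
      have := (hu.2 _ h).ne_two (walk T x (t + 1))
      generalize u (walk T x t) (walk T x (t + 1)) = l at this
      revert l
      decide
  · intro j l hl
    have key : 1 < (Finset.univ.filter fun e => u j e = l).card → ∃ t t', t < t' ∧ t' ≤ 5 * 5 ∧
        walk T x t = j ∧ walk T x t' = j ∧ splitLabel (walk T x) u t = l ∧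
          splitLabel (walk T x) u t' = l := by
      intro hcard
      obtain ⟨e, he, e', he', hee⟩ := Finset.one_lt_card.1 hcard
      rw [Finset.mem_filter] at he he'
      obtain ⟨t, t', h3, h4, h5, h6⟩ := exists_lt_of_ne
        (P := fun t => walk T x t = j ∧ splitLabel (walk T x) u t = l)
        (fun h => hee (arcPos_inj hT x h).2) (arcPos_lt hT x j e).le (arcPos_lt hT x j e').le
        ⟨walk_arcPos hT x j e, by rw [splitLabel_arcPos, he.2]⟩
        ⟨walk_arcPos hT x j e', by rw [splitLabel_arcPos, he'.2]⟩
      exact ⟨t, t', h3, h4, h5.1, h6.1, h5.2, h6.2⟩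
    split_ifs at hl with hj
    · subst hj
      obtain ⟨h1, h2, h3⟩ := hu.1
      have h4 := card_fibers (u x.1)
      fin_cases l
      · obtain ⟨e, he⟩ := Finset.card_pos.1 (h2.symm ▸ one_pos :
          0 < (Finset.univ.filter fun e => u x.1 e = 0).card)
        exact ⟨arcPos hT x x.1 e, 5 * 5, arcPos_lt hT x _ _, le_rfl, walk_arcPos hT x _ _,
          walk_sq hT x, by rw [splitLabel_arcPos]; exact (Finset.mem_filter.1 he).2,
          splitLabel_last _⟩
      · exact key (by change 1 < (Finset.univ.filter fun e => u x.1 e = 1).card; omega)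
      · exact key (by change 1 < (Finset.univ.filter fun e => u x.1 e = 2).card; omega)
    · obtain ⟨h1, h2⟩ := hu.2 j hj
      rw [Finset.mem_insert, Finset.mem_singleton] at hl
      rcases hl with rfl | rfl
      · exact key (by omega)
      · exact key (by omega)

/-- The names of the classes are normalised: at the start letter, `0` is the class of the final
position and `1` that of the first arc; elsewhere the sizes two and three tell them apart. -/
theorem splitChoice_eq_of_code_eq (hT : IsFullCycle (stepPerm T)) (hu : IsSplitChoice x u)
    (hu' : IsSplitChoice x u')
    (hcode : labelCode (walk T x) (splitLabel (walk T x) u) =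
      labelCode (walk T x) (splitLabel (walk T x) u')) : u = u' := by
  have h1 : ∀ c e e', u c e = u c e' ↔ u' c e = u' c e' := by
    intro c e e'
    have := labelCode_eq_labelCode hcode (arcPos_lt hT x c e).le (arcPos_lt hT x c e').le
    simpa only [walk_arcPos, splitLabel_arcPos, true_and] using this
  funext c
  by_cases hc : c = x.1
  · subst hc
    funext e
    have h0 : u x.1 e = 0 ↔ u' x.1 e = 0 := by
      have := labelCode_eq_labelCode hcode (arcPos_lt hT x x.1 e).le le_rfl
      simpa only [walk_arcPos, walk_sq hT, splitLabel_arcPos, splitLabel_last, true_and] using this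
    have h2 := h1 x.1 e x.2
    rw [hu.1.1, hu'.1.1] at h2
    generalize u x.1 e = a at h0 h2
    generalize u' x.1 e = b at h0 h2
    revert a b
    decide
  · exact (hu.2 c hc).eq_of_respects (hu'.2 c hc) (h1 c)

/-- There are `11` variables, one of which needs no letter, so a pattern has at most `5 ^ 10`
preimages. The data number at least `12 * 10 ^ 4 * 120 ^ 5`, and `12 * 10 ^ 4 * 120 > 5 ^ 10`. -/
theorem factorial_pow_le_ncard_PiDB_five : 5 ! ^ (5 - 1) ≤ (PiDB 5).ncard := by
  let D := Σ x : Fin 5 × Fin 5, {u : Fin 5 → Fin 5 → Fin 3 // IsSplitChoice x u} ×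
    {T : Fin 5 → Perm (Fin 5) // IsFullCycle (stepPerm T)}
  have h1 := card_le_mul_ncard_of_fiber_le (B := 5 ^ 10)
    (fun d : D => labelCode (walk d.2.2.1 d.1) (splitLabel (walk d.2.2.1 d.1) d.2.1.1))
    (finite_PiDB (by norm_num)) (fun d => splitLabel_mem_PiDB d.2.2.2 d.2.1.2) fun d₀ => by
      refine card_le_pow_of_code_eq
        (vars_card_of_mem_PiDB (by norm_num) (splitLabel_mem_PiDB d₀.2.2.2 d₀.2.1.2))
        (fun d => d.1.2.2.1) (fun d => d.1.1)
        (fun d => splitLabel (walk d.1.2.2.1 d.1.1) d.1.2.1.1) (fun d => d.2)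
        (fun d => d.1.2.2.2) (fun d => ?_) ?_
      · rw [splitLabel_last, splitLabel, if_pos (by norm_num)]
        change d.1.2.1.1 d.1.1.1 d.1.1.2 ≠ 0
        rw [d.1.2.1.2.1.1]
        decide
      · rintro ⟨⟨x, ⟨u, hu⟩, ⟨T, hT⟩⟩, hc⟩ ⟨⟨x', ⟨u', hu'⟩, ⟨T', hT'⟩⟩, hc'⟩ e1 e2
        dsimp only at e1 e2
        subst e1 e2
        obtain rfl := splitChoice_eq_of_code_eq hT hu hu' (hc.trans hc'.symm)
        rfl
  have h2 := factorial_pow_le_card_eulerian (k := 5) (by norm_num)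
  have h3 : Nat.card (Fin 5 × Fin 5) * (12 * 10 ^ 4 *
      Nat.card {T : Fin 5 → Perm (Fin 5) // IsFullCycle (stepPerm T)}) ≤ Nat.card D := by
    refine card_mul_le_card_sigma fun x => ?_
    rw [Nat.card_prod]
    exact Nat.mul_le_mul_right _ (card_isSplitChoice x)
  rw [Nat.card_prod, Nat.card_eq_fintype_card (α := Fin 5), Fintype.card_fin] at h3
  have h4 : 5 ! = 120 := rfl
  rw [h4] at h2 ⊢
  norm_num at h1 h2 h3 ⊢
  omega

end five

/-! ### The theorem. -/

theorem factorial_pow_le_ncard_PiDB {k : ℕ} (hk : 1 ≤ k) : k ! ^ (k - 1) ≤ (PiDB k).ncard := by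
  rcases Nat.even_or_odd k with he | ⟨h, rfl⟩
  · exact factorial_pow_le_ncard_PiDB_of_even hk he
  · rcases Nat.lt_or_ge h 3 with h3 | h3
    · interval_cases h
      · exact (Set.ncard_pos (finite_PiDB le_rfl)).2 PiDB_one_nonempty
      · exact factorial_pow_le_ncard_PiDB_three
      · exact factorial_pow_le_ncard_PiDB_five
    · exact factorial_pow_le_ncard_PiDB_of_odd rfl h3

theorem theorem13 (k : ℕ) (hk : 1 ≤ k) :
    k.factorial ^ (k - 1) ≤ (PiDB k).ncard ∧
      ∀ α ∈ PiDB k, α.vars.card = (k - 1) * (k / 2) + (k + 1) / 2 :=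
  ⟨factorial_pow_le_ncard_PiDB hk, fun _ hα => vars_card_of_mem_PiDB hk hα⟩
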